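/- Infinite chess is played on the board $\mathbb{Z}\times\mathbb{Z}$ with the usual pieces and rules of movement, except that there is no promotion, no castling, no en passant and no double step of pawns. A board position assigns to each square a piece or nothing; a position is a board position together with the player to move, where each side has at most one king and the king of the player not to move is not under attack. A play ends with checkmate, which wins, or with stalemate, which is a draw; infinite play is a draw. A strategy for a player from a position is a function that, given the finite sequence of moves made so far, yields a legal move for that player whenever it is the player's turn and the game is not over. It is computable if this function is Turing computable, and it is winning if it defeats every strategy of the opponent. **Theorem.** There is a position in infinite chess such that: 1. The position is computable, that is, its board position is a Turing computable function; moreover its game tree, the set of finite sequences of legal moves from the position, is decidable. 2. In the category of computable play, the position is a win for white: white has a computable strategy that defeats every computable strategy for black (and black does have computable strategies). 3. In the category of arbitrary play, the position is a draw: neither player has a winning strategy, and each player can force a draw, that is, each player has a strategy with which the play against any strategy of the opponent is a draw. -/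

import Mathlib

namespace InfiniteChess

inductive Color where
  | white
  | black
deriving DecidableEq

inductive Kind where
  | king
  | queen
  | rook
  | bishop
  | knight
  | pawn
deriving DecidableEq

/-- The opponent. -/
def Color.other : Color → Color
  | .white => .black
  | .black => .white

/-- A chess piece: its colour and its kind. -/
abbrev Piece : Type := Color × Kind

/-- A square of the infinite board: its file (growing to the right) and its rank (growing upward). -/
abbrev Square : Type := ℤ × ℤ

/-- A board position: to each square either a piece or nothing. -/
abbrev Board : Type := Square → Option Piece

/-- A move, given by the square a piece leaves and the square it goes to. There is no promotion,
no castling and no en passant, so this determines what happens on the board. -/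
abbrev Move : Type := Square × Square

/-! ### Codings of the finite data, for computability -/

def colorEquivBool : Color ≃ Bool where
  toFun
    | .white => true
    | .black => false
  invFun
    | true => .white
    | false => .black
  left_inv c := by cases c <;> rfl
  right_inv b := by cases b <;> rfl

def kindEquivFin : Kind ≃ Fin 6 where
  toFun
    | .king => 0
    | .queen => 1
    | .rook => 2
    | .bishop => 3
    | .knight => 4
    | .pawn => 5
  invFun
    | 0 => .king
    | 1 => .queen
    | 2 => .rook
    | 3 => .bishop
    | 4 => .knight
    | 5 => .pawn
  left_inv k := by cases k <;> rfl
  right_inv i := by fin_cases i <;> rfl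

instance : Primcodable Color := Primcodable.ofEquiv Bool colorEquivBool

instance : Primcodable Kind := Primcodable.ofEquiv (Fin 6) kindEquivFin

/-! ### Movement of the pieces -/

/-- The four orthogonal directions. -/
def rookDirs : Set (ℤ × ℤ) := {(1, 0), (-1, 0), (0, 1), (0, -1)}

/-- The four diagonal directions. -/
def bishopDirs : Set (ℤ × ℤ) := {(1, 1), (1, -1), (-1, 1), (-1, -1)}

/-- Some square-by-square walk from `s` in a direction of `D` reaches `t` after at least one step,
and all squares strictly in between are empty. -/
def Slides (D : Set (ℤ × ℤ)) (b : Board) (s t : Square) : Prop :=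
  ∃ d ∈ D, ∃ n : ℕ, t = s + ((n : ℤ) + 1) • d ∧ ∀ k < n, b (s + ((k : ℤ) + 1) • d) = none

/-- The direction in which pawns advance: upward for white, downward for black. -/
def Color.forward : Color → ℤ
  | .white => 1
  | .black => -1

/-- `Attacks b x s t`: a piece `x` standing on `s` attacks the square `t`. -/
def Attacks (b : Board) : Piece → Square → Square → Prop
  | (_, .king), s, t => t - s ∈ rookDirs ∪ bishopDirs
  | (_, .queen), s, t => Slides (rookDirs ∪ bishopDirs) b s t
  | (_, .rook), s, t => Slides rookDirs b s t
  | (_, .bishop), s, t => Slides bishopDirs b s t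
  | (_, .knight), s, t =>
      (|t.1 - s.1| = 1 ∧ |t.2 - s.2| = 2) ∨ (|t.1 - s.1| = 2 ∧ |t.2 - s.2| = 1)
  | (c, .pawn), s, t => |t.1 - s.1| = 1 ∧ t.2 = s.2 + c.forward

/-- Colour `c` has a king that is attacked by an opposing piece. -/
def InCheck (b : Board) (c : Color) : Prop :=
  ∃ s t k, b s = some (c.other, k) ∧ b t = some (c, .king) ∧ Attacks b (c.other, k) s t

/-- The piece `x` on `s` can move to `t`, where the safety of the own king is disregarded: either it
captures an opposing piece on an attacked square, or it goes to an empty square, which for a pawn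
is the square in front of it and for other pieces an attacked square. -/
def CanMove (b : Board) (x : Piece) (s t : Square) : Prop :=
  (Attacks b x s t ∧ ∃ k, b t = some (x.1.other, k)) ∨
  (b t = none ∧
    if x.2 = .pawn then t = (s.1, s.2 + x.1.forward) else Attacks b x s t)

/-- The board after the content of `m.1` has been carried to `m.2`. -/
def Board.move (b : Board) (m : Move) : Board :=
  fun q => if q = m.2 then b m.1 else if q = m.1 then none else b q

/-! ### Positions, legal moves, end of the game -/

/-- A position: a board position and the player whose turn it is. -/
structure Position where
  board : Board
  turn : Color

namespace Position

/-- The position after the move `m`. -/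
def move (p : Position) (m : Move) : Position :=
  ⟨p.board.move m, p.turn.other⟩

/-- The move `m` is legal: the player whose turn it is moves a piece of his own, and his king
is not attacked afterwards. -/
def Legal (p : Position) (m : Move) : Prop :=
  (∃ k, p.board m.1 = some (p.turn, k) ∧ CanMove p.board (p.turn, k) m.1 m.2) ∧
  ¬ InCheck (p.move m).board p.turn

/-- Colour `c` is checkmated: it is to move, in check, and without a legal move. -/
def Checkmated (p : Position) (c : Color) : Prop :=
  p.turn = c ∧ InCheck p.board c ∧ ∀ m, ¬ p.Legal m

/-- Each side has at most one king, and the player who has just moved has not left his king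
under attack. -/
def Proper (p : Position) : Prop :=
  (∀ c s t, p.board s = some (c, .king) → p.board t = some (c, .king) → s = t) ∧
  ¬ InCheck p.board p.turn.other

/-! ### Plays and strategies -/

/-- The position reached from `p` by a finite sequence of moves (in chronological order). -/
def after (p : Position) : List Move → Position
  | [] => p
  | m :: h => (p.move m).after h

/-- The sequence of moves is a finite play from `p`: every move of it is legal. -/
def IsPlay (p : Position) : List Move → Prop
  | [] => True
  | m :: h => p.Legal m ∧ (p.move m).IsPlay h

/-- In the sequence `h` of moves from `p`, each move of the player `c` is the one that
`f` gives on the moves before it. -/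
def Follows (p : Position) (c : Color) (f : List Move → Move) (h : List Move) : Prop :=
  ∀ g m, (g ++ [m]) <+: h → (p.after g).turn = c → m = f g

/-- `f` is a strategy for `c` from `p`: it gives a legal move at each finite play from `p` in which
`c` has followed it, `c` is to move, and the game is not over (neither checkmate nor stalemate,
that is, there is a legal move). -/
def IsStrategy (p : Position) (c : Color) (f : List Move → Move) : Prop :=
  ∀ h, p.IsPlay h → p.Follows c f h → (p.after h).turn = c →
    (∃ m, (p.after h).Legal m) → (p.after h).Legal (f h)

/-- In the play from `p` where white plays by `w` and black by `b`, the player `c` is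
checkmated at some finite stage. -/
def Mates (p : Position) (w b : List Move → Move) (c : Color) : Prop :=
  ∃ h, p.IsPlay h ∧ p.Follows .white w h ∧ p.Follows .black b h ∧ (p.after h).Checkmated c

/-- White wins the play of `w` (white) against `b` (black). -/
def WhiteWins (p : Position) (w b : List Move → Move) : Prop := p.Mates w b .black

/-- Black wins the play of `w` (white) against `b` (black). -/
def BlackWins (p : Position) (w b : List Move → Move) : Prop := p.Mates w b .white

/-- The play of `w` (white) against `b` (black) is a draw: it goes on forever or ends in
stalemate. -/
def IsDraw (p : Position) (w b : List Move → Move) : Prop :=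
  ¬ p.WhiteWins w b ∧ ¬ p.BlackWins w b

end Position

end InfiniteChess

/-!
The position encodes a pair of computably inseparable sets: the sets of the `n` such that the
`n`-th program, run on its own number, outputs `0`, respectively `1`. For each `n` there is a
gadget with two rooms, and the left (right) room contains a white rook if and only if the output
is `0` (is `1`). The rook stands at a height given by the number of steps of the computation, so
that the content of a square is decided by a bounded simulation and the board is computable. The
exit of each room is guarded by a black pawn, and a white pawn can be advanced to a square where
it attacks both guards of its gadget. In this way white asks black which of the two guards he is
willing to give up: if one of the guards takes the pawn, then it leaves its exit unguarded, and if
none does, then the pawn takes the left guard.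

The black king sits in a prison where it can be attacked only along its own file, from below, by a
rook that has escaped; then it is mate at once. White has no king, so black cannot win. Since the
prison remains intact, legality of a move depends only on finitely many squares that can be
computed from the play (`legal_white_turn`, `legal_black_turn`), and therefore the game tree is
decidable. A spare black pawn, far from everything else, always has a move.

* In arbitrary play black draws: he answers every question by taking the pawn with the guard that
  is not needed, and takes a rook that comes to a guarded exit (`GuardInv.exists_reply`). White
  draws by waiting moves (`isDraw_idleWhite`).
* White's computable plan `whitePlan` asks all the questions one after the other, while it
  searches for a rook in a room whose exit black has given up. When such a rook is found, it goes
  to the exit, from there to a rank below all black pawns, and along this rank to the file of the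
  king (`Attack.white_move`, `Attack.checkmated`). If the plan did not win against a computable
  `b`, then the answers of `b` along the resulting infinite play would be computable. A program
  which outputs `1` if `b` answers the question about `n` with the right guard, and `0` otherwise,
  run on its own number, then has a rook in the very room that `b` opens (`whiteWins_whitePlan`).
-/

namespace InfiniteChess

open Nat.Partrec (Code)

/-! ### Integers and primitive recursion -/

theorem primrec_int_toNat : Primrec Int.toNat := by
  have h : Primrec fun e : ℕ => if e % 2 = 0 then e / 2 else 0 :=
    Primrec.ite (Primrec.eq.comp (Primrec.nat_mod.comp Primrec.id (Primrec.const 2))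
      (Primrec.const 0)) (Primrec.nat_div.comp Primrec.id (Primrec.const 2)) (Primrec.const 0)
  refine (h.comp (Primrec.encode (α := ℤ))).of_eq fun z => ?_
  cases z with
  | ofNat n =>
    have : Encodable.encode (Int.ofNat n) = 2 * n := rfl
    simp only [this]
    split_ifs <;> simp; omega
  | negSucc n =>
    have : Encodable.encode (Int.negSucc n) = 2 * n + 1 := rfl
    simp only [this]
    split_ifs <;> omega

theorem primrec_int_negToNat : Primrec fun z : ℤ => (-z).toNat := by
  have h : Primrec fun e : ℕ => if e % 2 = 0 then 0 else e / 2 + 1 :=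
    Primrec.ite (Primrec.eq.comp (Primrec.nat_mod.comp Primrec.id (Primrec.const 2))
      (Primrec.const 0)) (Primrec.const 0)
      (Primrec.succ.comp (Primrec.nat_div.comp Primrec.id (Primrec.const 2)))
  refine (h.comp (Primrec.encode (α := ℤ))).of_eq fun z => ?_
  cases z with
  | ofNat n =>
    have : Encodable.encode (Int.ofNat n) = 2 * n := rfl
    simp only [this]
    split_ifs <;> simp; omega
  | negSucc n =>
    have : Encodable.encode (Int.negSucc n) = 2 * n + 1 := rfl
    simp only [this]
    split_ifs <;> omega

theorem primrec_int_subNat : Primrec₂ fun a b : ℕ => (a : ℤ) - b := by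
  have h : Primrec fun p : ℕ × ℕ => Denumerable.ofNat ℤ
      (if p.2 ≤ p.1 then 2 * (p.1 - p.2) else 2 * (p.2 - p.1 - 1) + 1) :=
    (Primrec.ofNat ℤ).comp (Primrec.ite (Primrec.nat_le.comp Primrec.snd Primrec.fst)
      (Primrec.nat_double.comp (Primrec.nat_sub.comp Primrec.fst Primrec.snd))
      (Primrec.nat_double_succ.comp (Primrec.nat_sub.comp
        (Primrec.nat_sub.comp Primrec.snd Primrec.fst) (Primrec.const 1))))
  refine Primrec.of_eq h fun p => ?_
  have key : ∀ z : ℤ, ∀ e, Encodable.encode z = e → Denumerable.ofNat ℤ e = z := by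
    rintro z e rfl; exact Denumerable.ofNat_encode z
  rcases p with ⟨a, b⟩
  dsimp only
  split_ifs with hab
  · obtain ⟨d, rfl⟩ := Nat.exists_eq_add_of_le hab
    have : Encodable.encode (Int.ofNat d) = 2 * d := rfl
    rw [Nat.add_sub_cancel_left, key _ _ this]
    simp
  · obtain ⟨d, rfl⟩ := Nat.exists_eq_add_of_lt (not_le.1 hab)
    have : Encodable.encode (Int.negSucc d) = 2 * d + 1 := rfl
    have e : a + d + 1 - a - 1 = d := by omega
    rw [e, key _ _ this]
    omega

theorem primrec_int_natCast : Primrec fun a : ℕ => (a : ℤ) :=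
  (primrec_int_subNat.comp Primrec.id (Primrec.const 0)).of_eq fun a => by simp

theorem primrec_int_add : Primrec₂ fun a b : ℤ => a + b := by
  have h : Primrec fun p : ℤ × ℤ => (((p.1.toNat + p.2.toNat : ℕ) : ℤ) -
      (((-p.1).toNat + (-p.2).toNat : ℕ) : ℤ)) :=
    primrec_int_subNat.comp
      (Primrec.nat_add.comp (primrec_int_toNat.comp Primrec.fst)
        (primrec_int_toNat.comp Primrec.snd))
      (Primrec.nat_add.comp (primrec_int_negToNat.comp Primrec.fst)
        (primrec_int_negToNat.comp Primrec.snd))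
  refine Primrec.of_eq h fun p => ?_
  dsimp only
  omega

theorem primrec_int_neg : Primrec fun a : ℤ => -a :=
  (primrec_int_subNat.comp primrec_int_negToNat primrec_int_toNat).of_eq fun a => by omega

theorem primrec_int_sub : Primrec₂ fun a b : ℤ => a - b :=
  (primrec_int_add.comp₂ Primrec₂.left (primrec_int_neg.comp₂ Primrec₂.right)).of_eq
    fun a b => by omega

theorem primrec_int_natAbs : Primrec Int.natAbs :=
  (Primrec.nat_add.comp primrec_int_toNat primrec_int_negToNat).of_eq fun a => by omega

theorem primrec_int_le : PrimrecRel fun a b : ℤ => a ≤ b := by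
  have h : PrimrecRel fun a b : ℤ => (a - b).toNat = 0 :=
    Primrec.eq.comp₂ (primrec_int_toNat.comp₂ primrec_int_sub) (Primrec₂.const 0)
  exact h.of_eq fun a b => by omega

theorem primrec_int_lt : PrimrecRel fun a b : ℤ => a < b := by
  have h : PrimrecRel fun a b : ℤ => a + 1 ≤ b :=
    primrec_int_le.comp₂ (primrec_int_add.comp₂ Primrec₂.left (Primrec₂.const 1)) Primrec₂.right
  exact h.of_eq fun a b => by omega

/-! ### The starting position -/

abbrev whitePawn : Option Piece := some (.white, .pawn)
abbrev whiteRook : Option Piece := some (.white, .rook)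
abbrev whiteBishop : Option Piece := some (.white, .bishop)
abbrev blackPawn : Option Piece := some (.black, .pawn)
abbrev blackKing : Option Piece := some (.black, .king)

/-- The `n`-th program, run on its own number, is seen to output `v` after `s + 1` steps of
computation but not after `s` steps. -/
def HaltsAt (v n s : ℕ) : Prop :=
  Code.evaln (s + 1) (Denumerable.ofNat Code n) n = some v ∧
    Code.evaln s (Denumerable.ofNat Code n) n = none

instance (v n s : ℕ) : Decidable (HaltsAt v n s) := inferInstanceAs (Decidable (_ ∧ _))

/-- The prison of the black king. The king stands at `a = 0`, `z = 0`, where `a` is the distance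
from the king's file and `z` the rank relative to the king. All neighbouring squares are covered
by white pawns or occupied by one of the two black pawns at `a = 1`, `z = -1`. These cannot move:
the squares in front of them hold white pawns, and the squares at `a = 0` and `a = 2`, `z = -2`,
on which they could capture, are empty. The bishops below the latter keep white rooks out of them
and, unlike pawns, cannot step into them. The only way to attack the king is along its own file
from below. -/
def prison (a : ℕ) (z : ℤ) : Option Piece :=
  if a = 0 then if 1 ≤ z then whitePawn else if z = 0 then blackKing else none
  else if a = 1 then
    if 0 ≤ z then whitePawn else if z = -1 then blackPawn else if -4 ≤ z then whitePawn else none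
  else if a = 2 then if -1 ≤ z then whitePawn else if z = -3 then whiteBishop else none
  else if a = 3 then if -4 ≤ z then whitePawn else none
  else none

/-- The content of the `n`-th gadget in its file number `r < 8`, rank `y`. Files `0`, `2`, `6` are
walls, files `1` and `7` are the rooms of the rooks, the two black pawns on files `3` and `5` are
the guards of the exits `(2, 0)` and `(6, 0)`, and both attack the square `(4, 0)`, to which the
white pawn `(4, -1)` can advance. There is a rook on file `1` (file `7`) if and only if the `n`-th
program on input `n` outputs `0` (outputs `1`). -/
def gadget (n r : ℕ) (y : ℤ) : Option Piece :=
  if r = 0 then if 0 ≤ y then whitePawn else none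
  else if r = 1 then if y = -1 then whitePawn
    else if 1 ≤ y ∧ HaltsAt 0 n (y - 1).toNat then whiteRook else none
  else if r = 7 then if y = -1 then whitePawn
    else if 1 ≤ y ∧ HaltsAt 1 n (y - 1).toNat then whiteRook else none
  else if r = 4 then if y = -1 ∨ y = 5 then whitePawn else none
  else if r = 3 ∨ r = 5 then if y = 0 then whitePawn else if y = 1 then blackPawn else none
  else if 1 ≤ y then whitePawn else none

/-- The starting board: the prison around `(-10, 10)`, a black pawn at `(-30, 0)` which always has
a move, and the gadgets, the `n`-th one on the files `8 * n, …, 8 * n + 7`. -/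
def startBoard : Board := fun q =>
  if q.1 < 0 then
    if q.1 = -30 then if q.2 = 0 then blackPawn else none
    else prison (q.1 + 10).natAbs (q.2 - 10)
  else gadget (q.1.toNat / 8) (q.1.toNat % 8) q.2

/-- The starting position, with white to move. White has no king. -/
def start : Position := ⟨startBoard, .white⟩

theorem primrec_prison : Primrec₂ prison := by
  have a : Primrec fun p : ℕ × ℤ => p.1 := Primrec.fst
  have z : Primrec fun p : ℕ × ℤ => p.2 := Primrec.snd
  have le (k : ℤ) : PrimrecPred fun p : ℕ × ℤ => k ≤ p.2 :=
    primrec_int_le.comp (Primrec.const k) z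
  have eq (k : ℤ) : PrimrecPred fun p : ℕ × ℤ => p.2 = k := Primrec.eq.comp z (Primrec.const k)
  have aeq (k : ℕ) : PrimrecPred fun p : ℕ × ℤ => p.1 = k := Primrec.eq.comp a (Primrec.const k)
  have c (o : Option Piece) : Primrec fun _ : ℕ × ℤ => o := Primrec.const o
  exact Primrec.ite (aeq 0) (Primrec.ite (le 1) (c _) (Primrec.ite (eq 0) (c _) (c _)))
    (Primrec.ite (aeq 1) (Primrec.ite (le 0) (c _) (Primrec.ite (eq (-1)) (c _)
        (Primrec.ite (le (-4)) (c _) (c _))))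
      (Primrec.ite (aeq 2) (Primrec.ite (le (-1)) (c _) (Primrec.ite (eq (-3)) (c _) (c _)))
        (Primrec.ite (aeq 3) (Primrec.ite (le (-4)) (c _) (c _)) (c _))))

theorem primrecPred_haltsAt (v : ℕ) : PrimrecRel fun n s : ℕ => HaltsAt v n s := by
  have ev {α : Type} [Primcodable α] {f g : α → ℕ} (hf : Primrec f) (hg : Primrec g) :
      Primrec fun p : α => Code.evaln (f p) (Denumerable.ofNat Code (g p)) (g p) :=
    Code.primrec_evaln.comp (Primrec.pair (Primrec.pair hf ((Primrec.ofNat Code).comp hg)) hg)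
  have h1 : PrimrecPred fun p : ℕ × ℕ =>
      Code.evaln (p.2 + 1) (Denumerable.ofNat Code p.1) p.1 = some v :=
    Primrec.eq.comp (ev (Primrec.succ.comp Primrec.snd) Primrec.fst) (Primrec.const _)
  have h2 : PrimrecPred fun p : ℕ × ℕ =>
      Code.evaln p.2 (Denumerable.ofNat Code p.1) p.1 = none :=
    Primrec.eq.comp (ev Primrec.snd Primrec.fst) (Primrec.const _)
  exact (h1.and h2).primrecRel

theorem primrec_gadget : Primrec fun p : (ℕ × ℕ) × ℤ => gadget p.1.1 p.1.2 p.2 := by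
  have n : Primrec fun p : (ℕ × ℕ) × ℤ => p.1.1 := Primrec.fst.comp Primrec.fst
  have r : Primrec fun p : (ℕ × ℕ) × ℤ => p.1.2 := Primrec.snd.comp Primrec.fst
  have z : Primrec fun p : (ℕ × ℕ) × ℤ => p.2 := Primrec.snd
  have le (k : ℤ) : PrimrecPred fun p : (ℕ × ℕ) × ℤ => k ≤ p.2 :=
    primrec_int_le.comp (Primrec.const k) z
  have eq (k : ℤ) : PrimrecPred fun p : (ℕ × ℕ) × ℤ => p.2 = k :=
    Primrec.eq.comp z (Primrec.const k)
  have req (k : ℕ) : PrimrecPred fun p : (ℕ × ℕ) × ℤ => p.1.2 = k :=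
    Primrec.eq.comp r (Primrec.const k)
  have c (o : Option Piece) : Primrec fun _ : (ℕ × ℕ) × ℤ => o := Primrec.const o
  have hl (v : ℕ) : PrimrecPred fun p : (ℕ × ℕ) × ℤ => HaltsAt v p.1.1 (p.2 - 1).toNat :=
    (primrecPred_haltsAt v).comp n
      (primrec_int_toNat.comp (primrec_int_sub.comp z (Primrec.const 1)))
  exact Primrec.ite (req 0) (Primrec.ite (le 0) (c _) (c _))
    (Primrec.ite (req 1) (Primrec.ite (eq (-1)) (c _)
        (Primrec.ite ((le 1).and (hl 0)) (c _) (c _)))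
      (Primrec.ite (req 7) (Primrec.ite (eq (-1)) (c _)
          (Primrec.ite ((le 1).and (hl 1)) (c _) (c _)))
        (Primrec.ite (req 4) (Primrec.ite ((eq (-1)).or (eq 5)) (c _) (c _))
          (Primrec.ite ((req 3).or (req 5)) (Primrec.ite (eq 0) (c _)
              (Primrec.ite (eq 1) (c _) (c _)))
            (Primrec.ite (le 1) (c _) (c _))))))

theorem primrec_startBoard : Primrec startBoard := by
  have x : Primrec fun q : Square => q.1 := Primrec.fst
  have y : Primrec fun q : Square => q.2 := Primrec.snd
  have c (o : Option Piece) : Primrec fun _ : Square => o := Primrec.const o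
  have k (i : ℤ) : Primrec fun _ : Square => i := Primrec.const i
  have x8 : Primrec fun q : Square => q.1.toNat := primrec_int_toNat.comp x
  exact Primrec.ite (primrec_int_lt.comp x (k 0))
    (Primrec.ite (Primrec.eq.comp x (k (-30))) (Primrec.ite (Primrec.eq.comp y (k 0)) (c _) (c _))
      (primrec_prison.comp (primrec_int_natAbs.comp (primrec_int_add.comp x (k 10)))
        (primrec_int_sub.comp y (k 10))))
    (primrec_gadget.comp (Primrec.pair (Primrec.pair
      (Primrec.nat_div.comp x8 (Primrec.const 8)) (Primrec.nat_mod.comp x8 (Primrec.const 8))) y))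

/-! ### Moves in coordinates -/

theorem slides_rookDirs_iff {b : Board} {x y x' y' : ℤ} :
    Slides rookDirs b (x, y) (x', y') ↔
      (y' = y ∧ x < x' ∧ ∀ u, x < u → u < x' → b (u, y) = none) ∨
      (y' = y ∧ x' < x ∧ ∀ u, x' < u → u < x → b (u, y) = none) ∨
      (x' = x ∧ y < y' ∧ ∀ u, y < u → u < y' → b (x, u) = none) ∨
      (x' = x ∧ y' < y ∧ ∀ u, y' < u → u < y → b (x, u) = none) := by
  constructor
  · rintro ⟨d, hd, n, ht, hk⟩
    simp only [rookDirs, Set.mem_insert_iff, Set.mem_singleton_iff] at hd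
    rcases hd with rfl | rfl | rfl | rfl <;>
      simp only [Prod.mk_add_mk, Prod.smul_mk, smul_eq_mul, mul_one, mul_zero, mul_neg, add_zero,
        Prod.mk.injEq] at ht hk
    · refine .inl ⟨ht.2, by omega, fun u h1 h2 => ?_⟩
      have := hk (u - x - 1).toNat (by omega)
      rwa [show x + (((u - x - 1).toNat : ℤ) + 1) = u by omega] at this
    · refine .inr (.inl ⟨ht.2, by omega, fun u h1 h2 => ?_⟩)
      have := hk (x - u - 1).toNat (by omega)
      rwa [show x + -(((x - u - 1).toNat : ℤ) + 1) = u by omega] at this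
    · refine .inr (.inr (.inl ⟨ht.1, by omega, fun u h1 h2 => ?_⟩))
      have := hk (u - y - 1).toNat (by omega)
      rwa [show y + (((u - y - 1).toNat : ℤ) + 1) = u by omega] at this
    · refine .inr (.inr (.inr ⟨ht.1, by omega, fun u h1 h2 => ?_⟩))
      have := hk (y - u - 1).toNat (by omega)
      rwa [show y + -(((y - u - 1).toNat : ℤ) + 1) = u by omega] at this
  · rintro (⟨rfl, hx, h⟩ | ⟨rfl, hx, h⟩ | ⟨rfl, hx, h⟩ | ⟨rfl, hx, h⟩)
    · refine ⟨(1, 0), by simp [rookDirs], (x' - x - 1).toNat, ?_, fun k hk => ?_⟩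
      · ext <;> simp; omega
      · simpa using h (x + (k + 1)) (by omega) (by omega)
    · refine ⟨(-1, 0), by simp [rookDirs], (x - x' - 1).toNat, ?_, fun k hk => ?_⟩
      · ext <;> simp; omega
      · simpa using h (x + (-1 + -k)) (by omega) (by omega)
    · refine ⟨(0, 1), by simp [rookDirs], (y' - y - 1).toNat, ?_, fun k hk => ?_⟩
      · ext <;> simp; omega
      · simpa using h (y + (k + 1)) (by omega) (by omega)
    · refine ⟨(0, -1), by simp [rookDirs], (y - y' - 1).toNat, ?_, fun k hk => ?_⟩
      · ext <;> simp; omega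
      · simpa using h (y + (-1 + -k)) (by omega) (by omega)

theorem canMove_pawn_iff {b : Board} {c : Color} {s t : Square} :
    CanMove b (c, .pawn) s t ↔
      t.2 = s.2 + c.forward ∧ (((t.1 = s.1 + 1 ∨ t.1 = s.1 - 1) ∧ ∃ k, b t = some (c.other, k)) ∨
        (t.1 = s.1 ∧ b t = none)) := by
  have : |t.1 - s.1| = 1 ↔ (t.1 = s.1 + 1 ∨ t.1 = s.1 - 1) := by
    rw [abs_eq (by norm_num)]; omega
  simp only [CanMove, Attacks, this, if_true, Prod.ext_iff]
  tauto

theorem canMove_rook_iff {b : Board} {c : Color} {s t : Square} :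
    CanMove b (c, .rook) s t ↔
      Slides rookDirs b s t ∧ (b t = none ∨ ∃ k, b t = some (c.other, k)) := by
  simp only [CanMove, Attacks, reduceCtorEq, if_false]
  tauto

theorem Board.move_apply (b : Board) (m : Move) (q : Square) :
    b.move m q = if q = m.2 then b m.1 else if q = m.1 then none else b q := rfl

/-! ### The prison -/

/-- The squares whose content never changes. -/
def InCage (q : Square) : Prop :=
  (q.1 = -10 ∧ 8 ≤ q.2) ∨ ((q.1 = -11 ∨ q.1 = -9) ∧ 6 ≤ q.2) ∨
    ((q.1 = -12 ∨ q.1 = -8) ∧ 7 ≤ q.2) ∨ ((q.1 = -13 ∨ q.1 = -7) ∧ 6 ≤ q.2)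

theorem startBoard_neg {x y : ℤ} (h : x < 0) (h' : x ≠ -30) :
    startBoard (x, y) = prison (x + 10).natAbs (y - 10) := by
  simp [startBoard, h, h']

theorem startBoard_file_king (y : ℤ) : startBoard (-10, y) =
    if 11 ≤ y then whitePawn else if y = 10 then blackKing else none := by
  rw [startBoard_neg (by omega) (by omega)]
  simp only [prison, show (-10 + 10 : ℤ).natAbs = 0 by rfl, if_true]
  split_ifs <;> first | rfl | omega

theorem startBoard_file_one {x : ℤ} (hx : x = -11 ∨ x = -9) (y : ℤ) : startBoard (x, y) =
    if 10 ≤ y then whitePawn else if y = 9 then blackPawn else if 6 ≤ y then whitePawn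
      else none := by
  rw [startBoard_neg (by omega) (by omega)]
  simp only [prison, show (x + 10 : ℤ).natAbs = 1 by omega, if_true, one_ne_zero, if_false]
  split_ifs <;> first | rfl | omega

theorem startBoard_file_two {x : ℤ} (hx : x = -12 ∨ x = -8) (y : ℤ) : startBoard (x, y) =
    if 9 ≤ y then whitePawn else if y = 7 then whiteBishop else none := by
  rw [startBoard_neg (by omega) (by omega)]
  simp only [prison, show (x + 10 : ℤ).natAbs = 2 by omega, if_true, if_false, OfNat.ofNat_ne_zero,
    OfNat.ofNat_ne_one, Nat.reduceEqDiff]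
  split_ifs <;> first | rfl | omega

theorem startBoard_file_three {x : ℤ} (hx : x = -13 ∨ x = -7) (y : ℤ) : startBoard (x, y) =
    if 6 ≤ y then whitePawn else none := by
  rw [startBoard_neg (by omega) (by omega)]
  simp only [prison, show (x + 10 : ℤ).natAbs = 3 by omega, if_true, if_false, OfNat.ofNat_ne_zero,
    OfNat.ofNat_ne_one, Nat.reduceEqDiff]
  split_ifs <;> first | rfl | omega

theorem startBoard_neg_outside {x y : ℤ} (h : x < 0) (h' : x ≠ -30) (hc : ¬ InCage (x, y)) :
    startBoard (x, y) = none := by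
  rw [startBoard_neg h h']
  simp only [InCage] at hc
  have : (x + 10).natAbs = 0 ∨ (x + 10).natAbs = 1 ∨ (x + 10).natAbs = 2 ∨ (x + 10).natAbs = 3 ∨
    3 < (x + 10).natAbs := by omega
  unfold prison
  split_ifs <;> first | rfl | omega

theorem startBoard_spare (y : ℤ) : startBoard (-30, y) = if y = 0 then blackPawn else none := by
  simp [startBoard]

theorem startBoard_gadget (n r : ℕ) (hr : r < 8) (y : ℤ) :
    startBoard (8 * n + r, y) = gadget n r y := by
  have h1 : (8 * (n : ℤ) + r).toNat / 8 = n := by omega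
  have h2 : (8 * (n : ℤ) + r).toNat % 8 = r := by omega
  simp only [startBoard, h1, h2]
  rw [if_neg (by omega)]

theorem exists_gadget_coord {x : ℤ} (hx : 0 ≤ x) : ∃ n r : ℕ, r < 8 ∧ x = 8 * n + r :=
  ⟨x.toNat / 8, x.toNat % 8, by omega, by omega⟩

/-- What holds on the board in every play: the prison is intact, the other black pieces are pawns
that never stand above rank `1`, and the other white pieces are rooks or pawns far away from the
prison. Indeed, a white pawn moves to the left only when it captures; this raises its rank, and the
new rank is at most `1`, so that `q.1 + min q.2 1` does not decrease. -/
structure CageInv (b : Board) : Prop where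
  cage : ∀ q, InCage q → b q = startBoard q
  black : ∀ q k, ¬ InCage q → b q = some (.black, k) → k = .pawn ∧ q.2 ≤ 1
  white : ∀ q k, ¬ InCage q → b q = some (.white, k) →
    (k = .pawn ∧ 0 ≤ q.1 + min q.2 1) ∨ k = .rook

/-- A white rook attacks the black king along the open shaft below him. -/
def ShaftCheck (b : Board) : Prop :=
  ∃ y < 10, b (-10, y) = whiteRook ∧ ∀ u, y < u → u < 10 → b (-10, u) = none

theorem cageInv_startBoard : CageInv startBoard where
  cage _ _ := rfl
  black := by
    rintro ⟨x, y⟩ k hc h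
    rcases lt_or_ge x 0 with hx | hx
    · by_cases h30 : x = -30
      · subst h30
        rw [startBoard_spare] at h
        split_ifs at h with hy
        simp_all
      · rw [startBoard_neg_outside hx h30 hc] at h
        cases h
    · obtain ⟨n, r, hr, rfl⟩ := exists_gadget_coord hx
      rw [startBoard_gadget n r hr] at h
      unfold gadget at h
      split_ifs at h <;> simp_all
  white := by
    rintro ⟨x, y⟩ k hc h
    rcases lt_or_ge x 0 with hx | hx
    · by_cases h30 : x = -30
      · subst h30
        rw [startBoard_spare] at h
        split_ifs at h with hy
        simp at h
      · rw [startBoard_neg_outside hx h30 hc] at h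
        cases h
    · obtain ⟨n, r, hr, rfl⟩ := exists_gadget_coord hx
      rw [startBoard_gadget n r hr] at h
      unfold gadget at h
      split_ifs at h <;> simp only [Option.some.injEq, Prod.mk.injEq, true_and, reduceCtorEq,
        false_and] at h <;> subst h <;> simp <;> omega

namespace CageInv

variable {b : Board}

theorem file_king (hb : CageInv b) {y : ℤ} (hy : 8 ≤ y) : b (-10, y) =
    if 11 ≤ y then whitePawn else if y = 10 then blackKing else none := by
  rw [hb.cage _ (by simp [InCage, hy]), startBoard_file_king]

theorem file_one (hb : CageInv b) {x y : ℤ} (hx : x = -11 ∨ x = -9) (hy : 6 ≤ y) : b (x, y) =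
    if y = 9 then blackPawn else whitePawn := by
  rw [hb.cage _ (by simp [InCage, hy, hx]), startBoard_file_one hx]
  split_ifs <;> first | rfl | omega

theorem file_two (hb : CageInv b) {x y : ℤ} (hx : x = -12 ∨ x = -8) (hy : 7 ≤ y) : b (x, y) =
    if 9 ≤ y then whitePawn else if y = 7 then whiteBishop else none := by
  rw [hb.cage _ (by simp [InCage, hy, hx]), startBoard_file_two hx]

theorem file_three (hb : CageInv b) {x y : ℤ} (hx : x = -13 ∨ x = -7) (hy : 6 ≤ y) :
    b (x, y) = whitePawn := by
  rw [hb.cage _ (by simp [InCage, hy, hx]), startBoard_file_three hx, if_pos hy]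

theorem not_whiteKing (hb : CageInv b) (q : Square) : b q ≠ some (.white, .king) := by
  intro h
  by_cases hc : InCage q
  · obtain ⟨x, y⟩ := q
    have hc' := hc
    simp only [InCage] at hc'
    rcases hc' with ⟨rfl, hy⟩ | ⟨hx, hy⟩ | ⟨hx, hy⟩ | ⟨hx, hy⟩
    · rw [hb.file_king hy] at h; split_ifs at h <;> simp at h
    · rw [hb.file_one hx hy] at h; split_ifs at h <;> simp at h
    · rw [hb.file_two hx hy] at h; split_ifs at h <;> simp at h
    · rw [hb.file_three hx hy] at h; simp at h
  · simpa using hb.white q _ hc h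

theorem not_inCheck_white (hb : CageInv b) : ¬ InCheck b .white := by
  rintro ⟨s, t, k, -, h, -⟩
  exact hb.not_whiteKing t h

theorem blackKing_iff (hb : CageInv b) {q : Square} : b q = blackKing ↔ q = (-10, 10) := by
  constructor
  · intro h
    by_cases hc : InCage q
    · obtain ⟨x, y⟩ := q
      have hc' := hc
      simp only [InCage] at hc'
      rcases hc' with ⟨rfl, hy⟩ | ⟨hx, hy⟩ | ⟨hx, hy⟩ | ⟨hx, hy⟩
      · rw [hb.file_king hy] at h; split_ifs at h <;> simp_all
      · rw [hb.file_one hx hy] at h; split_ifs at h <;> simp at h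
      · rw [hb.file_two hx hy] at h; split_ifs at h <;> simp at h
      · rw [hb.file_three hx hy] at h; simp at h
    · simpa using hb.black q _ hc h
  · rintro rfl
    rw [hb.file_king (by norm_num)]; rfl

/-- A rook that stands outside the prison reaches a square of it, empty or occupied by black, only
through the shaft. -/
theorem slides_to_cage (hb : CageInv b) {s t : Square} (hs : ¬ InCage s) (ht : InCage t)
    (hw : ∀ k, b t ≠ some (.white, k)) (h : Slides rookDirs b s t) :
    t.1 = -10 ∧ s.1 = -10 ∧ s.2 < 8 ∧ ∀ u, s.2 < u → u < 10 → b (-10, u) = none := by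
  obtain ⟨x, y⟩ := s
  obtain ⟨x', y'⟩ := t
  have ht' := ht
  have hs' := hs
  simp only [InCage] at ht' hs'
  rw [slides_rookDirs_iff] at h
  dsimp only at *
  rcases ht' with ⟨rfl, hy⟩ | ⟨hx, hy⟩ | ⟨hx, hy⟩ | ⟨hx, hy⟩
  · -- the file of the king
    have hy11 : y' < 11 := by
      by_contra hcon
      rw [hb.file_king hy, if_pos (by omega)] at hw
      exact hw _ rfl
    have hne : ∀ x1 y1 : ℤ, x1 = -11 ∨ x1 = -9 → 6 ≤ y1 → b (x1, y1) ≠ none := by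
      intro x1 y1 h1 h2
      rw [hb.file_one h1 h2]; split_ifs <;> simp
    rcases h with ⟨rfl, h1, h2⟩ | ⟨rfl, h1, h2⟩ | ⟨rfl, h1, h2⟩ | ⟨rfl, h1, h2⟩
    · exact absurd (h2 (-11) (by omega) (by omega)) (hne _ _ (by simp) (by omega))
    · exact absurd (h2 (-9) (by omega) (by omega)) (hne _ _ (by simp) (by omega))
    · refine ⟨rfl, rfl, by omega, fun u h3 h4 => ?_⟩
      by_cases h5 : u < y'
      · exact h2 u h3 h5
      · rw [hb.file_king (by omega), if_neg (by omega), if_neg (by omega)]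
    · omega
  · -- the black pawns next to the king are shielded on both sides and from below
    have hy9 : y' = 9 := by
      by_contra hcon
      rw [hb.file_one hx hy, if_neg (by omega)] at hw
      exact hw _ rfl
    subst hy9
    have hne : ∀ x1 : ℤ, x1 = -12 ∨ x1 = -8 → b (x1, 9) ≠ none := by
      intro x1 h1
      rw [hb.file_two h1 (by norm_num)]; simp
    rcases h with ⟨rfl, h1, h2⟩ | ⟨rfl, h1, h2⟩ | ⟨rfl, h1, h2⟩ | ⟨rfl, h1, h2⟩
    · by_cases h3 : x < -12
      · exact absurd (h2 (-12) (by omega) (by omega)) (hne _ (by simp))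
      · omega
    · by_cases h3 : -8 < x
      · exact absurd (h2 (-8) (by omega) (by omega)) (hne _ (by simp))
      · omega
    · have := h2 8 (by omega) (by omega)
      rw [hb.file_one hx (by norm_num)] at this
      simp at this
    · omega
  · -- the two empty squares that these pawns attack are enclosed as well
    have hy9 : y' = 8 := by
      by_contra hcon
      rw [hb.file_two hx hy] at hw
      split_ifs at hw <;> first | omega | exact hw _ rfl
    subst hy9
    have hne : ∀ x1 : ℤ, x1 = -11 ∨ x1 = -9 → b (x1, 8) ≠ none := by
      intro x1 h1
      rw [hb.file_one h1 (by norm_num)]; simp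
    have hne' : ∀ x1 : ℤ, x1 = -13 ∨ x1 = -7 → b (x1, 8) ≠ none := by
      intro x1 h1
      rw [hb.file_three h1 (by norm_num)]; simp
    rcases h with ⟨rfl, h1, h2⟩ | ⟨rfl, h1, h2⟩ | ⟨rfl, h1, h2⟩ | ⟨rfl, h1, h2⟩
    · rcases hx with rfl | rfl
      · exact absurd (h2 (-13) (by omega) (by omega)) (hne' _ (by simp))
      · exact absurd (h2 (-9) (by omega) (by omega)) (hne _ (by simp))
    · rcases hx with rfl | rfl
      · exact absurd (h2 (-11) (by omega) (by omega)) (hne _ (by simp))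
      · exact absurd (h2 (-7) (by omega) (by omega)) (hne' _ (by simp))
    · have := h2 7 (by omega) (by omega)
      rw [hb.file_two hx (by norm_num)] at this
      simp at this
    · omega
  · exact absurd (hb.file_three hx hy) (hw _)

/-- The white pieces of the prison do not attack the king, pawns from outside are too far away, and
rooks from outside come only through the shaft. -/
theorem inCheck_black_iff (hb : CageInv b) : InCheck b .black ↔ ShaftCheck b := by
  constructor
  · rintro ⟨s, t, k, hs, ht, ha⟩
    obtain rfl := hb.blackKing_iff.1 ht
    simp only [Color.other] at hs ha
    by_cases hc : InCage s
    · exfalso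
      obtain ⟨x, y⟩ := s
      have hc' := hc
      simp only [InCage] at hc'
      rcases hc' with ⟨rfl, hy⟩ | ⟨hx, hy⟩ | ⟨hx, hy⟩ | ⟨hx, hy⟩
      · rw [hb.file_king hy] at hs
        split_ifs at hs <;> simp only [Option.some.injEq, Prod.mk.injEq, true_and, reduceCtorEq,
          false_and] at hs
        subst hs
        simp [Attacks] at ha
      · rw [hb.file_one hx hy] at hs
        split_ifs at hs <;> simp only [Option.some.injEq, Prod.mk.injEq, true_and, reduceCtorEq,
          false_and] at hs
        subst hs
        simp only [Attacks, Color.forward] at ha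
        omega
      · rw [hb.file_two hx hy] at hs
        split_ifs at hs with h1 h2 <;>
        simp only [Option.some.injEq, Prod.mk.injEq, true_and] at hs <;> subst hs
        · simp only [Attacks, Color.forward] at ha
          rw [abs_eq (by norm_num)] at ha
          omega
        · subst h2
          obtain ⟨d, hd, n, h, -⟩ := ha
          simp only [bishopDirs, Set.mem_insert_iff, Set.mem_singleton_iff] at hd
          rcases hd with rfl | rfl | rfl | rfl <;> simp at h <;> omega
      · rw [hb.file_three hx hy] at hs
        simp only [Option.some.injEq, Prod.mk.injEq, true_and] at hs
        subst hs
        simp only [Attacks, Color.forward] at ha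
        rw [abs_eq (by norm_num)] at ha
        omega
    · rcases hb.white s k hc hs with ⟨rfl, h⟩ | rfl
      · simp only [Attacks, Color.forward] at ha
        rw [abs_eq (by norm_num)] at ha
        omega
      · obtain ⟨-, h1, h2, h3⟩ := hb.slides_to_cage hc (by simp [InCage]) (by simp [ht]) ha
        obtain ⟨x, y⟩ := s
        dsimp only at h1 h2 h3
        subst h1
        exact ⟨y, by omega, hs, h3⟩
  · rintro ⟨y, hy, h, h'⟩
    refine ⟨(-10, y), (-10, 10), .rook, h, hb.blackKing_iff.2 rfl, ?_⟩
    exact slides_rookDirs_iff.2 (.inr (.inr (.inl ⟨rfl, hy, h'⟩)))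

/-- White cannot touch the prison when black is not in check: the white pieces of the prison block
each other, and a rook that could enter it through the shaft would already give check. -/
theorem white_outside (hb : CageInv b) (hch : ¬ InCheck b .black) {k : Kind} {s t : Square}
    (hs : b s = some (.white, k)) (h : CanMove b (.white, k) s t) : ¬ InCage s ∧ ¬ InCage t := by
  have hw : ∀ k, b t ≠ some (.white, k) := by
    rintro k' h'
    rcases h with ⟨-, k2, h2⟩ | ⟨h2, -⟩ <;> simp [h', Color.other] at h2
  by_cases hc : InCage s
  · exfalso
    obtain ⟨x, y⟩ := s
    obtain ⟨x', y'⟩ := t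
    have hc' := hc
    simp only [InCage] at hc'
    rcases hc' with ⟨rfl, hy⟩ | ⟨hx, hy⟩ | ⟨hx, hy⟩ | ⟨hx, hy⟩
    · rw [hb.file_king hy] at hs
      split_ifs at hs <;> simp only [Option.some.injEq, Prod.mk.injEq, true_and, reduceCtorEq,
        false_and] at hs
      subst hs
      rw [canMove_pawn_iff] at h
      simp only [Color.forward] at h
      obtain ⟨rfl, h⟩ := h
      rcases h with ⟨hx, -⟩ | ⟨rfl, -⟩
      · exact hw .pawn (by rw [hb.file_one (by omega) (by omega), if_neg (by omega)])
      · exact hw .pawn (by rw [hb.file_king (by omega), if_pos (by omega)])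
    · rw [hb.file_one hx hy] at hs
      split_ifs at hs <;> simp only [Option.some.injEq, Prod.mk.injEq, true_and, reduceCtorEq,
        false_and] at hs
      subst hs
      rw [canMove_pawn_iff] at h
      simp only [Color.forward, Color.other] at h
      obtain ⟨rfl, h⟩ := h
      rcases h with ⟨hx', k, h⟩ | ⟨rfl, h⟩
      · have : x' = -10 ∨ (x' = -12 ∨ x' = -8) := by omega
        rcases this with rfl | hx'
        · by_cases hy8 : 8 ≤ y + 1
          · rw [hb.file_king hy8] at h
            split_ifs at h <;> first | (simp at h; done) | omega
          · have := hb.black _ _ (by simp only [InCage]; omega) h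
            dsimp only at this; omega
        · rw [hb.file_two hx' (by omega)] at h
          split_ifs at h <;> simp at h
      · rw [hb.file_one hx (by omega)] at h
        split_ifs at h
    · rw [hb.file_two hx hy] at hs
      split_ifs at hs with h1 h2 <;>
        simp only [Option.some.injEq, Prod.mk.injEq, true_and] at hs <;> subst hs
      · rw [canMove_pawn_iff] at h
        simp only [Color.forward, Color.other] at h
        obtain ⟨rfl, h⟩ := h
        rcases h with ⟨hx', k, h⟩ | ⟨rfl, h⟩
        · have : (x' = -11 ∨ x' = -9) ∨ (x' = -13 ∨ x' = -7) := by omega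
          rcases this with hx' | hx'
          · exact hw .pawn (by rw [hb.file_one hx' (by omega), if_neg (by omega)])
          · exact hw .pawn (by rw [hb.file_three hx' (by omega)])
        · rw [hb.file_two hx (by omega), if_pos (by omega)] at h
          simp at h
      · -- a bishop has white pawns on all four diagonals
        subst h2
        have hsl : Slides bishopDirs b (x, 7) (x', y') := by
          rcases h with ⟨h, -⟩ | ⟨-, h⟩
          · exact h
          · simpa [Attacks] using h
        obtain ⟨d, hd, n, h, h0⟩ := hsl
        have hd' : b ((x, 7) + d) = whitePawn := by
          simp only [bishopDirs, Set.mem_insert_iff, Set.mem_singleton_iff] at hd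
          have key : ∀ x1 y1 : ℤ, (x1 = x + 1 ∨ x1 = x - 1) → (y1 = 8 ∨ y1 = 6) →
              b (x1, y1) = whitePawn := by
            intro x1 y1 h1 h2
            have : (x1 = -11 ∨ x1 = -9) ∨ (x1 = -13 ∨ x1 = -7) := by omega
            rcases this with hx' | hx'
            · rw [hb.file_one hx' (by omega), if_neg (by omega)]
            · rw [hb.file_three hx' (by omega)]
          rcases hd with rfl | rfl | rfl | rfl <;> exact key _ _ (by omega) (by norm_num)
        rcases Nat.eq_zero_or_pos n with rfl | hn
        · rw [h] at hw
          simp [hd'] at hw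
        · have := h0 0 hn
          simp [hd'] at this
    · rw [hb.file_three hx hy] at hs
      simp only [Option.some.injEq, Prod.mk.injEq, true_and] at hs
      subst hs
      rw [canMove_pawn_iff] at h
      simp only [Color.forward, Color.other] at h
      obtain ⟨rfl, h⟩ := h
      rcases h with ⟨hx', k, h⟩ | ⟨rfl, h⟩
      · by_cases hx2 : x' = -12 ∨ x' = -8
        · rw [hb.file_two hx2 (by omega)] at h
          split_ifs at h <;> simp at h
        · have := hb.black _ _ (by simp only [InCage]; omega) h
          dsimp only at this; omega
      · rw [hb.file_three hx (by omega)] at h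
        simp at h
  · refine ⟨hc, fun ht => ?_⟩
    rcases hb.white s k hc hs with ⟨rfl, h'⟩ | rfl
    · rw [canMove_pawn_iff] at h
      simp only [InCage] at ht
      have := h.2
      omega
    · rw [canMove_rook_iff] at h
      obtain ⟨-, h1, h2, h3⟩ := hb.slides_to_cage hc ht hw h.1
      obtain ⟨x, y⟩ := s
      dsimp only at h1 h2 h3
      subst h1
      exact hch (hb.inCheck_black_iff.2 ⟨y, by omega, hs, h3⟩)

/-- Black can legally move only pawns from outside the prison. -/
theorem black_outside (hb : CageInv b) {m : Move} (h : Position.Legal ⟨b, .black⟩ m) :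
    b m.1 = blackPawn ∧ ¬ InCage m.1 ∧ ¬ InCage m.2 ∧ CanMove b (.black, .pawn) m.1 m.2 := by
  obtain ⟨⟨k, hs, h⟩, hch⟩ := h
  obtain ⟨s, t⟩ := m
  dsimp only [Position.move] at *
  by_cases hc : InCage s
  · exfalso
    obtain ⟨x, y⟩ := s
    obtain ⟨x', y'⟩ := t
    have hc' := hc
    simp only [InCage] at hc'
    rcases hc' with ⟨rfl, hy⟩ | ⟨hx, hy⟩ | ⟨hx, hy⟩ | ⟨hx, hy⟩
    · rw [hb.file_king hy] at hs
      split_ifs at hs with h1 h2 <;> simp only [Option.some.injEq, Prod.mk.injEq, true_and,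
        reduceCtorEq, false_and] at hs
      subst hs h2
      have hat : (x', y') - ((-10 : ℤ), (10 : ℤ)) ∈ rookDirs ∪ bishopDirs := by
        rcases h with ⟨h, -⟩ | ⟨-, h⟩
        · exact h
        · simpa [Attacks] using h
      simp only [rookDirs, bishopDirs, Set.mem_union, Set.mem_insert_iff, Set.mem_singleton_iff,
        Prod.mk_sub_mk, Prod.mk.injEq] at hat
      -- every square next to the king is protected by a white pawn
      have key : ∀ x1 y1 : ℤ, y1 + 1 = y' → (x' = x1 + 1 ∨ x' = x1 - 1) →
          b (x1, y1) = whitePawn → ¬ (x1 = -10 ∧ y1 = 10) → False := by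
        intro x1 y1 h1 h2 h3 h4
        refine hch ⟨(x1, y1), (x', y'), .pawn, ?_, ?_, ?_⟩
        · simp only [Board.move_apply, Prod.mk.injEq]
          rw [if_neg (by omega), if_neg h4, h3]
          rfl
        · simp only [Board.move_apply, if_true]
          rw [hb.blackKing_iff]
        · refine ⟨?_, h1.symm⟩
          rw [abs_eq (by norm_num)]
          dsimp only; omega
      have no9 : ¬ (y' = 9 ∧ x' ≠ -10) := by
        rintro ⟨h1, h2⟩
        have : b (x', y') = blackPawn := by
          rw [hb.file_one (by omega) (by omega), if_pos (by omega)]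
        rcases h with ⟨-, k, h⟩ | ⟨h, -⟩ <;> rw [this] at h <;> simp [Color.other] at h
      by_cases hx10 : x' = -10
      · refine key (-11) (y' - 1) (by omega) (by omega) ?_ (by omega)
        rw [hb.file_one (by omega) (by omega), if_neg (by omega)]
      · by_cases hx11 : x' = -11
        · refine key (-12) (y' - 1) (by omega) (by omega) ?_ (by omega)
          rw [hb.file_two (by omega) (by omega), if_pos (by omega)]
        · refine key (-8) (y' - 1) (by omega) (by omega) ?_ (by omega)
          rw [hb.file_two (by omega) (by omega), if_pos (by omega)]
    · rw [hb.file_one hx hy] at hs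
      split_ifs at hs with h1 <;> simp only [Option.some.injEq, Prod.mk.injEq, true_and,
        reduceCtorEq, false_and] at hs
      subst hs h1
      rw [canMove_pawn_iff] at h
      simp only [Color.forward, Color.other] at h
      obtain ⟨rfl, h⟩ := h
      rcases h with ⟨hx', k, h⟩ | ⟨rfl, h⟩
      · have : x' = -10 ∨ (x' = -12 ∨ x' = -8) := by omega
        rcases this with rfl | hx'
        · rw [hb.file_king (by omega)] at h
          simp at h
        · rw [hb.file_two hx' (by omega)] at h
          simp at h
      · rw [hb.file_one hx (by omega)] at h
        simp at h
    · rw [hb.file_two hx hy] at hs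
      split_ifs at hs <;> simp at hs
    · rw [hb.file_three hx hy] at hs
      simp at hs
  · obtain ⟨rfl, hy⟩ := hb.black s k hc hs
    refine ⟨hs, hc, fun ht => ?_, h⟩
    rw [canMove_pawn_iff] at h
    simp only [InCage, Color.forward] at ht h
    have := h.1
    omega

theorem move_white (hb : CageInv b) (hch : ¬ InCheck b .black) {k : Kind} {m : Move}
    (hs : b m.1 = some (.white, k)) (h : CanMove b (.white, k) m.1 m.2) : CageInv (b.move m) := by
  obtain ⟨s, t⟩ := m
  obtain ⟨h1, h2⟩ := hb.white_outside hch hs h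
  dsimp only at *
  refine ⟨fun q hq => ?_, fun q j hq hj => ?_, fun q j hq hj => ?_⟩
  · have hqt : q ≠ t := by rintro rfl; exact h2 hq
    have hqs : q ≠ s := by rintro rfl; exact h1 hq
    simp only [Board.move_apply, hqt, hqs, if_false]
    exact hb.cage q hq
  · simp only [Board.move_apply] at hj
    split_ifs at hj with h3 h4
    · rw [hs] at hj; simp at hj
    · exact hb.black q j hq hj
  · simp only [Board.move_apply] at hj
    split_ifs at hj with h3 h4
    · subst h3
      rw [hs] at hj
      simp only [Option.some.injEq, Prod.mk.injEq, true_and] at hj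
      subst hj
      rcases hb.white s k h1 hs with ⟨rfl, h'⟩ | rfl
      · left
        rw [canMove_pawn_iff] at h
        simp only [Color.forward, Color.other] at h
        obtain ⟨h5, ⟨h6, k, h7⟩ | ⟨h6, h7⟩⟩ := h
        · have := (hb.black q k h2 h7).2
          exact ⟨rfl, by omega⟩
        · exact ⟨rfl, by omega⟩
      · exact .inr rfl
    · exact hb.white q j hq hj

theorem move_black (hb : CageInv b) {m : Move} (hs : b m.1 = blackPawn) (h1 : ¬ InCage m.1)
    (h : CanMove b (.black, .pawn) m.1 m.2) : CageInv (b.move m) := by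
  obtain ⟨s, t⟩ := m
  have hy := (hb.black s _ h1 hs).2
  rw [canMove_pawn_iff] at h
  simp only [Color.forward] at h
  dsimp only at *
  have h2 : ¬ InCage t := by simp only [InCage]; omega
  refine ⟨fun q hq => ?_, fun q j hq hj => ?_, fun q j hq hj => ?_⟩
  · have hqt : q ≠ t := by rintro rfl; exact h2 hq
    have hqs : q ≠ s := by rintro rfl; exact h1 hq
    simp only [Board.move_apply, hqt, hqs, if_false]
    exact hb.cage q hq
  · simp only [Board.move_apply] at hj
    split_ifs at hj with h3 h4
    · subst h3
      rw [hs] at hj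
      simp only [Option.some.injEq, Prod.mk.injEq, true_and] at hj
      exact ⟨hj.symm, by omega⟩
    · exact hb.black q j hq hj
  · simp only [Board.move_apply] at hj
    split_ifs at hj with h3 h4
    · rw [hs] at hj; simp at hj
    · exact hb.white q j hq hj

theorem legal_white_iff (hb : CageInv b) (hch : ¬ InCheck b .black) {m : Move} :
    Position.Legal ⟨b, .white⟩ m ↔
      (b m.1 = whitePawn ∧ CanMove b (.white, .pawn) m.1 m.2) ∨
        (b m.1 = whiteRook ∧ CanMove b (.white, .rook) m.1 m.2) := by
  constructor
  · rintro ⟨⟨k, hs, h⟩, -⟩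
    have := (hb.white_outside hch hs h).1
    rcases hb.white m.1 k this hs with ⟨rfl, -⟩ | rfl
    · exact .inl ⟨hs, h⟩
    · exact .inr ⟨hs, h⟩
  · rintro (⟨hs, h⟩ | ⟨hs, h⟩)
    · exact ⟨⟨_, hs, h⟩, (hb.move_white hch hs h).not_inCheck_white⟩
    · exact ⟨⟨_, hs, h⟩, (hb.move_white hch hs h).not_inCheck_white⟩

theorem legal_black_iff (hb : CageInv b) {m : Move} :
    Position.Legal ⟨b, .black⟩ m ↔ b m.1 = blackPawn ∧ ¬ InCage m.1 ∧
      CanMove b (.black, .pawn) m.1 m.2 ∧ ¬ ShaftCheck (b.move m) := by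
  constructor
  · intro h
    obtain ⟨h1, h2, -, h3⟩ := hb.black_outside h
    refine ⟨h1, h2, h3, ?_⟩
    rw [← (hb.move_black h1 h2 h3).inCheck_black_iff]
    exact h.2
  · rintro ⟨h1, h2, h3, h4⟩
    refine ⟨⟨_, h1, h3⟩, ?_⟩
    rw [← (hb.move_black h1 h2 h3).inCheck_black_iff] at h4
    exact h4

end CageInv

/-! ### Plays -/

namespace Position

variable {p : Position} {c : Color} {f : List Move → Move} {h : List Move} {m : Move}

theorem after_concat (p : Position) (h : List Move) (m : Move) :
    p.after (h ++ [m]) = (p.after h).move m := by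
  induction h generalizing p with
  | nil => rfl
  | cons a h ih => exact ih _

theorem isPlay_concat : p.IsPlay (h ++ [m]) ↔ p.IsPlay h ∧ (p.after h).Legal m := by
  induction h generalizing p with
  | nil => simp [IsPlay, after]
  | cons a h ih =>
    simp only [List.cons_append, IsPlay, after, ih]
    tauto

theorem follows_concat :
    p.Follows c f (h ++ [m]) ↔ p.Follows c f h ∧ ((p.after h).turn = c → m = f h) := by
  constructor
  · intro hf
    exact ⟨fun g m' hg => hf g m' (hg.trans (List.prefix_append _ _)), hf h m (List.prefix_refl _)⟩
  · rintro ⟨h1, h2⟩ g m' hg ht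
    rcases List.prefix_concat_iff.1 hg with hg | hg
    · obtain ⟨rfl, hm⟩ := List.append_inj' hg rfl
      simp only [List.cons.injEq, and_true] at hm
      subst hm
      exact h2 ht
    · exact h1 g m' hg ht

theorem follows_nil : p.Follows c f [] := by
  intro g m hg
  simp at hg

/-- Induction along the plays in which the player `c` follows `f`. -/
theorem play_induction (I : List Move → Prop) (nil : I [])
    (own : ∀ h, p.IsPlay h → I h → (p.after h).turn = c → (p.after h).Legal (f h) →
      I (h ++ [f h]))
    (opp : ∀ h m, p.IsPlay h → I h → (p.after h).turn ≠ c → (p.after h).Legal m → I (h ++ [m])) :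
    ∀ h, p.IsPlay h → p.Follows c f h → I h := by
  intro h
  induction h using List.reverseRecOn with
  | nil => exact fun _ _ => nil
  | append_singleton h m ih =>
    intro h1 h2
    rw [isPlay_concat] at h1
    rw [follows_concat] at h2
    by_cases ht : (p.after h).turn = c
    · obtain rfl := h2.2 ht
      exact own h h1.1 (ih h1.1 h2.1) ht h1.2
    · exact opp h m h1.1 (ih h1.1 h2.1) ht h1.2

end Position

open Position

theorem turn_start_after (h : List Move) :
    (start.after h).turn = if h.length % 2 = 0 then .white else .black := by
  induction h using List.reverseRecOn with
  | nil => rfl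
  | append_singleton h m ih =>
    rw [after_concat, List.length_append, List.length_singleton]
    simp only [Position.move, ih]
    split_ifs <;> first | rfl | omega

theorem start_after_concat_board (h : List Move) (m : Move) :
    (start.after (h ++ [m])).board = (start.after h).board.move m := by
  rw [after_concat]; rfl

theorem turn_eq_white_iff {h : List Move} : (start.after h).turn = .white ↔ h.length % 2 = 0 := by
  rw [turn_start_after]; split_ifs <;> simp_all

theorem turn_eq_black_iff {h : List Move} : (start.after h).turn = .black ↔ h.length % 2 = 1 := by
  rw [turn_start_after]; split_ifs <;> simp_all

theorem start_after_eq_white {h : List Move} (hh : h.length % 2 = 0) :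
    start.after h = ⟨(start.after h).board, .white⟩ := by
  rw [← turn_eq_white_iff.2 hh]

theorem start_after_eq_black {h : List Move} (hh : h.length % 2 = 1) :
    start.after h = ⟨(start.after h).board, .black⟩ := by
  rw [← turn_eq_black_iff.2 hh]

theorem not_shaftCheck_startBoard : ¬ ShaftCheck startBoard := by
  rintro ⟨y, hy, h, -⟩
  rw [startBoard_file_king] at h
  split_ifs at h <;> simp at h

theorem cageInv_after {h : List Move} (hp : start.IsPlay h) :
    CageInv (start.after h).board ∧
      (h.length % 2 = 0 → ¬ InCheck (start.after h).board .black) := by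
  induction h using List.reverseRecOn with
  | nil =>
    exact ⟨cageInv_startBoard, fun _ => cageInv_startBoard.inCheck_black_iff.not.2
      not_shaftCheck_startBoard⟩
  | append_singleton h m ih =>
    rw [isPlay_concat] at hp
    obtain ⟨hb, hc⟩ := ih hp.1
    rw [start_after_concat_board, List.length_append, List.length_singleton]
    rcases Nat.mod_two_eq_zero_or_one h.length with hh | hh
    · rw [start_after_eq_white hh] at hp
      obtain ⟨k, h1, h2⟩ := hp.2.1
      exact ⟨hb.move_white (hc hh) h1 h2, by omega⟩
    · rw [start_after_eq_black hh] at hp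
      obtain ⟨h1, h2, -, h3⟩ := hb.black_outside hp.2
      exact ⟨hb.move_black h1 h2 h3, fun _ => hp.2.2⟩

theorem legal_white_turn {h : List Move} (hp : start.IsPlay h) (hh : h.length % 2 = 0) {m : Move} :
    (start.after h).Legal m ↔
      ((start.after h).board m.1 = whitePawn ∧
        CanMove (start.after h).board (.white, .pawn) m.1 m.2) ∨
      ((start.after h).board m.1 = whiteRook ∧
        CanMove (start.after h).board (.white, .rook) m.1 m.2) := by
  rw [← (cageInv_after hp).1.legal_white_iff ((cageInv_after hp).2 hh), ← start_after_eq_white hh]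

theorem legal_black_turn {h : List Move} (hp : start.IsPlay h) (hh : h.length % 2 = 1) {m : Move} :
    (start.after h).Legal m ↔ (start.after h).board m.1 = blackPawn ∧ ¬ InCage m.1 ∧
      CanMove (start.after h).board (.black, .pawn) m.1 m.2 ∧
      ¬ ShaftCheck (start.after (h ++ [m])).board := by
  rw [start_after_concat_board, ← (cageInv_after hp).1.legal_black_iff, ← start_after_eq_black hh]

/-- Since white has no king, black never wins. -/
theorem not_blackWins (w b : List Move → Move) : ¬ start.BlackWins w b := by
  rintro ⟨h, hp, -, -, -, hc, -⟩
  exact (cageInv_after hp).1.not_inCheck_white hc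

/-! ### The game tree is decidable -/

theorem primrecRel_forall_lt {β : Type*} [Primcodable β] {R : ℕ → β → Prop}
    (hR : PrimrecRel R) : PrimrecRel fun (n : ℕ) (b : β) => ∀ k < n, R k b :=
  (hR.forall_mem_list.comp (Primrec.list_range.comp Primrec.fst) Primrec.snd).of_eq (by simp)

/-- The square from which the content of `q` has come in the course of the moves `h`, if any. -/
def origin (h : List Move) (q : Square) : Option Square :=
  h.foldr (fun m a => a.bind fun q =>
    if q = m.2 then some m.1 else if q = m.1 then none else some q) (some q)

theorem after_board_eq_origin (p : Position) (h : List Move) (q : Square) :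
    (p.after h).board q = (origin h q).bind p.board := by
  induction h generalizing p with
  | nil => rfl
  | cons m h ih =>
    rw [Position.after, ih]
    simp only [origin, List.foldr_cons]
    rw [Option.bind_assoc]
    congr 1
    funext q'
    simp only [Position.move, Board.move_apply]
    split_ifs <;> rfl

theorem primrec_board : Primrec fun p : List Move × Square => (start.after p.1).board p.2 := by
  have ho : Primrec fun p : List Move × Square => origin p.1 p.2 := by
    refine Primrec.list_foldr Primrec.fst (Primrec.option_some.comp Primrec.snd)
      (h := fun (_ : List Move × Square) (x : Move × Option Square) =>
      x.2.bind fun q => if q = x.1.2 then some x.1.1 else if q = x.1.1 then none else some q) ?_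
    refine Primrec.option_bind (Primrec.snd.comp Primrec.snd) ?_
    have m : Primrec fun p : ((List Move × Square) × Move × Option Square) × Square => p.1.2.1 :=
      Primrec.fst.comp (Primrec.snd.comp Primrec.fst)
    have q : Primrec fun p : ((List Move × Square) × Move × Option Square) × Square => p.2 :=
      Primrec.snd
    exact Primrec.ite (Primrec.eq.comp q (Primrec.snd.comp m))
      (Primrec.option_some.comp (Primrec.fst.comp m))
      (Primrec.ite (Primrec.eq.comp q (Primrec.fst.comp m)) (Primrec.const none)
        (Primrec.option_some.comp q))
  exact (Primrec.option_bind ho (primrec_startBoard.comp Primrec.snd).to₂).of_eq fun p => by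
    rw [after_board_eq_origin]; rfl

theorem primrecPred_clear_horizontal : PrimrecPred fun p : List Move × (ℤ × ℤ) × ℤ =>
    ∀ u, p.2.1.1 < u → u < p.2.1.2 → (start.after p.1).board (u, p.2.2) = none := by
  have h1 : PrimrecRel fun (k : ℕ) (p : List Move × (ℤ × ℤ) × ℤ) =>
      (start.after p.1).board (p.2.1.1 + 1 + k, p.2.2) = none :=
    Primrec.eq.comp (primrec_board.comp (Primrec.pair (Primrec.fst.comp Primrec.snd)
      (Primrec.pair (primrec_int_add.comp (primrec_int_add.comp (Primrec.fst.comp (Primrec.fst.comp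
        (Primrec.snd.comp Primrec.snd))) (Primrec.const 1)) (primrec_int_natCast.comp Primrec.fst))
        (Primrec.snd.comp (Primrec.snd.comp Primrec.snd))))) (Primrec.const none)
  have h0 := primrecRel_forall_lt h1
  have h2 := h0.comp (primrec_int_toNat.comp (primrec_int_sub.comp
    (primrec_int_sub.comp (Primrec.snd.comp (Primrec.fst.comp Primrec.snd))
      (Primrec.fst.comp (Primrec.fst.comp Primrec.snd))) (Primrec.const 1)))
    (Primrec.id (α := List Move × (ℤ × ℤ) × ℤ))
  refine h2.of_eq fun p => ⟨fun h u hu1 hu2 => ?_, fun h k hk => h _ ?_ ?_⟩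
  · have := h (u - p.2.1.1 - 1).toNat (by omega)
    simp only [id] at this
    rwa [show p.2.1.1 + 1 + ((u - p.2.1.1 - 1).toNat : ℤ) = u by omega] at this
  · simp only [id]; omega
  · simp only [id]; omega

theorem primrecPred_clear_vertical : PrimrecPred fun p : List Move × (ℤ × ℤ) × ℤ =>
    ∀ u, p.2.1.1 < u → u < p.2.1.2 → (start.after p.1).board (p.2.2, u) = none := by
  have h1 : PrimrecRel fun (k : ℕ) (p : List Move × (ℤ × ℤ) × ℤ) =>
      (start.after p.1).board (p.2.2, p.2.1.1 + 1 + k) = none :=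
    Primrec.eq.comp (primrec_board.comp (Primrec.pair (Primrec.fst.comp Primrec.snd)
      (Primrec.pair (Primrec.snd.comp (Primrec.snd.comp Primrec.snd)) (primrec_int_add.comp
        (primrec_int_add.comp (Primrec.fst.comp (Primrec.fst.comp
        (Primrec.snd.comp Primrec.snd))) (Primrec.const 1))
          (primrec_int_natCast.comp Primrec.fst))))) (Primrec.const none)
  have h0 := primrecRel_forall_lt h1
  have h2 := h0.comp (primrec_int_toNat.comp (primrec_int_sub.comp
    (primrec_int_sub.comp (Primrec.snd.comp (Primrec.fst.comp Primrec.snd))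
      (Primrec.fst.comp (Primrec.fst.comp Primrec.snd))) (Primrec.const 1)))
    (Primrec.id (α := List Move × (ℤ × ℤ) × ℤ))
  refine h2.of_eq fun p => ⟨fun h u hu1 hu2 => ?_, fun h k hk => h _ ?_ ?_⟩
  · have := h (u - p.2.1.1 - 1).toNat (by omega)
    simp only [id] at this
    rwa [show p.2.1.1 + 1 + ((u - p.2.1.1 - 1).toNat : ℤ) = u by omega] at this
  · simp only [id]; omega
  · simp only [id]; omega

theorem primrecPred_slides : PrimrecPred fun p : List Move × Move =>
    Slides rookDirs (start.after p.1).board p.2.1 p.2.2 := by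
  have h : Primrec fun p : List Move × Move => p.1 := Primrec.fst
  have x : Primrec fun p : List Move × Move => p.2.1.1 :=
    Primrec.fst.comp (Primrec.fst.comp Primrec.snd)
  have y : Primrec fun p : List Move × Move => p.2.1.2 :=
    Primrec.snd.comp (Primrec.fst.comp Primrec.snd)
  have x' : Primrec fun p : List Move × Move => p.2.2.1 :=
    Primrec.fst.comp (Primrec.snd.comp Primrec.snd)
  have y' : Primrec fun p : List Move × Move => p.2.2.2 :=
    Primrec.snd.comp (Primrec.snd.comp Primrec.snd)
  refine PrimrecPred.of_eq (PrimrecPred.or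
    ((Primrec.eq.comp y' y).and ((primrec_int_lt.comp x x').and
      (primrecPred_clear_horizontal.comp (.pair h (.pair (.pair x x') y)))))
    (PrimrecPred.or ((Primrec.eq.comp y' y).and ((primrec_int_lt.comp x' x).and
      (primrecPred_clear_horizontal.comp (.pair h (.pair (.pair x' x) y)))))
    (PrimrecPred.or ((Primrec.eq.comp x' x).and ((primrec_int_lt.comp y y').and
      (primrecPred_clear_vertical.comp (.pair h (.pair (.pair y y') x)))))
    ((Primrec.eq.comp x' x).and ((primrec_int_lt.comp y' y).and
      (primrecPred_clear_vertical.comp (.pair h (.pair (.pair y' y) x))))))))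
    fun p => slides_rookDirs_iff.symm

theorem exists_kind_iff {o : Option Piece} {c : Color} :
    (∃ k, o = some (c, k)) ↔ o.map Prod.fst = some c := by
  rcases o with _ | ⟨c', k⟩ <;> simp

theorem primrecPred_canMove_rook : PrimrecPred fun p : List Move × Move =>
    CanMove (start.after p.1).board (.white, .rook) p.2.1 p.2.2 := by
  have b : Primrec fun p : List Move × Move => (start.after p.1).board p.2.2 :=
    primrec_board.comp (.pair Primrec.fst (Primrec.snd.comp Primrec.snd))
  refine (primrecPred_slides.and ((Primrec.eq.comp b (Primrec.const none)).or
    (Primrec.eq.comp (Primrec.option_map b (Primrec.fst.comp Primrec.snd).to₂)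
      (Primrec.const (some Color.black))))).of_eq fun p => ?_
  rw [canMove_rook_iff, exists_kind_iff]
  rfl

theorem primrecPred_canMove_pawn (c : Color) : PrimrecPred fun p : List Move × Move =>
    CanMove (start.after p.1).board (c, .pawn) p.2.1 p.2.2 := by
  have b : Primrec fun p : List Move × Move => (start.after p.1).board p.2.2 :=
    primrec_board.comp (.pair Primrec.fst (Primrec.snd.comp Primrec.snd))
  have x : Primrec fun p : List Move × Move => p.2.1.1 :=
    Primrec.fst.comp (Primrec.fst.comp Primrec.snd)
  have y : Primrec fun p : List Move × Move => p.2.1.2 :=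
    Primrec.snd.comp (Primrec.fst.comp Primrec.snd)
  have x' : Primrec fun p : List Move × Move => p.2.2.1 :=
    Primrec.fst.comp (Primrec.snd.comp Primrec.snd)
  have y' : Primrec fun p : List Move × Move => p.2.2.2 :=
    Primrec.snd.comp (Primrec.snd.comp Primrec.snd)
  refine ((Primrec.eq.comp y' (primrec_int_add.comp y (Primrec.const c.forward))).and
    ((((Primrec.eq.comp x' (primrec_int_add.comp x (Primrec.const 1))).or
      (Primrec.eq.comp x' (primrec_int_sub.comp x (Primrec.const 1)))).and
        (Primrec.eq.comp (Primrec.option_map b (Primrec.fst.comp Primrec.snd).to₂)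
      (Primrec.const (some c.other)))).or ((Primrec.eq.comp x' x).and
        (Primrec.eq.comp b (Primrec.const none))))).of_eq fun p => ?_
  rw [canMove_pawn_iff, exists_kind_iff]

theorem exists_target_of_board_ne {h : List Move} {q : Square} {o : Option Piece}
    (ho : (start.after h).board q = o) (hne : o ≠ none) (hs : startBoard q ≠ o) :
    ∃ m ∈ h, m.2 = q := by
  induction h using List.reverseRecOn with
  | nil => exact absurd ho hs
  | append_singleton h m ih =>
    rw [start_after_concat_board, Board.move_apply] at ho
    split_ifs at ho with h1 h2
    · exact ⟨m, by simp, h1.symm⟩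
    · exact absurd ho.symm hne
    · obtain ⟨m', h3, h4⟩ := ih ho
      exact ⟨m', by simp [h3], h4⟩

theorem exists_touching_of_board_ne {h : List Move} {q : Square}
    (hs : (start.after h).board q ≠ startBoard q) : ∃ m ∈ h, m.1 = q ∨ m.2 = q := by
  induction h using List.reverseRecOn with
  | nil => exact absurd rfl hs
  | append_singleton h m ih =>
    rw [start_after_concat_board, Board.move_apply] at hs
    split_ifs at hs with h1 h2
    · exact ⟨m, by simp, .inr h1.symm⟩
    · exact ⟨m, by simp, .inl h2.symm⟩
    · obtain ⟨m', h3, h4⟩ := ih hs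
      exact ⟨m', by simp [h3], h4⟩

/-- There is no rook on the file of the king at the beginning, so only the targets of the moves have
to be examined. -/
theorem primrecPred_shaftCheck :
    PrimrecPred fun h : List Move => ShaftCheck (start.after h).board := by
  have q : Primrec fun p : Move × List Move => p.1.2 := Primrec.snd.comp Primrec.fst
  have h : Primrec fun p : Move × List Move => p.2 := Primrec.snd
  have k (i : ℤ) : Primrec fun _ : Move × List Move => i := Primrec.const i
  have hR : PrimrecRel fun (m : Move) (h : List Move) => m.2.1 = -10 ∧ m.2.2 < 10 ∧
      (start.after h).board m.2 = whiteRook ∧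
      ∀ u, m.2.2 < u → u < 10 → (start.after h).board (-10, u) = none :=
    (Primrec.eq.comp (Primrec.fst.comp q) (k _)).and ((primrec_int_lt.comp (Primrec.snd.comp q)
      (k _)).and ((Primrec.eq.comp (primrec_board.comp (.pair h q)) (Primrec.const _)).and
        (primrecPred_clear_vertical.comp (.pair h (.pair (.pair (Primrec.snd.comp q) (k 10))
          (k (-10)))))))
  refine (hR.exists_mem_list.comp Primrec.id Primrec.id).of_eq fun h => ⟨?_, ?_⟩
  · rintro ⟨⟨s, x, y⟩, -, h1, h2, h3, h4⟩
    dsimp only [id] at *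
    subst h1
    exact ⟨y, h2, h3, h4⟩
  · rintro ⟨y, h1, h2, h3⟩
    obtain ⟨m, hm, hq⟩ := exists_target_of_board_ne h2 (by simp) (by
      rw [startBoard_file_king]
      split_ifs <;> simp)
    exact ⟨m, hm, by rw [hq], by rw [hq]; exact h1, by rw [hq]; exact h2, by rw [hq]; exact h3⟩

theorem primrecPred_inCage : PrimrecPred InCage := by
  have x (i : ℤ) : PrimrecPred fun q : Square => q.1 = i :=
    Primrec.eq.comp Primrec.fst (Primrec.const i)
  have y (i : ℤ) : PrimrecPred fun q : Square => i ≤ q.2 :=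
    primrec_int_le.comp (Primrec.const i) Primrec.snd
  exact ((x _).and (y _)).or ((((x _).or (x _)).and (y _)).or ((((x _).or (x _)).and (y _)).or
    (((x _).or (x _)).and (y _))))

/-- A criterion for the legality of the move `m` after the play `h`, free of quantifiers over
squares except along the path of a rook. -/
def LegalCriterion (h : List Move) (m : Move) : Prop :=
  (h.length % 2 = 0 ∧ (((start.after h).board m.1 = whitePawn ∧
      CanMove (start.after h).board (.white, .pawn) m.1 m.2) ∨
    ((start.after h).board m.1 = whiteRook ∧
      CanMove (start.after h).board (.white, .rook) m.1 m.2))) ∨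
  (h.length % 2 = 1 ∧ (start.after h).board m.1 = blackPawn ∧ ¬ InCage m.1 ∧
      CanMove (start.after h).board (.black, .pawn) m.1 m.2 ∧
      ¬ ShaftCheck (start.after (h ++ [m])).board)

theorem legal_iff_legalCriterion {h : List Move} (hp : start.IsPlay h) {m : Move} :
    (start.after h).Legal m ↔ LegalCriterion h m := by
  rcases Nat.mod_two_eq_zero_or_one h.length with hh | hh
  · rw [legal_white_turn hp hh]; simp [LegalCriterion, hh]
  · rw [legal_black_turn hp hh]; simp [LegalCriterion, hh]

theorem primrecRel_legalCriterion : PrimrecRel LegalCriterion := by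
  have par (i : ℕ) : PrimrecPred fun p : List Move × Move => p.1.length % 2 = i :=
    Primrec.eq.comp (Primrec.nat_mod.comp (Primrec.list_length.comp Primrec.fst) (Primrec.const 2))
      (Primrec.const i)
  have src (o : Option Piece) : PrimrecPred fun p : List Move × Move =>
      (start.after p.1).board p.2.1 = o :=
    Primrec.eq.comp (primrec_board.comp (.pair Primrec.fst (Primrec.fst.comp Primrec.snd)))
      (Primrec.const o)
  exact ((par 0).and (((src _).and (primrecPred_canMove_pawn _)).or
    ((src _).and primrecPred_canMove_rook))).or ((par 1).and ((src _).and
      ((primrecPred_inCage.comp (Primrec.fst.comp Primrec.snd)).not.and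
        ((primrecPred_canMove_pawn _).and (primrecPred_shaftCheck.comp
          (Primrec.list_concat.comp Primrec.fst Primrec.snd)).not))))

theorem isPlay_iff_forall_legalCriterion {h : List Move} : start.IsPlay h ↔
    ∀ k < h.length, LegalCriterion (h.take k) (h.getI k) := by
  induction h using List.reverseRecOn with
  | nil => simp [IsPlay]
  | append_singleton h m ih =>
    have e : (∀ k < (h ++ [m]).length, LegalCriterion ((h ++ [m]).take k) ((h ++ [m]).getI k)) ↔
        (∀ k < h.length, LegalCriterion (h.take k) (h.getI k)) ∧ LegalCriterion h m := by
      rw [List.length_append, List.length_singleton]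
      constructor
      · intro H
        refine ⟨fun k hk => ?_, ?_⟩
        · have := H k (by omega)
          rwa [List.take_append_of_le_length hk.le, List.getI_append _ _ _ hk] at this
        · have := H h.length (by omega)
          rwa [List.take_left, List.getI_append_right _ _ _ le_rfl, Nat.sub_self] at this
      · rintro ⟨H1, H2⟩ k hk
        rcases Nat.lt_succ_iff_lt_or_eq.1 hk with hk | rfl
        · rw [List.take_append_of_le_length hk.le, List.getI_append _ _ _ hk]
          exact H1 k hk
        · rwa [List.take_left, List.getI_append_right _ _ _ le_rfl, Nat.sub_self]
    rw [e, isPlay_concat, ← ih]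
    exact and_congr_right fun hp => legal_iff_legalCriterion hp

theorem computablePred_isPlay : ComputablePred start.IsPlay := by
  have hR : PrimrecRel fun (k : ℕ) (h : List Move) => LegalCriterion (h.take k) (h.getI k) :=
    primrecRel_legalCriterion.comp (Primrec.list_take.comp Primrec.fst Primrec.snd)
      (Primrec.list_getI.comp Primrec.snd Primrec.fst)
  have hR' := primrecRel_forall_lt hR
  obtain ⟨hd, hc⟩ := (hR'.comp Primrec.list_length Primrec.id).of_eq fun h =>
    (isPlay_iff_forall_legalCriterion (h := h)).symm
  exact ⟨hd, hc.to_comp⟩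

/-! ### A computable strategy for black -/

/-- Moves of black pawns from or to a square that occurs in `h` or is the initial square of the
spare pawn. In every play, these include all legal moves of black. -/
def blackCandidates (h : List Move) : List Move :=
  ((-30, 0) :: h.flatMap fun m => [m.1, m.2]).flatMap fun q =>
    [(q, (q.1 - 1, q.2 - 1)), (q, (q.1, q.2 - 1)), (q, (q.1 + 1, q.2 - 1)),
      ((q.1 - 1, q.2 + 1), q), ((q.1, q.2 + 1), q), ((q.1 + 1, q.2 + 1), q)]

open Classical in
/-- Black plays the first legal move in the list of candidates. -/
noncomputable def greedyBlack (h : List Move) : Move :=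
  ((blackCandidates h).filter fun m => LegalCriterion h m).headI

theorem primrec_blackCandidates : Primrec blackCandidates := by
  have q : Primrec fun p : List Move × Square => p.2 := Primrec.snd
  have x : Primrec fun p : List Move × Square => p.2.1 := Primrec.fst.comp q
  have y : Primrec fun p : List Move × Square => p.2.2 := Primrec.snd.comp q
  have a {f : List Move × Square → ℤ} (hf : Primrec f) :
    Primrec fun p => f p + 1 := primrec_int_add.comp hf (Primrec.const 1)
  have s {f : List Move × Square → ℤ} (hf : Primrec f) :
    Primrec fun p => f p - 1 := primrec_int_sub.comp hf (Primrec.const 1)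
  have c {f : List Move × Square → Move} {g : List Move × Square → List Move} (hf : Primrec f)
      (hg : Primrec g) : Primrec fun p => f p :: g p := Primrec.list_cons.comp hf hg
  refine Primrec.list_flatMap (Primrec.list_cons.comp (Primrec.const (-30, 0))
    (Primrec.list_flatMap Primrec.id ?_)) ?_
  · exact Primrec.list_cons.comp (Primrec.fst.comp Primrec.snd)
      (Primrec.list_cons.comp (Primrec.snd.comp Primrec.snd) (Primrec.const []))
  · exact c (.pair q (.pair (s x) (s y))) (c (.pair q (.pair x (s y))) (c (.pair q
      (.pair (a x) (s y))) (c (.pair (.pair (s x) (a y)) q) (c (.pair (.pair x (a y)) q)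
        (c (.pair (.pair (a x) (a y)) q) (Primrec.const []))))))

theorem computable_greedyBlack : Computable greedyBlack := by
  classical
  have h1 : PrimrecRel fun (m : Move) (h : List Move) => LegalCriterion h m :=
    primrecRel_legalCriterion.comp Primrec.snd Primrec.fst
  have h2 := Primrec.list_headI.comp ((h1.listFilter).comp primrec_blackCandidates Primrec.id)
  exact (h2.of_eq fun h => by simp only [greedyBlack, id]).to_comp

theorem mem_blackCandidates {h : List Move} (hp : start.IsPlay h) (hh : h.length % 2 = 1) {m : Move}
    (hm : (start.after h).Legal m) : m ∈ blackCandidates h := by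
  obtain ⟨h1, h2, h3, -⟩ := (legal_black_turn hp hh).1 hm
  obtain ⟨s, t⟩ := m
  obtain ⟨x, y⟩ := s
  obtain ⟨x', y'⟩ := t
  rw [canMove_pawn_iff] at h3
  simp only [Color.forward, Color.other] at h1 h2 h3
  -- at the beginning only the spare pawn can move, so one of the two squares has been changed
  have key : (x, y) ∈ ((-30, 0) :: h.flatMap fun m => [m.1, m.2]) ∨
      (x', y') ∈ ((-30, 0) :: h.flatMap fun m => [m.1, m.2]) := by
    by_contra hcon
    simp only [List.mem_cons, List.mem_flatMap, List.not_mem_nil, or_false, not_or] at hcon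
    have hs : (start.after h).board (x, y) = startBoard (x, y) := by
      by_contra h4
      obtain ⟨m, hm, h5⟩ := exists_touching_of_board_ne h4
      exact hcon.1.2 ⟨m, hm, by tauto⟩
    have ht : (start.after h).board (x', y') = startBoard (x', y') := by
      by_contra h4
      obtain ⟨m, hm, h5⟩ := exists_touching_of_board_ne h4
      exact hcon.2.2 ⟨m, hm, by tauto⟩
    rw [hs] at h1
    rw [ht] at h3
    rcases lt_or_ge x 0 with hx | hx
    · by_cases hx' : x = -30
      · subst hx'
        rw [startBoard_spare] at h1
        split_ifs at h1 with hy
        subst hy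
        exact hcon.1.1 rfl
      · rw [startBoard_neg_outside hx hx' h2] at h1
        simp at h1
    · obtain ⟨n, r, hr, rfl⟩ := exists_gadget_coord hx
      rw [startBoard_gadget n r hr] at h1
      have h4 : (r = 3 ∨ r = 5) ∧ y = 1 := by
        unfold gadget at h1
        split_ifs at h1 <;> simp_all
      obtain ⟨hr, rfl⟩ := h4
      obtain ⟨rfl, h3⟩ := h3
      rcases h3 with ⟨hx', k, h3⟩ | ⟨rfl, h3⟩
      · obtain ⟨r', hr', rfl⟩ : ∃ r' : ℕ, (r' = 2 ∨ r' = 4 ∨ r' = 6) ∧ x' = 8 * n + r' := by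
          rcases hr with rfl | rfl <;> rcases hx' with rfl | rfl
          · exact ⟨4, by simp, by push_cast; ring⟩
          · exact ⟨2, by simp, by push_cast; ring⟩
          · exact ⟨6, by simp, by push_cast; ring⟩
          · exact ⟨4, by simp, by push_cast; ring⟩
        rw [startBoard_gadget n r' (by omega)] at h3
        rcases hr' with rfl | rfl | rfl <;> simp [gadget] at h3
      · rw [startBoard_gadget n r (by omega)] at h3
        rcases hr with rfl | rfl <;> simp [gadget] at h3
  simp only [blackCandidates, List.mem_flatMap]
  obtain ⟨rfl, h3⟩ := h3
  have h3' : x' = x - 1 ∨ x' = x ∨ x' = x + 1 := by tauto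
  rcases key with key | key
  · refine ⟨_, key, ?_⟩
    rcases h3' with rfl | rfl | rfl <;> simp [sub_eq_add_neg]
  · refine ⟨_, key, ?_⟩
    rcases h3' with rfl | rfl | rfl <;> simp

theorem isStrategy_greedyBlack : start.IsStrategy .black greedyBlack := by
  classical
  rintro h hp - ht ⟨m, hm⟩
  have hmem : m ∈ (blackCandidates h).filter fun m => LegalCriterion h m :=
    List.mem_filter.2 ⟨mem_blackCandidates hp (turn_eq_black_iff.1 ht) hm,
      by simpa using (legal_iff_legalCriterion hp).1 hm⟩
  rw [legal_iff_legalCriterion hp]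
  have hne : (blackCandidates h).filter (fun m => LegalCriterion h m) ≠ [] :=
    List.ne_nil_of_mem hmem
  have : greedyBlack h ∈ (blackCandidates h).filter fun m => LegalCriterion h m := by
    have e : greedyBlack h = ((blackCandidates h).filter fun m => LegalCriterion h m).headI := by
      simp only [greedyBlack]
    rw [e]
    cases hl : (blackCandidates h).filter fun m => LegalCriterion h m with
    | nil => exact absurd hl hne
    | cons a l => simp
  simpa using (List.mem_filter.1 this).2

/-! ### White can force a draw -/

theorem Board.move_of_ne {b : Board} {m : Move} {q : Square} (h1 : q ≠ m.1) (h2 : q ≠ m.2) :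
    b.move m q = b q := by
  simp [Board.move_apply, h1, h2]

/-- The content of the start board to the right of the prison, by gadgets. -/
theorem startBoard_eq_gadget {x : ℤ} (n r : ℕ) (hx : x = 8 * n + r) (hr : r < 8) (y : ℤ) :
    startBoard (x, y) = gadget n r y := by
  rw [hx, startBoard_gadget n r hr]

theorem haltsAt_unique {v v' n s s' : ℕ} (h : HaltsAt v n s) (h' : HaltsAt v' n s') :
    v = v' ∧ s = s' := by
  have mono {k k' : ℕ} {a : ℕ} (hk : k ≤ k')
      (ha : Code.evaln k (Denumerable.ofNat Code n) n = some a) :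
      Code.evaln k' (Denumerable.ofNat Code n) n = some a :=
    Code.evaln_mono hk ha
  have hs : s = s' := by
    rcases lt_trichotomy s s' with hlt | heq | hlt
    · have := mono (k' := s') hlt h.1
      rw [h'.2] at this
      cases this
    · exact heq
    · have := mono (k' := s) hlt h'.1
      rw [h.2] at this
      cases this
  subst hs
  exact ⟨Option.some.inj (h.1.symm.trans h'.1), rfl⟩

theorem startBoard_eq_whiteRook_iff {x y : ℤ} : startBoard (x, y) = whiteRook ↔
    1 ≤ y ∧ ∃ n : ℕ, (x = 8 * n + 1 ∧ HaltsAt 0 n (y - 1).toNat) ∨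
      (x = 8 * n + 7 ∧ HaltsAt 1 n (y - 1).toNat) := by
  constructor
  · intro h
    rcases lt_or_ge x 0 with hx | hx
    · exfalso
      by_cases h30 : x = -30
      · subst h30
        rw [startBoard_spare] at h
        split_ifs at h; simp at h
      · rw [startBoard_neg hx h30] at h
        unfold prison at h
        split_ifs at h <;> simp at h
    · obtain ⟨n, r, hr, rfl⟩ := exists_gadget_coord hx
      rw [startBoard_gadget n r hr] at h
      unfold gadget at h
      split_ifs at h with h0 h1 h2 h3 h4 h5 h6 h7 <;>
        try (simp only [Option.some.injEq, Prod.mk.injEq, reduceCtorEq, and_false] at h; done)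
      · exact ⟨h4.1, n, .inl ⟨by omega, h4.2⟩⟩
      · exact ⟨h7.1, n, .inr ⟨by omega, h7.2⟩⟩
  · rintro ⟨hy, n, ⟨rfl, h⟩ | ⟨rfl, h⟩⟩
    · rw [startBoard_eq_gadget n 1 (by simp) (by norm_num)]
      simp only [gadget, one_ne_zero, if_false, if_true]
      rw [if_neg (by omega), if_pos ⟨hy, h⟩]
    · rw [startBoard_eq_gadget n 7 (by simp) (by norm_num)]
      simp only [gadget, OfNat.ofNat_ne_zero, OfNat.ofNat_ne_one, if_false, if_true]
      rw [if_neg (by omega), if_pos ⟨hy, h⟩]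

theorem shaftCheck_of_checkmated {h : List Move} (hp : start.IsPlay h)
    (hc : (start.after h).Checkmated .black) : ShaftCheck (start.after h).board :=
  (cageInv_after hp).1.inCheck_black_iff.1 hc.2.1

theorem isDraw_of_forall_not_shaftCheck {w b : List Move → Move}
    (hI : ∀ h, start.IsPlay h → start.Follows .white w h → start.Follows .black b h →
      ¬ ShaftCheck (start.after h).board) : start.IsDraw w b :=
  ⟨fun ⟨h, hp, hw, hb, hc⟩ => hI h hp hw hb (shaftCheck_of_checkmated hp hc),
    not_blackWins w b⟩

/-- White advances the idle pawns of the gadgets, one after the other. -/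
def idleWhite (h : List Move) : Move :=
  ((8 * (h.length / 2 : ℕ) + 4, 5), (8 * (h.length / 2 : ℕ) + 4, 6))

/-- The idle pawns that are still to be moved are in place, and no rook has left the gadgets. -/
def IdleInv (h : List Move) : Prop :=
  (∀ j : ℕ, h.length ≤ 2 * j → (start.after h).board (8 * j + 4, 5) = whitePawn ∧
    (start.after h).board (8 * j + 4, 6) = none) ∧
  ∀ q, (start.after h).board q = whiteRook → 0 ≤ q.1

theorem legal_idleWhite {h : List Move} (hp : start.IsPlay h) (hh : h.length % 2 = 0)
    (hi : IdleInv h) : (start.after h).Legal (idleWhite h) := by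
  obtain ⟨h1, h2⟩ := hi.1 (h.length / 2) (by omega)
  refine (legal_white_turn hp hh).2 (.inl ⟨h1, canMove_pawn_iff.2 ?_⟩)
  exact ⟨by simp [idleWhite, Color.forward], .inr ⟨rfl, h2⟩⟩

theorem idleInv_of_follows : ∀ h, start.IsPlay h → start.Follows .white idleWhite h →
    IdleInv h := by
  refine play_induction IdleInv ⟨fun j _ => ?_, fun q hq => ?_⟩ ?_ ?_
  · simp only [after, start]
    rw [startBoard_eq_gadget j 4 (by simp) (by norm_num),
      startBoard_eq_gadget j 4 (by simp) (by norm_num)]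
    simp [gadget]
  · obtain ⟨-, n, h | h⟩ := startBoard_eq_whiteRook_iff.1 hq <;> omega
  · intro h hp hi ht hl
    rw [turn_eq_white_iff] at ht
    unfold IdleInv
    rw [start_after_concat_board, List.length_append, List.length_singleton]
    have h1 := (hi.1 (h.length / 2) (by omega)).1
    refine ⟨fun j hj => ?_, fun q hq => ?_⟩
    · obtain ⟨h2, h3⟩ := hi.1 j (by omega)
      rw [Board.move_of_ne, Board.move_of_ne]
      · exact ⟨h2, h3⟩
      all_goals simp only [idleWhite, ne_eq, Prod.mk.injEq]; omega
    · rw [Board.move_apply] at hq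
      split_ifs at hq with h4 h5
      · simp only [idleWhite] at hq
        rw [h1] at hq
        simp at hq
      · exact hi.2 q hq
  · intro h m hp hi ht hl
    have ht' : h.length % 2 = 1 := by rw [ne_eq, turn_eq_white_iff] at ht; omega
    obtain ⟨h1, h2, h3, -⟩ := (legal_black_turn hp ht').1 hl
    have h4 := ((cageInv_after hp).1.black _ _ h2 h1).2
    rw [canMove_pawn_iff] at h3
    simp only [Color.forward] at h3
    have h5 := h3.1
    unfold IdleInv
    rw [start_after_concat_board, List.length_append, List.length_singleton]
    refine ⟨fun j hj => ?_, fun q hq => ?_⟩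
    · rw [Board.move_of_ne, Board.move_of_ne]
      · exact hi.1 j (by omega)
      all_goals rw [ne_eq, Prod.ext_iff]; dsimp only; omega
    · rw [Board.move_apply] at hq
      split_ifs at hq with h4 h5
      · rw [h1] at hq; simp at hq
      · exact hi.2 q hq

theorem isStrategy_idleWhite : start.IsStrategy .white idleWhite := fun h hp hf ht _ =>
  legal_idleWhite hp (turn_eq_white_iff.1 ht) (idleInv_of_follows h hp hf)

theorem isDraw_idleWhite (b : List Move → Move) : start.IsDraw idleWhite b := by
  refine isDraw_of_forall_not_shaftCheck fun h hp hw _ hc => ?_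
  obtain ⟨y, -, hy, -⟩ := hc
  have := (idleInv_of_follows h hp hw).2 _ hy
  norm_num at this

/-! ### Black can force a draw -/

/-- The gadget `n` has a rook at rank `y` of one of its rooms, and the exit of this room is
guarded. The rooms are mirror images of each other in the file `8 * n + 4`; the one on the
file `8 * n + 1` is given by `e = 1`, the one on the file `8 * n + 7` by `e = -1`. -/
structure Guarded (b : Board) (n : ℕ) (e y : ℤ) : Prop where
  wedge : b (8 * n + 4 - e, 0) = whitePawn
  guard : b (8 * n + 4 - e, 1) = blackPawn
  exit : b (8 * n + 4 - 2 * e, 0) = none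
  otherExit : b (8 * n + 4 + 2 * e, 0) = none
  inner : ∀ v, 1 ≤ v → b (8 * n + 4 - 2 * e, v) = whitePawn
  outer : ∀ v, 0 ≤ v → b (8 * n + 4 - 4 * e, v) = whitePawn
  floor : ∃ f, -1 ≤ f ∧ f < y ∧ b (8 * n + 4 - 3 * e, f) = whitePawn
  centre : (b (8 * n + 4, 0) = none ∧ b (8 * n + 4 + e, 1) = blackPawn) ∨
    b (8 * n + 4, 0) = blackPawn

/-- What black maintains when white is to move: there is at most one rook in each gadget, it is
confined to its guarded room, and no other piece can interfere. -/
structure GuardInv (b : Board) : Prop where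
  rook : ∀ x y, b (x, y) = whiteRook → 0 ≤ y ∧ ∃ (n : ℕ) (e : ℤ), (e = 1 ∨ e = -1) ∧
    x = 8 * n + 4 - 3 * e ∧ Guarded b n e y
  unique : ∀ (n : ℕ) (e e' y y' : ℤ), (e = 1 ∨ e = -1) → (e' = 1 ∨ e' = -1) →
    b (8 * n + 4 - 3 * e, y) = whiteRook → b (8 * n + 4 - 3 * e', y') = whiteRook → e = e' ∧ y = y'
  black : ∀ x y k, b (x, y) = some (.black, k) → ¬ InCage (x, y) → x = -30 ∨ (0 ≤ x ∧
    (((x % 8 = 3 ∨ x % 8 = 5) ∧ y = 1) ∨ ((x % 8 = 2 ∨ x % 8 = 4 ∨ x % 8 = 6) ∧ y = 0)))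
  low : ∀ x y k, b (x, y) = some (.white, k) → y < 0 →
    y = -1 ∧ 0 ≤ x ∧ (x % 8 = 1 ∨ x % 8 = 4 ∨ x % 8 = 7)
  spare : ∃ y, ∀ v, b (-30, v) = if v = y then blackPawn else none

theorem guardInv_startBoard : GuardInv startBoard where
  rook x y h := by
    obtain ⟨hy, n, ⟨rfl, h⟩ | ⟨rfl, h⟩⟩ := startBoard_eq_whiteRook_iff.1 h
    · refine ⟨by omega, n, 1, .inl rfl, by ring, ⟨?_, ?_, ?_, ?_, fun v hv => ?_, fun v hv => ?_,
        ⟨-1, le_rfl, by omega, ?_⟩, .inl ⟨?_, ?_⟩⟩⟩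
      · rw [startBoard_eq_gadget n 3 (by push_cast; ring) (by norm_num)]; simp [gadget]
      · rw [startBoard_eq_gadget n 3 (by push_cast; ring) (by norm_num)]; simp [gadget]
      · rw [startBoard_eq_gadget n 2 (by push_cast; ring) (by norm_num)]; simp [gadget]
      · rw [startBoard_eq_gadget n 6 (by push_cast; ring) (by norm_num)]; simp [gadget]
      · rw [startBoard_eq_gadget n 2 (by push_cast; ring) (by norm_num)]; simp [gadget, hv]
      · rw [startBoard_eq_gadget n 0 (by push_cast; ring) (by norm_num)]; simp [gadget, hv]
      · rw [startBoard_eq_gadget n 1 (by push_cast; ring) (by norm_num)]; simp [gadget]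
      · rw [startBoard_eq_gadget n 4 (by push_cast; ring) (by norm_num)]; simp [gadget]
      · rw [startBoard_eq_gadget n 5 (by push_cast; ring) (by norm_num)]; simp [gadget]
    · refine ⟨by omega, n, -1, .inr rfl, by ring, ⟨?_, ?_, ?_, ?_, fun v hv => ?_, fun v hv => ?_,
        ⟨-1, le_rfl, by omega, ?_⟩, .inl ⟨?_, ?_⟩⟩⟩
      · rw [startBoard_eq_gadget n 5 (by push_cast; ring) (by norm_num)]; simp [gadget]
      · rw [startBoard_eq_gadget n 5 (by push_cast; ring) (by norm_num)]; simp [gadget]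
      · rw [startBoard_eq_gadget n 6 (by push_cast; ring) (by norm_num)]; simp [gadget]
      · rw [startBoard_eq_gadget n 2 (by push_cast; ring) (by norm_num)]; simp [gadget]
      · rw [startBoard_eq_gadget n 6 (by push_cast; ring) (by norm_num)]; simp [gadget, hv]
      · rw [startBoard_eq_gadget (n + 1) 0 (by push_cast; ring) (by norm_num)]; simp [gadget, hv]
      · rw [startBoard_eq_gadget n 7 (by push_cast; ring) (by norm_num)]; simp [gadget]
      · rw [startBoard_eq_gadget n 4 (by push_cast; ring) (by norm_num)]; simp [gadget]
      · rw [startBoard_eq_gadget n 3 (by push_cast; ring) (by norm_num)]; simp [gadget]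
  unique n e e' y y' he he' h h' := by
    obtain ⟨hy, m, hm⟩ := startBoard_eq_whiteRook_iff.1 h
    obtain ⟨hy', m', hm'⟩ := startBoard_eq_whiteRook_iff.1 h'
    rcases hm with ⟨h1, hm⟩ | ⟨h1, hm⟩ <;> rcases hm' with ⟨h1', hm'⟩ | ⟨h1', hm'⟩ <;>
      obtain rfl : m = n := by omega
    all_goals
      obtain rfl : m' = m := by omega
      have := haltsAt_unique hm hm'
      omega
  black x y k h hc := by
    rcases lt_or_ge x 0 with hx | hx
    · by_cases h30 : x = -30
      · exact .inl h30
      · rw [startBoard_neg_outside hx h30 hc] at h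
        cases h
    · obtain ⟨n, r, hr, rfl⟩ := exists_gadget_coord hx
      rw [startBoard_gadget n r hr] at h
      have h4 : (r = 3 ∨ r = 5) ∧ y = 1 := by
        unfold gadget at h
        split_ifs at h <;> simp_all
      omega
  low x y k h hy := by
    rcases lt_or_ge x 0 with hx | hx
    · exfalso
      by_cases h30 : x = -30
      · subst h30
        rw [startBoard_spare] at h
        split_ifs at h
        simp at h
      · rw [startBoard_neg_outside hx h30 (by simp only [InCage]; omega)] at h
        cases h
    · obtain ⟨n, r, hr, rfl⟩ := exists_gadget_coord hx
      rw [startBoard_gadget n r hr] at h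
      unfold gadget at h
      split_ifs at h <;> omega
  spare := ⟨0, fun v => startBoard_spare v⟩

variable {b : Board}

theorem GuardInv.not_shaftCheck (hg : GuardInv b) : ¬ ShaftCheck b := by
  rintro ⟨y, -, h, -⟩
  obtain ⟨-, n, e, he, h, -⟩ := hg.rook _ _ h
  omega

/-- The contents of finitely many squares, and of two columns of pawns, ensure that a room is
guarded. -/
theorem Guarded.congr {b' : Board} {n : ℕ} {e y y' : ℤ} (h : Guarded b n e y)
    (heq : ∀ u v, ((u = 8 * n + 4 - e ∧ (v = 0 ∨ v = 1)) ∨ (u = 8 * n + 4 - 2 * e ∧ 0 ≤ v) ∨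
      (u = 8 * n + 4 + 2 * e ∧ v = 0) ∨ (u = 8 * n + 4 - 4 * e ∧ 0 ≤ v)) → b' (u, v) = b (u, v))
    (hfl : ∃ f, -1 ≤ f ∧ f < y' ∧ b' (8 * n + 4 - 3 * e, f) = whitePawn)
    (hce : (b' (8 * n + 4, 0) = none ∧ b' (8 * n + 4 + e, 1) = blackPawn) ∨
      b' (8 * n + 4, 0) = blackPawn) : Guarded b' n e y' where
  wedge := by rw [heq _ _ (.inl ⟨rfl, by simp⟩), h.wedge]
  guard := by rw [heq _ _ (.inl ⟨rfl, by simp⟩), h.guard]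
  exit := by rw [heq _ _ (.inr (.inl ⟨rfl, le_rfl⟩)), h.exit]
  otherExit := by rw [heq _ _ (.inr (.inr (.inl ⟨rfl, rfl⟩))), h.otherExit]
  inner v hv := by rw [heq _ _ (.inr (.inl ⟨rfl, by omega⟩)), h.inner v hv]
  outer v hv := by rw [heq _ _ (.inr (.inr (.inr ⟨rfl, by omega⟩))), h.outer v hv]
  floor := hfl
  centre := hce

/-- A rook that reappears after a move of another piece was there before. -/
theorem rook_of_move {m : Move} {q : Square} (hs : b m.1 ≠ whiteRook)
    (h : b.move m q = whiteRook) : q ≠ m.1 ∧ q ≠ m.2 ∧ b q = whiteRook := by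
  rw [Board.move_apply] at h
  split_ifs at h with h1 h2
  · exact absurd h hs
  · exact ⟨h2, h1, h⟩

/-- A guarded position with black to move: black moves the spare pawn. -/
theorem GuardInv.exists_spare_move (hb : CageInv b) (hg : GuardInv b) :
    ∃ m, Position.Legal ⟨b, .black⟩ m ∧ GuardInv (b.move m) := by
  obtain ⟨y, hy⟩ := hg.spare
  have h1 : b (-30, y) = blackPawn := by rw [hy, if_pos rfl]
  have h2 : b (-30, y - 1) = none := by rw [hy, if_neg (by omega)]
  have hcm : CanMove b (.black, .pawn) (-30, y) (-30, y - 1) :=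
    canMove_pawn_iff.2 ⟨by simp [Color.forward, sub_eq_add_neg], .inr ⟨rfl, h2⟩⟩
  have hne : ∀ u v : ℤ, u ≠ -30 → b.move ((-30, y), (-30, y - 1)) (u, v) = b (u, v) := by
    intro u v hu
    apply Board.move_of_ne <;> simp [hu]
  have hr : ∀ u v : ℤ, b.move ((-30, y), (-30, y - 1)) (u, v) = whiteRook → b (u, v) = whiteRook :=
    fun u v h => (rook_of_move (by rw [h1]; simp) h).2.2
  have hg' : GuardInv (b.move ((-30, y), (-30, y - 1))) := by
    refine ⟨fun u v h => ?_, fun n e e' v v' he he' h h' => ?_, fun u v k h hc => ?_,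
      fun u v k h hv => ?_, ⟨y - 1, fun v => ?_⟩⟩
    · obtain ⟨h3, n, e, he, h4, h5⟩ := hg.rook u v (hr u v h)
      refine ⟨h3, n, e, he, h4, h5.congr (fun u v h6 => hne u v (by omega)) ?_ ?_⟩
      · obtain ⟨f, hf⟩ := h5.floor
        exact ⟨f, by rwa [hne _ _ (by omega)]⟩
      · rw [hne _ _ (by omega), hne _ _ (by omega)]
        exact h5.centre
    · exact hg.unique n e e' v v' he he' (hr _ _ h) (hr _ _ h')
    · by_cases hu : u = -30
      · exact .inl hu
      · rw [hne u v hu] at h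
        exact hg.black u v k h hc
    · rw [Board.move_apply] at h
      split_ifs at h with h3 h4
      · rw [h1] at h; simp at h
      · exact hg.low u v k h hv
    · rw [Board.move_apply]
      simp only [Prod.mk.injEq, true_and, h1, hy v]
      split_ifs <;> rfl
  exact ⟨((-30, y), (-30, y - 1)), hb.legal_black_iff.2 ⟨h1, by simp [InCage], hcm,
    hg'.not_shaftCheck⟩, hg'⟩

set_option maxHeartbeats 600000 in
/-- After a legal move of a white pawn, black can restore the invariant: if this pawn attacks the
guards of a gadget with a rook, it is captured by the guard that is not needed. -/
theorem GuardInv.exists_reply_pawn (hb : CageInv b) (hch : ¬ InCheck b .black) (hg : GuardInv b)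
    {x y x' y' : ℤ} (hs : b (x, y) = whitePawn)
    (hcm : CanMove b (.white, .pawn) (x, y) (x', y')) :
    ∃ m, Position.Legal ⟨b.move ((x, y), (x', y')), .black⟩ m ∧
      GuardInv ((b.move ((x, y), (x', y'))).move m) := by
  have hb1 : CageInv (b.move ((x, y), (x', y'))) := hb.move_white hch hs hcm
  have hblack : ∀ u v k, b (u, v) = some (.black, k) → -6 ≤ u → (0 ≤ u ∧
      (((u % 8 = 3 ∨ u % 8 = 5) ∧ v = 1) ∨ ((u % 8 = 2 ∨ u % 8 = 4 ∨ u % 8 = 6) ∧ v = 0))) := by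
    intro u v k h hu
    rcases hg.black u v k h (by simp only [InCage]; omega) with h | h <;> omega
  have hout := hb.white_outside hch hs hcm
  have hx : 0 ≤ x + min y 1 := by
    rcases hb.white _ _ hout.1 hs with h | h
    · exact h.2
    · cases h
  rw [canMove_pawn_iff] at hcm
  simp only [Color.forward, Color.other] at hcm
  obtain ⟨hy', hcm⟩ := hcm
  have hlow : y < 0 → y = -1 ∧ 0 ≤ x ∧ (x % 8 = 1 ∨ x % 8 = 4 ∨ x % 8 = 7) := hg.low x y _ hs
  have hcap : ((x' = x + 1 ∨ x' = x - 1) ∧ b (x', y') = blackPawn ∧ (0 ≤ x' ∧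
      (((x' % 8 = 3 ∨ x' % 8 = 5) ∧ y' = 1) ∨
        ((x' % 8 = 2 ∨ x' % 8 = 4 ∨ x' % 8 = 6) ∧ y' = 0)))) ∨
      (x' = x ∧ b (x', y') = none) := by
    rcases hcm with ⟨h1, k, h2⟩ | h
    · have h3 := hblack _ _ _ h2 (by omega)
      obtain ⟨rfl, -⟩ := hb.black _ _ hout.2 h2
      exact .inl ⟨h1, h2, h3⟩
    · exact .inr h
  have hne : ∀ q, q ≠ (x, y) → q ≠ (x', y') → b.move ((x, y), (x', y')) q = b q :=
    fun q h1 h2 => Board.move_of_ne h1 h2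
  have hne' : ∀ u v, ¬ (u = x ∧ v = y) → ¬ (u = x' ∧ v = y') →
      b.move ((x, y), (x', y')) (u, v) = b (u, v) := by
    intro u v h1 h2
    apply Board.move_of_ne <;> (simp only [ne_eq, Prod.mk.injEq]; assumption)
  have hsame : ∀ u v o, b (u, v) = o → o ≠ whitePawn → ¬ (x' = u ∧ y' = v) →
      b.move ((x, y), (x', y')) (u, v) = o := by
    intro u v o h1 h2 h3
    rw [hne, h1]
    · rintro h
      rw [h, hs] at h1
      exact h2 h1.symm
    · rintro h
      simp only [Prod.mk.injEq] at h
      omega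
  have hsame' : ∀ u v, b (u, v) = whitePawn → ¬ (x = u ∧ y = v) →
      b.move ((x, y), (x', y')) (u, v) = whitePawn := by
    intro u v h1 h2
    rw [hne, h1]
    · rintro h
      simp only [Prod.mk.injEq] at h
      omega
    · rintro h
      simp only [Prod.mk.injEq] at h
      obtain ⟨rfl, rfl⟩ := h
      rw [h1] at hcap
      simp at hcap
  have hr : ∀ u v : ℤ, b.move ((x, y), (x', y')) (u, v) = whiteRook →
      b (u, v) = whiteRook :=
    fun u v h => (rook_of_move (by rw [hs]; simp) h).2.2
  -- the walls, the guard and the exit of a guarded room do not change, and its floor can at most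
  -- rise below the rook
  have hkeep : ∀ (n : ℕ) (e z : ℤ), (e = 1 ∨ e = -1) → b (8 * n + 4 - 3 * e, z) = whiteRook →
      Guarded b n e z →
      (∀ u v, ((u = 8 * n + 4 - e ∧ (v = 0 ∨ v = 1)) ∨ (u = 8 * n + 4 - 2 * e ∧ 0 ≤ v) ∨
        (u = 8 * n + 4 + 2 * e ∧ v = 0) ∨ (u = 8 * n + 4 - 4 * e ∧ 0 ≤ v)) →
          b.move ((x, y), (x', y')) (u, v) = b (u, v)) ∧
      (∃ f, -1 ≤ f ∧ f < z ∧
        b.move ((x, y), (x', y')) (8 * n + 4 - 3 * e, f) = whitePawn) := by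
    intro n e z he hz h
    have hxne : ∀ u v v1, v1 = v + 1 → b (u, v) = whitePawn → b (u, v1) ≠ none →
        (∀ u', u' = u + 1 ∨ u' = u - 1 → b (u', v1) ≠ blackPawn) → ¬ (x = u ∧ y = v) := by
      rintro u v v1 h0 h1 h2 h3 ⟨rfl, rfl⟩
      obtain rfl : v1 = y' := by omega
      rcases hcap with ⟨h4, h5, -⟩ | ⟨rfl, h5⟩
      · exact h3 _ h4 h5
      · exact h2 h5
    have hnb : ∀ u v, -6 ≤ u → ¬ (((u % 8 = 3 ∨ u % 8 = 5) ∧ v = 1) ∨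
        ((u % 8 = 2 ∨ u % 8 = 4 ∨ u % 8 = 6) ∧ v = 0)) → b (u, v) ≠ blackPawn := by
      intro u v h1 h2 h3
      have := hblack u v _ h3 h1
      omega
    refine ⟨?_, ?_⟩
    · rintro u v (⟨rfl, rfl | rfl⟩ | ⟨rfl, hv⟩ | ⟨rfl, rfl⟩ | ⟨rfl, hv⟩)
      · rw [h.wedge]
        refine hsame' _ _ h.wedge (hxne _ _ 1 rfl h.wedge (by rw [h.guard]; simp) ?_)
        rintro u' hu'
        obtain rfl | rfl : u' = 8 * n + 4 - 2 * e ∨ u' = 8 * n + 4 := by omega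
        · rw [h.inner 1 le_rfl]; simp
        · exact hnb _ _ (by omega) (by omega)
      · rw [h.guard]
        refine hsame _ _ _ h.guard (by simp) ?_
        rintro ⟨rfl, h1⟩
        obtain rfl : y = 0 := by omega
        rw [h1, h.guard] at hcap
        rcases hcap with ⟨h2, -, -⟩ | ⟨-, h2⟩
        · obtain rfl | rfl : x = 8 * n + 4 - 2 * e ∨ x = 8 * n + 4 := by omega
          · rw [h.exit] at hs; simp at hs
          · rcases h.centre with h3 | h3
            · rw [h3.1] at hs; simp at hs
            · rw [h3] at hs; simp at hs
        · simp at h2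
      · rcases hv.eq_or_lt with rfl | hv
        · rw [h.exit]
          refine hsame _ _ _ h.exit (by simp) ?_
          rintro ⟨rfl, h1⟩
          rw [h1, h.exit] at hcap
          rcases hcap with ⟨-, h2, -⟩ | ⟨h2, -⟩
          · simp at h2
          · omega
        · have h1 := h.inner v hv
          rw [h1]
          refine hsame' _ _ h1 (hxne _ _ _ rfl h1 (by rw [h.inner (v + 1) (by omega)]; simp) ?_)
          rintro u' hu'
          exact hnb _ _ (by omega) (by omega)
      · rw [h.otherExit]
        refine hsame _ _ _ h.otherExit (by simp) ?_
        rintro ⟨rfl, h1⟩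
        rw [h1, h.otherExit] at hcap
        rcases hcap with ⟨-, h2, -⟩ | ⟨h2, -⟩
        · simp at h2
        · omega
      · have h1 := h.outer v hv
        rw [h1]
        refine hsame' _ _ h1 (hxne _ _ _ rfl h1 (by rw [h.outer (v + 1) (by omega)]; simp) ?_)
        rintro u' hu'
        exact hnb _ _ (by omega) (by omega)
    · obtain ⟨f, hf1, hf2, hf3⟩ := h.floor
      by_cases hsf : x = 8 * n + 4 - 3 * e ∧ y = f
      · obtain ⟨rfl, rfl⟩ := hsf
        rcases hcap with ⟨h1, h2, h3⟩ | ⟨rfl, h2⟩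
        · exfalso
          obtain rfl | rfl : x' = 8 * n + 4 - 2 * e ∨ x' = 8 * n + 4 - 4 * e := by omega
          · rcases hf1.eq_or_lt with rfl | hf1
            · rw [show y' = 0 by omega, h.exit] at h2; simp at h2
            · rw [h.inner y' (by omega)] at h2; simp at h2
          · rw [h.outer y' (by omega)] at h2; simp at h2
        · refine ⟨y', by omega, ?_, ?_⟩
          · rcases (show y' ≤ z by omega).eq_or_lt with h3 | h3
            · rw [h3, hz] at h2; simp at h2
            · exact h3
          · rw [Board.move_apply, if_pos rfl, hf3]
      · exact ⟨f, hf1, hf2, hsame' _ _ hf3 hsf⟩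
  have hblack1 : ∀ u v k, b.move ((x, y), (x', y')) (u, v) = some (.black, k) →
      b (u, v) = some (.black, k) := by
    intro u v k h
    rw [Board.move_apply] at h
    split_ifs at h with h1 h2
    · rw [hs] at h; simp at h
    · exact h
  have hlow1 : ∀ u v k, b.move ((x, y), (x', y')) (u, v) = some (.white, k) → v < 0 →
      v = -1 ∧ 0 ≤ u ∧ (u % 8 = 1 ∨ u % 8 = 4 ∨ u % 8 = 7) := by
    intro u v k h hv
    rw [Board.move_apply] at h
    split_ifs at h with h1 h2
    · simp only [Prod.mk.injEq] at h1
      omega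
    · exact hg.low u v k h hv
  have hspare1 : ∃ z, ∀ v, b.move ((x, y), (x', y')) (-30, v) =
      if v = z then blackPawn else none := by
    obtain ⟨z, hz⟩ := hg.spare
    refine ⟨z, fun v => ?_⟩
    rw [hne, hz] <;> (simp only [ne_eq, Prod.mk.injEq]; omega)
  by_cases hcase : ∃ (n : ℕ) (e z : ℤ), (e = 1 ∨ e = -1) ∧ b (8 * n + 4 - 3 * e, z) = whiteRook ∧
      Guarded b n e z ∧ x' = 8 * n + 4 ∧ y' = 0
  · -- the pawn attacks both guards
    obtain ⟨n, e, z, he, hz, hG, rfl, h0⟩ := hcase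
    obtain rfl : y = -1 := by omega
    subst h0
    have hcen : b (8 * n + 4, 0) = none ∧ b (8 * n + 4 + e, 1) = blackPawn := by
      rcases hG.centre with h | h
      · exact h
      · exfalso
        rw [h] at hcap
        rcases hcap with ⟨h1, -, -⟩ | ⟨-, h2⟩
        · omega
        · simp at h2
    obtain rfl : x = 8 * n + 4 := by
      rw [hcen.1] at hcap
      rcases hcap with ⟨-, h2, -⟩ | ⟨h1, -⟩
      · simp at h2
      · exact h1.symm
    have h1 : b.move ((8 * n + 4, -1), (8 * n + 4, 0)) (8 * n + 4 + e, 1) = blackPawn :=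
      hsame _ _ _ hcen.2 (by simp) (by omega)
    have h2 : b.move ((8 * n + 4, -1), (8 * n + 4, 0)) (8 * n + 4, 0) = whitePawn := by
      rw [Board.move_apply, if_pos rfl, hs]
    set b1 := b.move ((8 * n + 4, -1), (8 * n + 4, 0)) with hb1def
    have hcm1 : CanMove b1 (.black, .pawn) (8 * n + 4 + e, 1) (8 * n + 4, 0) := by
      refine canMove_pawn_iff.2 ⟨by simp [Color.forward], .inl ⟨?_, _, h2⟩⟩
      dsimp only; omega
    have hr2 : ∀ u v, b1.move ((8 * n + 4 + e, 1), (8 * n + 4, 0)) (u, v) = whiteRook →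
        b1 (u, v) = whiteRook := fun u v h => (rook_of_move (by rw [h1]; simp) h).2.2
    have hne2 : ∀ u v, ¬ (u = 8 * n + 4 + e ∧ v = 1) → ¬ (u = 8 * n + 4 ∧ v = 0) →
        b1.move ((8 * n + 4 + e, 1), (8 * n + 4, 0)) (u, v) = b1 (u, v) := by
      intro u v h3 h4
      apply Board.move_of_ne <;> (simp only [ne_eq, Prod.mk.injEq]; omega)
    have hc2 : b1.move ((8 * n + 4 + e, 1), (8 * n + 4, 0)) (8 * n + 4, 0) = blackPawn := by
      rw [Board.move_apply, if_pos rfl, h1]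
    have hg2 : GuardInv (b1.move ((8 * n + 4 + e, 1), (8 * n + 4, 0))) := by
      refine ⟨fun u v h => ?_, fun n e e' v v' he he' h h' =>
        hg.unique n e e' v v' he he' (hr _ _ (hr2 _ _ h)) (hr _ _ (hr2 _ _ h')),
        fun u v k h hc => ?_, fun u v k h hv => ?_, ?_⟩
      · have h' := hr _ _ (hr2 _ _ h)
        obtain ⟨h3, n', e', he', rfl, hG'⟩ := hg.rook u v h'
        obtain ⟨hk1, f, hf1, hf2, hf3⟩ := hkeep n' e' v he' h' hG'
        have hee : n' = n → e' = e := by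
          rintro rfl
          exact (hg.unique n' e' e v z he' he h' hz).1
        refine ⟨h3, n', e', he', rfl, hG'.congr (fun u v huv => ?_) ⟨f, hf1, hf2, ?_⟩ ?_⟩
        · rw [hne2 _ _ (by omega) (by omega)]
          exact hk1 u v huv
        · rw [hne2 _ _ (by omega) (by omega)]
          exact hf3
        · by_cases hnn : n' = n
          · subst hnn
            exact .inr hc2
          · rw [hne2 _ _ (by omega) (by omega), hne2 _ _ (by omega) (by omega),
              hne' _ _ (by omega) (by omega), hne' _ _ (by omega) (by omega)]
            exact hG'.centre
      · rw [Board.move_apply] at h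
        split_ifs at h with h3 h4
        · simp only [Prod.mk.injEq] at h3
          omega
        · exact hg.black u v k (hblack1 u v k h) hc
      · rw [Board.move_apply] at h
        split_ifs at h with h3 h4
        · rw [h1] at h; simp at h
        · exact hlow1 u v k h hv
      · obtain ⟨w, hw⟩ := hspare1
        exact ⟨w, fun v => by rw [hne2 _ _ (by omega) (by omega), hw]⟩
    exact ⟨_, hb1.legal_black_iff.2 ⟨h1, by simp only [InCage]; omega, hcm1,
      hg2.not_shaftCheck⟩, hg2⟩
  · -- otherwise black moves the spare pawn
    push Not at hcase
    refine GuardInv.exists_spare_move hb1 ⟨fun u v h => ?_, fun n e e' v v' he he' h h' =>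
      hg.unique n e e' v v' he he' (hr _ _ h) (hr _ _ h'),
      fun u v k h hc => hg.black u v k (hblack1 u v k h) hc, hlow1, hspare1⟩
    have h' := hr _ _ h
    obtain ⟨h3, n, e, he, rfl, hG⟩ := hg.rook u v h'
    obtain ⟨hk1, hk2⟩ := hkeep n e v he h' hG
    refine ⟨h3, n, e, he, rfl, hG.congr hk1 hk2 ?_⟩
    have hnc := hcase n e v he h' hG
    rcases hG.centre with ⟨h4, h5⟩ | h4
    · refine .inl ⟨hsame _ _ _ h4 (by simp) (by tauto), hsame _ _ _ h5 (by simp) ?_⟩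
      rintro ⟨rfl, h6⟩
      obtain rfl : y = 0 := by omega
      rw [h6, h5] at hcap
      replace hcap := hcap.resolve_right (by simp)
      obtain rfl | rfl : x = 8 * n + 4 + 2 * e ∨ x = 8 * n + 4 := by omega
      · rw [hG.otherExit] at hs; simp at hs
      · rw [h4] at hs; simp at hs
    · exact .inr (hsame _ _ _ h4 (by simp) (by tauto))

set_option maxHeartbeats 600000 in
/-- After a legal move of a white rook, black can restore the invariant: if this rook has come to
an exit, it is captured by the guard of this exit. -/
theorem GuardInv.exists_reply_rook (hb : CageInv b) (hch : ¬ InCheck b .black) (hg : GuardInv b)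
    {x y x' y' : ℤ} (hs : b (x, y) = whiteRook)
    (hcm : CanMove b (.white, .rook) (x, y) (x', y')) :
    ∃ m, Position.Legal ⟨b.move ((x, y), (x', y')), .black⟩ m ∧
      GuardInv ((b.move ((x, y), (x', y'))).move m) := by
  have hb1 : CageInv (b.move ((x, y), (x', y'))) := hb.move_white hch hs hcm
  obtain ⟨hy, n, e, he, rfl, hG⟩ := hg.rook x y hs
  rw [canMove_rook_iff, slides_rookDirs_iff] at hcm
  obtain ⟨hsl, hcap⟩ := hcm
  have hnw : ∀ k, b (x', y') ≠ some (.white, k) := by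
    intro k h
    rcases hcap with h1 | ⟨k', h1⟩ <;> rw [h] at h1 <;> simp [Color.other] at h1
  obtain ⟨f, hf1, hf2, hf3⟩ := hG.floor
  have hout := hG.outer y hy
  have hr : ∀ u v : ℤ, b.move ((8 * n + 4 - 3 * e, y), (x', y')) (u, v) = whiteRook →
      (u, v) = (x', y') ∨ ((u, v) ≠ (8 * n + 4 - 3 * e, y) ∧ b (u, v) = whiteRook) := by
    intro u v h
    rw [Board.move_apply] at h
    split_ifs at h with h1 h2
    · exact .inl h1
    · exact .inr ⟨h2, h⟩
  -- the rook stays in its room or goes to the exit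
  have hwhere : (x' = 8 * n + 4 - 3 * e ∧ f < y' ∧ y' ≠ y) ∨
      (y = 0 ∧ y' = 0 ∧ x' = 8 * n + 4 - 2 * e) := by
    have hhor : ∀ d : ℤ, (d = 1 ∨ d = -1) → y' = y → (x' = 8 * n + 4 - 3 * e + d ∨
        b (8 * n + 4 - 3 * e + d, y) = none) →
        (x' ≠ 8 * n + 4 - 3 * e + d → x' = 8 * n + 4 - 3 * e + 2 * d ∨
          b (8 * n + 4 - 3 * e + 2 * d, y) = none) →
        (y = 0 ∧ y' = 0 ∧ x' = 8 * n + 4 - 2 * e) := by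
      rintro d hd rfl h1 h2
      by_cases hde : d = e
      · subst hde
        rcases hy.eq_or_lt with rfl | hy
        · refine ⟨rfl, rfl, ?_⟩
          by_contra hne
          have h3 : b (8 * n + 4 - 3 * d + 2 * d, 0) = whitePawn := by
            rw [show 8 * n + 4 - 3 * d + 2 * d = 8 * n + 4 - d by ring, hG.wedge]
          rcases h2 (by omega) with h4 | h4
          · rw [← h4] at h3
            exact hnw _ h3
          · rw [h3] at h4; simp at h4
        · exfalso
          have h3 : b (8 * n + 4 - 3 * d + d, y') = whitePawn := by
            rw [show 8 * n + 4 - 3 * d + d = 8 * n + 4 - 2 * d by ring, hG.inner y' (by omega)]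
          rcases h1 with h4 | h4
          · rw [← h4] at h3
            exact hnw _ h3
          · rw [h3] at h4; simp at h4
      · exfalso
        obtain rfl : d = -e := by omega
        have h3 : b (8 * n + 4 - 3 * e + -e, y') = whitePawn := by
          rw [show 8 * n + 4 - 3 * e + -e = 8 * n + 4 - 4 * e by ring, hG.outer y' (by omega)]
        rcases h1 with h4 | h4
        · rw [← h4] at h3
          exact hnw _ h3
        · rw [h3] at h4; simp at h4
    rcases hsl with ⟨rfl, h1, h2⟩ | ⟨rfl, h1, h2⟩ | ⟨rfl, h1, h2⟩ | ⟨rfl, h1, h2⟩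
    · right
      refine hhor 1 (.inl rfl) rfl ?_ ?_
      · by_cases h3 : x' = 8 * n + 4 - 3 * e + 1
        · exact .inl h3
        · exact .inr (h2 _ (by omega) (by omega))
      · intro h4
        by_cases h3 : x' = 8 * n + 4 - 3 * e + 2 * 1
        · exact .inl h3
        · exact .inr (h2 _ (by omega) (by omega))
    · right
      refine hhor (-1) (.inr rfl) rfl ?_ ?_
      · by_cases h3 : x' = 8 * n + 4 - 3 * e + -1
        · exact .inl h3
        · exact .inr (h2 _ (by omega) (by omega))
      · intro h4
        by_cases h3 : x' = 8 * n + 4 - 3 * e + 2 * -1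
        · exact .inl h3
        · exact .inr (h2 _ (by omega) (by omega))
    · exact .inl ⟨rfl, by omega, by omega⟩
    · refine .inl ⟨rfl, ?_, by omega⟩
      by_contra hcon
      rcases (not_lt.1 hcon).eq_or_lt with rfl | h3
      · exact hnw _ hf3
      · have := h2 f h3 hf2
        rw [hf3] at this
        simp at this
  have hne : ∀ u v, ¬ (u = 8 * n + 4 - 3 * e ∧ v = y) → ¬ (u = x' ∧ v = y') →
      b.move ((8 * n + 4 - 3 * e, y), (x', y')) (u, v) = b (u, v) := by
    intro u v h1 h2
    apply Board.move_of_ne <;> (simp only [ne_eq, Prod.mk.injEq]; assumption)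
  rcases hwhere with ⟨rfl, hfy, hyy⟩ | ⟨rfl, rfl, rfl⟩
  · -- within the room
    have hrk : ∀ u v : ℤ,
        b.move ((8 * n + 4 - 3 * e, y), (8 * n + 4 - 3 * e, y')) (u, v) = whiteRook →
        (u = 8 * n + 4 - 3 * e ∧ v = y') ∨ b (u, v) = whiteRook ∧
          ∀ (n' : ℕ) (e' : ℤ), (e' = 1 ∨ e' = -1) → u = 8 * n' + 4 - 3 * e' → n' ≠ n := by
      intro u v h
      rcases hr u v h with h1 | ⟨h1, h2⟩
      · simp only [Prod.mk.injEq] at h1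
        exact .inl h1
      · refine .inr ⟨h2, ?_⟩
        rintro n' e' he' rfl rfl
        obtain ⟨rfl, rfl⟩ := hg.unique n' e' e v y he' he h2 hs
        exact h1 rfl
    refine GuardInv.exists_spare_move hb1 ⟨fun u v h => ?_, fun n' e1 e2 v1 v2 he1 he2 h1 h2 => ?_,
      fun u v k h hc => ?_, fun u v k h hv => ?_, ?_⟩
    · rcases hrk u v h with ⟨rfl, rfl⟩ | ⟨h1, h2⟩
      · refine ⟨by omega, n, e, he, rfl, hG.congr (fun u v huv => hne u v (by omega) (by omega))
          ⟨f, hf1, hfy, ?_⟩ ?_⟩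
        · rw [hne _ _ (by omega) (by omega), hf3]
        · rw [hne _ _ (by omega) (by omega), hne _ _ (by omega) (by omega)]
          exact hG.centre
      · obtain ⟨h3, n', e', he', rfl, hG'⟩ := hg.rook u v h1
        have hnn := h2 n' e' he' rfl
        refine ⟨h3, n', e', he', rfl, hG'.congr (fun u v huv => hne u v (by omega) (by omega))
          ?_ ?_⟩
        · obtain ⟨f', hf'⟩ := hG'.floor
          refine ⟨f', ?_⟩
          rw [hne _ _ (by omega) (by omega)]
          exact hf'
        · rw [hne _ _ (by omega) (by omega), hne _ _ (by omega) (by omega)]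
          exact hG'.centre
    · rcases hrk _ _ h1 with ⟨h3, rfl⟩ | ⟨h3, h4⟩ <;> rcases hrk _ _ h2 with ⟨h5, rfl⟩ | ⟨h5, h6⟩
      · exact ⟨by omega, rfl⟩
      · exact absurd (by omega) (h6 n' e2 he2 rfl)
      · exact absurd (by omega) (h4 n' e1 he1 rfl)
      · exact hg.unique n' e1 e2 v1 v2 he1 he2 h3 h5
    · rw [Board.move_apply] at h
      split_ifs at h with h1 h2
      · rw [hs] at h; simp at h
      · exact hg.black u v k h hc
    · rw [Board.move_apply] at h
      split_ifs at h with h1 h2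
      · simp only [Prod.mk.injEq] at h1
        omega
      · exact hg.low u v k h hv
    · obtain ⟨z, hz⟩ := hg.spare
      exact ⟨z, fun v => by rw [hne _ _ (by omega) (by omega), hz]⟩
  · -- to the exit, where it is captured
    set b1 := b.move ((8 * n + 4 - 3 * e, 0), (8 * n + 4 - 2 * e, 0)) with hb1def
    have h1 : b1 (8 * n + 4 - e, 1) = blackPawn := by
      rw [hne _ _ (by omega) (by omega), hG.guard]
    have h2 : b1 (8 * n + 4 - 2 * e, 0) = whiteRook := by
      rw [hb1def, Board.move_apply, if_pos rfl, hs]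
    have hcm1 : CanMove b1 (.black, .pawn) (8 * n + 4 - e, 1) (8 * n + 4 - 2 * e, 0) := by
      refine canMove_pawn_iff.2 ⟨by simp [Color.forward], .inl ⟨?_, _, h2⟩⟩
      dsimp only; omega
    have hne2 : ∀ u v, ¬ (u = 8 * n + 4 - e ∧ v = 1) → ¬ (u = 8 * n + 4 - 2 * e ∧ v = 0) →
        b1.move ((8 * n + 4 - e, 1), (8 * n + 4 - 2 * e, 0)) (u, v) = b1 (u, v) := by
      intro u v h3 h4
      apply Board.move_of_ne <;> (simp only [ne_eq, Prod.mk.injEq]; omega)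
    have hr2 : ∀ u v, b1.move ((8 * n + 4 - e, 1), (8 * n + 4 - 2 * e, 0)) (u, v) = whiteRook →
        b (u, v) = whiteRook ∧ ∀ (n' : ℕ) (e' : ℤ), (e' = 1 ∨ e' = -1) →
          u = 8 * n' + 4 - 3 * e' → n' ≠ n := by
      intro u v h
      obtain ⟨-, h4, h⟩ := rook_of_move (by rw [h1]; simp) h
      rcases hr u v h with h3 | ⟨h3, h5⟩
      · exact absurd h3 h4
      · refine ⟨h5, ?_⟩
        rintro n' e' he' rfl rfl
        obtain ⟨rfl, rfl⟩ := hg.unique n' e' e v 0 he' he h5 hs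
        exact h3 rfl
    have hg2 : GuardInv (b1.move ((8 * n + 4 - e, 1), (8 * n + 4 - 2 * e, 0))) := by
      refine ⟨fun u v h => ?_, fun n e e' v v' he he' h h' =>
        hg.unique n e e' v v' he he' (hr2 _ _ h).1 (hr2 _ _ h').1,
        fun u v k h hc => ?_, fun u v k h hv => ?_, ?_⟩
      · obtain ⟨h', hnn⟩ := hr2 _ _ h
        obtain ⟨h3, n', e', he', rfl, hG'⟩ := hg.rook u v h'
        have hnn := hnn n' e' he' rfl
        refine ⟨h3, n', e', he', rfl, hG'.congr (fun u v huv => ?_) ?_ ?_⟩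
        · rw [hne2 _ _ (by omega) (by omega), hne _ _ (by omega) (by omega)]
        · obtain ⟨f', hf'⟩ := hG'.floor
          refine ⟨f', ?_⟩
          rw [hne2 _ _ (by omega) (by omega), hne _ _ (by omega) (by omega)]
          exact hf'
        · rw [hne2 _ _ (by omega) (by omega), hne _ _ (by omega) (by omega),
            hne2 _ _ (by omega) (by omega), hne _ _ (by omega) (by omega)]
          exact hG'.centre
      · rw [Board.move_apply] at h
        split_ifs at h with h3 h4
        · simp only [Prod.mk.injEq] at h3
          omega
        · rw [hb1def, Board.move_apply] at h
          split_ifs at h with h5 h6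
          · rw [hs] at h; simp at h
          · exact hg.black u v k h hc
      · rw [Board.move_apply] at h
        split_ifs at h with h3 h4
        · rw [h1] at h; simp at h
        · rw [hb1def, Board.move_apply] at h
          split_ifs at h with h5 h6
          · simp only [Prod.mk.injEq] at h5
            omega
          · exact hg.low u v k h hv
      · obtain ⟨z, hz⟩ := hg.spare
        exact ⟨z, fun v => by
          rw [hne2 _ _ (by omega) (by omega), hne _ _ (by omega) (by omega), hz]⟩
    exact ⟨_, hb1.legal_black_iff.2 ⟨h1, by simp only [InCage]; omega, hcm1,
      hg2.not_shaftCheck⟩, hg2⟩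

theorem GuardInv.exists_reply (hb : CageInv b) (hch : ¬ InCheck b .black) (hg : GuardInv b)
    {m : Move} (hm : Position.Legal ⟨b, .white⟩ m) :
    ∃ m', Position.Legal ⟨b.move m, .black⟩ m' ∧ GuardInv ((b.move m).move m') := by
  obtain ⟨⟨x, y⟩, ⟨x', y'⟩⟩ := m
  obtain ⟨hs, hcm⟩ | ⟨hs, hcm⟩ := (hb.legal_white_iff hch).1 hm
  · exact hg.exists_reply_pawn hb hch hs hcm
  · exact hg.exists_reply_rook hb hch hs hcm

open Classical in
/-- Black restores the invariant whenever this is possible. -/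
noncomputable def guardBlack (h : List Move) : Move :=
  if H : ∃ m, (start.after h).Legal m ∧ GuardInv ((start.after h).board.move m) then H.choose
  else default

/-- Along the plays of `guardBlack`, the invariant holds when white is to move, and can be restored
when black is to move. -/
theorem guardInv_of_follows : ∀ h, start.IsPlay h → start.Follows .black guardBlack h →
    (h.length % 2 = 0 → GuardInv (start.after h).board) ∧ (h.length % 2 = 1 →
      ∃ m, (start.after h).Legal m ∧ GuardInv ((start.after h).board.move m)) := by
  refine play_induction _ ⟨fun _ => guardInv_startBoard, by simp⟩ ?_ ?_
  · intro h hp hi ht _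
    rw [turn_eq_black_iff] at ht
    have H := hi.2 ht
    rw [List.length_append, List.length_singleton, start_after_concat_board]
    refine ⟨fun _ => ?_, by omega⟩
    rw [guardBlack, dif_pos H]
    exact H.choose_spec.2
  · intro h m hp hi ht hl
    have ht' : h.length % 2 = 0 := by rw [ne_eq, turn_eq_black_iff] at ht; omega
    rw [List.length_append, List.length_singleton]
    refine ⟨by omega, fun _ => ?_⟩
    have hb := cageInv_after hp
    rw [after_concat, start_after_eq_white ht']
    rw [start_after_eq_white ht'] at hl
    exact (hi.1 ht').exists_reply hb.1 (hb.2 ht') hl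

theorem isStrategy_guardBlack : start.IsStrategy .black guardBlack := by
  intro h hp hf ht _
  have H := (guardInv_of_follows h hp hf).2 (turn_eq_black_iff.1 ht)
  rw [guardBlack, dif_pos H]
  exact H.choose_spec.1

theorem isDraw_guardBlack (w : List Move → Move) : start.IsDraw w guardBlack := by
  refine ⟨?_, not_blackWins w _⟩
  rintro ⟨h, hp, -, hf, ht, -, hno⟩
  obtain ⟨m, hm, -⟩ := (guardInv_of_follows h hp hf).2 (turn_eq_black_iff.1 ht)
  exact hno m hm

/-! ### Positions with one displaced rook -/

theorem Board.move_self (b : Board) (q : Square) : b.move (q, q) = b := by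
  funext q'
  rw [Board.move_apply]
  split_ifs with h
  · rw [h]
  · rfl

/-- The squares that do not change while white follows the plan below, apart from the displacement
of one rook. -/
def Static (q : Square) : Prop :=
  (q.1 < 0 ∧ q.1 ≠ -30) ∨ (0 ≤ q.1 ∧ q.1 % 8 ≠ 4 ∧ ((q.1 % 8 ≠ 3 ∧ q.1 % 8 ≠ 5) ∨ q.2 ≤ 0))

/-- The static squares are as at the beginning, except that a rook may have been carried from `src`
to `cur`; and the black pieces are the spare pawn, guards, and pawns that have left the guard to
walk down the middle file of their gadget. No black pawn is lower than `-K`. -/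
structure RookInv (b : Board) (src cur : Square) (K : ℕ) : Prop where
  static : ∀ q, Static q → b q = startBoard.move (src, cur) q
  black : ∀ x y k, b (x, y) = some (.black, k) → ¬ InCage (x, y) → -K ≤ y ∧ (x = -30 ∨ (0 ≤ x ∧
    (((x % 8 = 3 ∨ x % 8 = 5) ∧ y = 1) ∨ (x % 8 = 4 ∧ y ≤ 0))))
  white : ∀ x y k, b (x, y) = some (.white, k) → 0 ≤ x → x % 8 = 4 → -1 ≤ y
  spare : ∃ z, ∀ v, b (-30, v) = if v = z then blackPawn else none

theorem startBoard_low {x y : ℤ} (hx : 0 ≤ x) (h : y < -1 ∨ (y ≤ 0 ∧ (x % 8 = 2 ∨ x % 8 = 6)) ∨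
    (y < 0 ∧ (x % 8 = 3 ∨ x % 8 = 5))) : startBoard (x, y) = none := by
  obtain ⟨n, r, hr, rfl⟩ := exists_gadget_coord hx
  rw [startBoard_gadget n r hr]
  unfold gadget
  split_ifs <;> first | rfl | omega

theorem startBoard_wedge {x : ℤ} (hx : 0 ≤ x) (h : x % 8 = 3 ∨ x % 8 = 5) :
    startBoard (x, 0) = whitePawn := by
  obtain ⟨n, r, hr, rfl⟩ := exists_gadget_coord hx
  rw [startBoard_gadget n r hr]
  unfold gadget
  split_ifs <;> first | rfl | omega

theorem startBoard_room {n : ℕ} {e y s : ℤ} (he : e = 1 ∨ e = -1)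
    (hr : startBoard (8 * n + 4 - 3 * e, s) = whiteRook) (hy : 0 ≤ y) (hys : y ≠ s) :
    startBoard (8 * n + 4 - 3 * e, y) = none := by
  by_cases h : startBoard (8 * n + 4 - 3 * e, y) = whiteRook
  · exact absurd (guardInv_startBoard.unique n e e _ _ he he h hr).2 hys
  · rcases he with rfl | rfl
    · rw [startBoard_eq_gadget n 1 (by push_cast; ring) (by norm_num)] at h ⊢
      simp only [gadget, one_ne_zero, if_false, if_true] at h ⊢
      split_ifs at h ⊢ <;> first | rfl | omega | exact absurd rfl h
    · rw [startBoard_eq_gadget n 7 (by push_cast; ring) (by norm_num)] at h ⊢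
      simp only [gadget, OfNat.ofNat_ne_zero, OfNat.ofNat_ne_one, if_false, if_true] at h ⊢
      split_ifs at h ⊢ <;> first | rfl | omega | exact absurd rfl h

/-- The moves that black has while white follows the plan below: with the spare pawn, down the
middle file of a gadget, and with a guard to the middle file. -/
def BlackStep (b : Board) (m : Move) : Prop :=
  (∃ z, m = ((-30, z), (-30, z - 1)) ∧ b (-30, z) = blackPawn ∧ b (-30, z - 1) = none) ∨
  (∃ x y, 0 ≤ x ∧ x % 8 = 4 ∧ y ≤ 0 ∧ m = ((x, y), (x, y - 1)) ∧ b (x, y) = blackPawn ∧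
    b (x, y - 1) = none) ∨
  (∃ x x' k, 0 ≤ x ∧ x % 8 = 4 ∧ (x' = x - 1 ∨ x' = x + 1) ∧ m = ((x', 1), (x, 0)) ∧
    b (x', 1) = blackPawn ∧ b (x, 0) = some (.white, k))

namespace RookInv

variable {b : Board} {src cur : Square} {K : ℕ}

theorem apply_of_ne (hI : RookInv b src cur K) {q : Square} (hq : Static q) (h1 : q ≠ src)
    (h2 : q ≠ cur) : b q = startBoard q := by
  rw [hI.static q hq, Board.move_of_ne h1 h2]

theorem apply_cur (hI : RookInv b src cur K) (hc : Static cur) : b cur = startBoard src := by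
  rw [hI.static cur hc, Board.move_apply, if_pos rfl]

/-- If no black pawn attacks the displaced rook, then the moves of black are as described. -/
theorem blackStep (hb : CageInv b) (hI : RookInv b src cur K)
    (hsrc : src.1 % 8 = 1 ∨ src.1 % 8 = 7) (hrook : startBoard src = whiteRook ∨ cur = src)
    (hcap : ∀ x, x = cur.1 + 1 ∨ x = cur.1 - 1 → b (x, cur.2 + 1) ≠ blackPawn) {m : Move}
    (hm : Position.Legal ⟨b, .black⟩ m) : BlackStep b m := by
  obtain ⟨hs, hc, hc', hcm⟩ := hb.black_outside hm
  obtain ⟨⟨x, y⟩, ⟨x', y'⟩⟩ := m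
  rw [canMove_pawn_iff] at hcm
  simp only [Color.forward, Color.other] at hs hc hc' hcm
  obtain ⟨hy', hcm⟩ := hcm
  obtain rfl : y' = y - 1 := by omega
  -- an empty static square off the path of the rook cannot be the target of a capture
  have hno : ∀ k, Static (x', y - 1) → startBoard (x', y - 1) = none →
      x' = x + 1 ∨ x' = x - 1 → b (x', y - 1) = some (.white, k) → False := by
    intro k h1 h2 h3 h4
    rw [hI.static _ h1, Board.move_apply] at h4
    split_ifs at h4 with h5 h6
    · simp only at h5
      refine hcap x (by rw [← h5]; dsimp only; omega) ?_
      rw [← h5]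
      simpa using hs
    · rw [h2] at h4
      simp at h4
  rcases (hI.black x y _ hs hc).2 with rfl | ⟨hx, ⟨h8, rfl⟩ | ⟨h8, hy⟩⟩
  · rcases hcm with ⟨h1, k, h2⟩ | ⟨rfl, h2⟩
    · have h3 : x' < 0 ∧ x' ≠ -30 := by omega
      exact (hno k (.inl h3) (startBoard_neg_outside h3.1 h3.2 hc') h1 h2).elim
    · exact .inl ⟨y, rfl, hs, h2⟩
  · rcases hcm with ⟨h1, k, h2⟩ | ⟨rfl, h2⟩
    · by_cases h4 : x' % 8 = 4
      · exact .inr (.inr ⟨x', x, k, by omega, h4, by omega, by simp, hs, by simpa using h2⟩)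
      · refine (hno k (.inr ?_) (startBoard_low (by omega) (by omega)) h1 h2).elim
        dsimp only; omega
    · exfalso
      rw [hI.static _ (.inr (by dsimp only; omega)), Board.move_apply] at h2
      have hw := startBoard_wedge hx h8
      split_ifs at h2 with h5 h6
      · rcases hrook with h7 | h7
        · rw [h7] at h2; simp at h2
        · simp only at h5
          rw [← h7, ← h5] at hsrc
          dsimp only at hsrc
          omega
      · simp only at h6
        rw [← h6] at hsrc
        dsimp only at hsrc
        omega
      · rw [show (1 : ℤ) - 1 = 0 by rfl, hw] at h2
        simp at h2
  · rcases hcm with ⟨h1, k, h2⟩ | ⟨rfl, h2⟩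
    · refine (hno k (.inr ?_) (startBoard_low (by omega) (by omega)) h1 h2).elim
      dsimp only; omega
    · exact .inr (.inl ⟨x', y, hx, h8, hy, rfl, hs, h2⟩)

theorem black_move (hI : RookInv b src cur K) {m : Move} (hm : BlackStep b m) :
    RookInv (b.move m) src cur (K + 1) := by
  have hst : ¬ Static m.1 ∧ ¬ Static m.2 := by
    unfold Static
    rcases hm with ⟨z, rfl, -⟩ | ⟨x, y, h1, h2, h3, rfl, -⟩ | ⟨x, x', k, h1, h2, h3, rfl, -⟩ <;>
      dsimp only <;> omega
  have hs : b m.1 = blackPawn := by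
    rcases hm with ⟨z, rfl, h, -⟩ | ⟨x, y, -, -, -, rfl, h, -⟩ | ⟨x, x', k, -, -, -, rfl, h, -⟩ <;>
      exact h
  refine ⟨fun q hq => ?_, fun x y k h hc => ?_, fun x y k h hx h8 => ?_, ?_⟩
  · rw [Board.move_of_ne, hI.static q hq]
    · rintro rfl; exact hst.1 hq
    · rintro rfl; exact hst.2 hq
  · rw [Board.move_apply] at h
    split_ifs at h with h1 h2
    · rcases hm with ⟨z, rfl, h3, -⟩ | ⟨x1, y1, h3, h4, h5, rfl, h6, -⟩ |
        ⟨x1, x', k, h3, h4, h5, rfl, -⟩ <;> simp only [Prod.mk.injEq] at h1 <;>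
        obtain ⟨rfl, rfl⟩ := h1
      · have := (hI.black _ _ _ h3 (by simp [InCage])).1
        exact ⟨by push_cast; omega, .inl rfl⟩
      · have := (hI.black _ _ _ h6 (by simp only [InCage]; omega)).1
        exact ⟨by push_cast; omega, .inr (by omega)⟩
      · exact ⟨by push_cast; omega, .inr (by omega)⟩
    · have := hI.black x y k h hc
      push_cast
      omega
  · rw [Board.move_apply] at h
    split_ifs at h with h1 h2
    · rw [hs] at h; simp at h
    · exact hI.white x y k h hx h8
  · obtain ⟨w, hw⟩ := hI.spare
    rcases hm with ⟨z, rfl, h3, -⟩ | ⟨x1, y1, h3, h4, h5, rfl, h6, -⟩ |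
        ⟨x1, x', k, h3, h4, h5, rfl, -⟩
    · refine ⟨z - 1, fun v => ?_⟩
      rw [Board.move_apply]
      have hzw : z = w := by
        by_contra hne
        rw [hw, if_neg hne] at h3
        simp at h3
      subst hzw
      simp only [Prod.mk.injEq, true_and, h3, hw v]
      split_ifs <;> rfl
    · refine ⟨w, fun v => ?_⟩
      rw [Board.move_of_ne, hw] <;> (simp only [ne_eq, Prod.mk.injEq]; omega)
    · refine ⟨w, fun v => ?_⟩
      rw [Board.move_of_ne, hw] <;> (simp only [ne_eq, Prod.mk.injEq]; omega)

/-- A white move outside the static squares. -/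
theorem white_move (hI : RookInv b src cur K) {m : Move} {k : Kind} (hs : b m.1 = some (.white, k))
    (h1 : ¬ Static m.1) (h2 : ¬ Static m.2) (h3 : 0 ≤ m.1.1) (h4 : 0 ≤ m.2.1)
    (h5 : -1 ≤ m.2.2) : RookInv (b.move m) src cur (K + 1) := by
  refine ⟨fun q hq => ?_, fun x y k h hc => ?_, fun x y k h hx h8 => ?_, ?_⟩
  · rw [Board.move_of_ne, hI.static q hq]
    · rintro rfl; exact h1 hq
    · rintro rfl; exact h2 hq
  · rw [Board.move_apply] at h
    split_ifs at h with h6 h7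
    · rw [hs] at h; simp at h
    · have := hI.black x y k h hc
      push_cast
      omega
  · rw [Board.move_apply] at h
    split_ifs at h with h6 h7
    · rw [← h6] at h5
      exact h5
    · exact hI.white x y k h hx h8
  · obtain ⟨w, hw⟩ := hI.spare
    refine ⟨w, fun v => ?_⟩
    rw [Board.move_of_ne, hw] <;> (rw [ne_eq, Prod.ext_iff]; dsimp only; omega)

/-- The displaced rook moves on. -/
theorem rook_move (hI : RookInv b src cur K) (hsrc : startBoard src = whiteRook)
    (h1 : Static cur) {cur' : Square} (h2 : Static cur')
    (h3 : startBoard cur = none ∨ cur = src) : RookInv (b.move (cur, cur')) src cur' (K + 1) := by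
  have hs : b cur = whiteRook := by rw [hI.apply_cur h1, hsrc]
  refine ⟨fun q hq => ?_, fun x y k h hc => ?_, fun x y k h hx h8 => ?_, ?_⟩
  · have hq' := hI.static q hq
    rw [Board.move_apply] at hq' ⊢
    rw [Board.move_apply]
    dsimp only at hq' ⊢
    by_cases h4 : q = cur'
    · rw [if_pos h4, if_pos h4, hs, hsrc]
    · rw [if_neg h4, if_neg h4]
      by_cases h5 : q = cur
      · rw [if_pos h5]
        split_ifs with h6
        · rfl
        · rcases h3 with h3 | h3
          · rw [h5, h3]
          · exact absurd (h5.trans h3) h6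
      · rw [if_neg h5] at hq' ⊢
        exact hq'
  · rw [Board.move_apply] at h
    split_ifs at h with h6 h7
    · rw [hs] at h; simp at h
    · have := hI.black x y k h hc
      push_cast
      omega
  · rw [Board.move_apply] at h
    split_ifs at h with h6 h7
    · dsimp only at h6
      rw [← h6] at h2
      simp only [Static] at h2
      omega
    · exact hI.white x y k h hx h8
  · obtain ⟨w, hw⟩ := hI.spare
    refine ⟨w, fun v => ?_⟩
    simp only [Static] at h1 h2
    rw [Board.move_of_ne, hw] <;> (rw [ne_eq, Prod.ext_iff]; dsimp only; omega)

end RookInv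

theorem BlackStep.target {b : Board} {m : Move} (hm : BlackStep b m) :
    (m.1.1 = -30 ∧ m.2.1 = -30) ∨ (0 ≤ m.1.1 ∧ 0 ≤ m.2.1 ∧ m.2.1 % 8 = 4 ∧ m.2.2 ≤ 0) := by
  rcases hm with ⟨z, rfl, h3, -⟩ | ⟨x1, y1, h3, h4, h5, rfl, h6, -⟩ |
    ⟨x1, x', k, h3, h4, h5, rfl, -⟩ <;> dsimp only <;> omega

theorem BlackStep.ne_blackPawn {b : Board} {m : Move} (hm : BlackStep b m) {x y : ℤ}
    (hx : 0 ≤ x) (hy : 0 < y) (h : b (x, y) ≠ blackPawn) : b.move m (x, y) ≠ blackPawn := by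
  have ht := hm.target
  rw [Board.move_apply]
  split_ifs with h1 h2
  · rw [← h1] at ht
    dsimp only at ht
    omega
  · simp
  · exact h

/-! ### White's computable plan -/

/-- The capture, by the right guard of the gadget `n`, of the pawn that attacks both guards. -/
def rightReply (n : ℕ) : Move := ((8 * n + 5, 1), (8 * n + 4, 0))

/-- The square to which white has moved last (when the play `h` is not empty). -/
def lastWhite (h : List Move) : Square := (h.getI ((h.length - 1) / 2 * 2)).2

/-- The number `m` codes a gadget `n`, the question about which has been settled, and the number `s`
of steps after which the `n`-th program outputs `0` or `1`. So there is a rook in a room of this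
gadget, and the exit of this room is open: the right one if black has captured with the right guard,
and the left one otherwise, since then the left guard has captured or has been captured. The answer
of black is the move of index `4 * n + 1`. -/
def Opportunity (h : List Move) (m : ℕ) : Prop :=
  4 * m.unpair.1 + 4 ≤ h.length ∧
    ((HaltsAt 0 m.unpair.1 m.unpair.2 ∧ h.getI (4 * m.unpair.1 + 1) ≠ rightReply m.unpair.1) ∨
      (HaltsAt 1 m.unpair.1 m.unpair.2 ∧ h.getI (4 * m.unpair.1 + 1) = rightReply m.unpair.1))

/-- The move of the rook given by an opportunity to the bottom of its room. -/
def attackMove (h : List Move) (m : ℕ) : Move :=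
  if h.getI (4 * m.unpair.1 + 1) = rightReply m.unpair.1 then
    (((8 * m.unpair.1 + 7 : ℕ), (m.unpair.2 + 1 : ℕ)), ((8 * m.unpair.1 + 7 : ℕ), 0))
  else (((8 * m.unpair.1 + 1 : ℕ), (m.unpair.2 + 1 : ℕ)), ((8 * m.unpair.1 + 1 : ℕ), 0))

/-- White asks the `n`-th question by attacking both guards of the `n`-th gadget. If black does not
take the pawn, it takes the left guard; otherwise white makes a waiting move. -/
def quietMove (h : List Move) : Move :=
  if h.length % 4 = 0 then
    (((8 * (h.length / 4) + 4 : ℕ), -1), ((8 * (h.length / 4) + 4 : ℕ), 0))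
  else if (h.getI (4 * (h.length / 4) + 1)).2 =
      (((8 * (h.length / 4) + 4 : ℕ) : ℤ), (0 : ℤ)) then
    (((8 * (h.length / 4) + 4 : ℕ), 5), ((8 * (h.length / 4) + 4 : ℕ), 6))
  else (((8 * (h.length / 4) + 4 : ℕ), 0), ((8 * (h.length / 4) + 3 : ℕ), 1))

open Classical in
/-- White takes the first opportunity that can be found by a search bounded by the number of moves
made so far. If there is none, white asks the next question. -/
noncomputable def planMove (h : List Move) : Move :=
  ((((List.range h.length).filter fun m => Opportunity h m).head?).map (attackMove h)).getD
    (quietMove h)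

/-- White's plan: once a rook has been moved to the bottom of its room, it goes to the exit, from
there far down, and from there to the file of the black king. -/
noncomputable def whitePlan (h : List Move) : Move :=
  if (lastWhite h).2 < 0 then (lastWhite h, (-10, (lastWhite h).2))
  else if (lastWhite h).2 = 0 ∧ ((lastWhite h).1.toNat % 8 = 2 ∨ (lastWhite h).1.toNat % 8 = 6) then
    (lastWhite h, ((lastWhite h).1, -(h.length + 5 : ℕ)))
  else if (lastWhite h).2 = 0 ∧ (lastWhite h).1.toNat % 8 = 1 then
    (lastWhite h, ((lastWhite h).1 + 1, 0))
  else if (lastWhite h).2 = 0 ∧ (lastWhite h).1.toNat % 8 = 7 then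
    (lastWhite h, ((lastWhite h).1 - 1, 0))
  else planMove h

theorem getI_concat_of_lt {h : List Move} {m : Move} {i : ℕ} (hi : i < h.length) :
    (h ++ [m]).getI i = h.getI i := List.getI_append _ _ _ hi

theorem getI_concat_length {h : List Move} {m : Move} {i : ℕ} (hi : i = h.length) :
    (h ++ [m]).getI i = m := by
  rw [List.getI_append_right _ _ _ hi.ge, hi, Nat.sub_self]; rfl

theorem lastWhite_concat_of_even {h : List Move} {m : Move} (hh : h.length % 2 = 0) :
    lastWhite (h ++ [m]) = m.2 := by
  rw [lastWhite, getI_concat_length]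
  simp only [List.length_append, List.length_singleton]
  omega

theorem lastWhite_concat_of_odd {h : List Move} {m : Move} (hh : h.length % 2 = 1) :
    lastWhite (h ++ [m]) = lastWhite h := by
  rw [lastWhite, lastWhite, List.length_append, List.length_singleton,
    show (h.length + 1 - 1) / 2 * 2 = (h.length - 1) / 2 * 2 by omega, getI_concat_of_lt]
  omega

theorem Board.move_ne_blackPawn {b : Board} {m : Move} {q : Square} (h1 : b m.1 ≠ blackPawn)
    (h2 : b q ≠ blackPawn) : b.move m q ≠ blackPawn := by
  rw [Board.move_apply]
  split_ifs
  · exact h1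
  · simp
  · exact h2

/-- What holds until white finds an opportunity. The questions `0, 1, 2, …` take four moves each;
the fields describe the gadgets that are still `fresh`, the gadget in question after the first and
second of these moves, and the guards that have disappeared. In `inv`, the equal squares `(-15,
0)` stand for the absence of a displaced rook. The field `last` ensures that no attack seems to be
going on. -/
structure PlanInv (h : List Move) : Prop where
  inv : RookInv (start.after h).board (-15, 0) (-15, 0) h.length
  fresh : ∀ n : ℕ, h.length ≤ 4 * n → (start.after h).board (8 * n + 4, -1) = whitePawn ∧
    (start.after h).board (8 * n + 4, 0) = none ∧
    (start.after h).board (8 * n + 4, 5) = whitePawn ∧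
    (start.after h).board (8 * n + 4, 6) = none ∧
    (start.after h).board (8 * n + 3, 1) = blackPawn
  called : ∀ n : ℕ, h.length = 4 * n + 1 → (start.after h).board (8 * n + 4, 0) = whitePawn ∧
    (start.after h).board (8 * n + 4, 5) = whitePawn ∧
    (start.after h).board (8 * n + 4, 6) = none ∧
    (start.after h).board (8 * n + 3, 1) = blackPawn
  answered : ∀ n : ℕ, h.length = 4 * n + 2 → (start.after h).board (8 * n + 4, 5) = whitePawn ∧
    (start.after h).board (8 * n + 4, 6) = none ∧
    ((h.getI (4 * n + 1)).2 ≠ ((8 * n + 4 : ℤ), (0 : ℤ)) →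
      (start.after h).board (8 * n + 4, 0) = whitePawn ∧
      (start.after h).board (8 * n + 3, 1) = blackPawn) ∧
    ((h.getI (4 * n + 1)).2 = ((8 * n + 4 : ℤ), (0 : ℤ)) → h.getI (4 * n + 1) ≠ rightReply n →
      (start.after h).board (8 * n + 3, 1) ≠ blackPawn)
  right : ∀ n : ℕ, 4 * n + 2 ≤ h.length → h.getI (4 * n + 1) = rightReply n →
    (start.after h).board (8 * n + 5, 1) ≠ blackPawn
  left : ∀ n : ℕ, 4 * n + 3 ≤ h.length → h.getI (4 * n + 1) ≠ rightReply n →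
    (start.after h).board (8 * n + 3, 1) ≠ blackPawn
  last : 0 < (lastWhite h).2 ∨ ((lastWhite h).2 = 0 ∧
    ((lastWhite h).1.toNat % 8 = 0 ∨ (lastWhite h).1.toNat % 8 = 4))

/-- What holds after white has found an opportunity, in the gadget `n`: a rook has been carried
from `src` to `cur`, and its exit is not guarded. In the stages `i = 1, 2, 3, 4` the rook stands at
the bottom of its room, at the exit, far below the exit, and below the king. The side `e` is `1` for
the left room and `-1` for the right one. The bounds on `cur.2` keep the rook below all black pawns
by a margin that survives the moves of black. -/
structure Attack (i : ℕ) (h : List Move) (n : ℕ) (e : ℤ) (src cur : Square) : Prop where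
  side : e = 1 ∨ e = -1
  rook : startBoard src = whiteRook
  file : src.1 = 8 * n + 4 - 3 * e
  inv : RookInv (start.after h).board src cur h.length
  guard : (start.after h).board (8 * n + 4 - e, 1) ≠ blackPawn
  last : lastWhite h = cur
  place : (i = 1 ∧ cur = (8 * n + 4 - 3 * e, 0)) ∨ (i = 2 ∧ cur = (8 * n + 4 - 2 * e, 0)) ∨
    (i = 3 ∧ cur.1 = 8 * n + 4 - 2 * e ∧ cur.2 + h.length ≤ -3 - (h.length % 2 : ℕ)) ∨
    (i = 4 ∧ cur.1 = -10 ∧ cur.2 + h.length ≤ -2 ∧ h.length % 2 = 1)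

theorem planInv_nil : PlanInv [] where
  inv := by
    simp only [after, start]
    refine ⟨fun q _ => by rw [Board.move_self], fun x y k h hc => ?_, fun x y k h hx h8 => ?_,
      ⟨0, fun v => startBoard_spare v⟩⟩
    · rcases lt_or_ge x 0 with hx | hx
      · by_cases h30 : x = -30
        · subst h30
          rw [startBoard_spare] at h
          split_ifs at h with hy
          exact ⟨by simp [hy], .inl rfl⟩
        · rw [startBoard_neg_outside hx h30 hc] at h
          cases h
      · obtain ⟨n, r, hr, rfl⟩ := exists_gadget_coord hx
        rw [startBoard_gadget n r hr] at h
        have h4 : (r = 3 ∨ r = 5) ∧ y = 1 := by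
          unfold gadget at h
          split_ifs at h <;> simp_all
        simp only [List.length_nil, Nat.cast_zero]
        omega
    · by_cases hy : y < 0
      · have := guardInv_startBoard.low x y k h hy
        omega
      · omega
  fresh n _ := by
    simp only [after, start]
    rw [startBoard_eq_gadget n 4 (by simp) (by norm_num),
      startBoard_eq_gadget n 4 (by simp) (by norm_num),
      startBoard_eq_gadget n 4 (by simp) (by norm_num),
      startBoard_eq_gadget n 4 (by simp) (by norm_num),
      startBoard_eq_gadget n 3 (by simp) (by norm_num)]
    simp [gadget]
  called n hn := by simp at hn
  answered n hn := by simp at hn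
  right n hn := by simp at hn
  left n hn := by simp at hn
  last := .inr ⟨rfl, .inl rfl⟩

/-- The cases of `BlackStep` by the target: an empty square, or a pawn called to the middle file. -/
theorem BlackStep.summary {b : Board} {m : Move} (hm : BlackStep b m) : b m.1 = blackPawn ∧
    ((b m.2 = none ∧ (m.2.2 < 0 ∨ m.2.1 = -30) ∧ (m.1.2 ≤ 0 ∨ m.1.1 = -30)) ∨
      (∃ k, b m.2 = some (.white, k) ∧ m.2.2 = 0 ∧ 0 ≤ m.2.1 ∧ m.2.1 % 8 = 4 ∧ m.1.2 = 1 ∧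
        (m.1.1 = m.2.1 - 1 ∨ m.1.1 = m.2.1 + 1))) := by
  rcases hm with ⟨z, rfl, h3, h4⟩ | ⟨x1, y1, h3, h4, h5, rfl, h6, h7⟩ |
    ⟨x1, x', k, h3, h4, h5, rfl, h6, h7⟩
  · exact ⟨h3, .inl ⟨h4, .inr rfl, .inr rfl⟩⟩
  · exact ⟨h6, .inl ⟨h7, .inl (by dsimp only; omega), .inl h5⟩⟩
  · exact ⟨h6, .inr ⟨k, h7, rfl, h3, h4, rfl, h5⟩⟩

namespace PlanInv

variable {h : List Move}

theorem blackStep (hP : PlanInv h) (hp : start.IsPlay h) (hh : h.length % 2 = 1) {m : Move}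
    (hm : (start.after h).Legal m) : BlackStep (start.after h).board m := by
  rw [start_after_eq_black hh] at hm
  refine hP.inv.blackStep (cageInv_after hp).1 (by norm_num) (.inr rfl) (fun x hx hb => ?_) hm
  have := (hP.inv.black _ _ _ hb (by simp only [InCage]; omega)).2
  dsimp only at hx
  omega

theorem black_move (hP : PlanInv h) (hp : start.IsPlay h) (hh : h.length % 2 = 1) {m : Move}
    (hm : (start.after h).Legal m) : PlanInv (h ++ [m]) := by
  have hstep := hP.blackStep hp hh hm
  obtain ⟨hs, ht⟩ := hstep.summary
  have hlen : (h ++ [m]).length = h.length + 1 := by simp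
  have hb := start_after_concat_board h m
  -- the squares that keep their content
  have keepW : ∀ x y, (start.after h).board (x, y) = whitePawn → m.2 ≠ (x, y) →
      (start.after (h ++ [m])).board (x, y) = whitePawn := by
    intro x y h1 h2
    rw [hb, Board.move_of_ne, h1]
    · rintro h3; rw [h3, hs] at h1; simp at h1
    · exact h2.symm
  have keepN : ∀ x y, (start.after h).board (x, y) = none → m.2 ≠ (x, y) →
      (start.after (h ++ [m])).board (x, y) = none := by
    intro x y h1 h2
    rw [hb, Board.move_of_ne, h1]
    · rintro h3; rw [h3, hs] at h1; simp at h1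
    · exact h2.symm
  have keepB : ∀ x y, (start.after h).board (x, y) = blackPawn → m.1 ≠ (x, y) → m.2 ≠ (x, y) →
      (start.after (h ++ [m])).board (x, y) = blackPawn := by
    intro x y h1 h2 h3
    rw [hb, Board.move_of_ne h2.symm h3.symm, h1]
  have high : ∀ x y : ℤ, 0 ≤ x → 0 < y → m.2 ≠ (x, y) := by
    rintro x y hx hy h1
    rw [h1] at ht
    dsimp only at ht
    rcases ht with ht | ⟨k, ht⟩ <;> omega
  refine ⟨?_, fun n hn => ?_, fun n hn => ?_, fun n hn => ?_, fun n hn hr => ?_,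
    fun n hn hr => ?_, ?_⟩
  · rw [hb, hlen]
    exact hP.inv.black_move hstep
  · obtain ⟨h1, h2, h3, h4, h5⟩ := hP.fresh n (by omega)
    have hc : m.2 ≠ ((8 * n + 4 : ℤ), (0 : ℤ)) := by
      intro h6
      rw [h6, h2] at ht
      rcases ht with ⟨-, ht, -⟩ | ⟨k, ht, -⟩
      · dsimp only at ht; omega
      · simp at ht
    refine ⟨keepW _ _ h1 ?_, keepN _ _ h2 hc, keepW _ _ h3 (high _ _ (by omega) (by omega)),
      keepN _ _ h4 (high _ _ (by omega) (by omega)),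
      keepB _ _ h5 ?_ (high _ _ (by omega) (by omega))⟩
    · intro h6
      rw [h6, h1] at ht
      rcases ht with ⟨ht, -, -⟩ | ⟨k, -, ht, -⟩ <;> simp at ht
    · intro h6
      rw [h6] at ht
      rcases ht with ⟨-, -, ht⟩ | ⟨k, -, ht⟩
      · dsimp only at ht; omega
      · exact hc (Prod.ext (by dsimp only at ht ⊢; omega) ht.1)
  · omega
  · obtain ⟨h1, h2, h3, h4⟩ := hP.called n (by omega)
    rw [getI_concat_length (by omega)]
    refine ⟨keepW _ _ h2 (high _ _ (by omega) (by omega)),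
      keepN _ _ h3 (high _ _ (by omega) (by omega)), fun hc => ⟨keepW _ _ h1 hc, keepB _ _ h4 ?_
        (high _ _ (by omega) (by omega))⟩, fun hc hr => ?_⟩
    · intro h6
      rw [h6] at ht
      rcases ht with ⟨-, -, ht⟩ | ⟨k, -, ht⟩
      · dsimp only at ht; omega
      · exact hc (Prod.ext (by dsimp only at ht ⊢; omega) ht.1)
    · have h5 : m.1 = ((8 * n + 3 : ℤ), (1 : ℤ)) := by
        rw [hc] at ht
        rcases ht with ⟨-, ht, -⟩ | ⟨k, -, ht⟩
        · dsimp only at ht; omega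
        · obtain ⟨-, -, -, h6, h7 | h7⟩ := ht
          · exact Prod.ext (by rw [h7]; dsimp only; omega) h6
          · refine absurd (Prod.ext (Prod.ext ?_ h6) hc) hr
            rw [h7]; simp only [rightReply]; omega
      rw [hb, Board.move_apply, if_neg (high _ _ (by omega) (by omega)).symm, if_pos h5.symm]
      simp
  · by_cases hn' : 4 * n + 2 ≤ h.length
    · rw [getI_concat_of_lt (by omega)] at hr
      rw [hb]
      exact hstep.ne_blackPawn (by omega) (by omega) (hP.right n hn' hr)
    · rw [getI_concat_length (by omega)] at hr
      rw [hb, hr, Board.move_apply, if_neg (by simp [rightReply]),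
        if_pos (show ((8 * n + 5 : ℤ), (1 : ℤ)) = (rightReply n).1 from rfl)]
      simp
  · rw [getI_concat_of_lt (by omega)] at hr
    rw [hb]
    exact hstep.ne_blackPawn (by omega) (by omega) (hP.left n (by omega) hr)
  · rw [lastWhite_concat_of_odd hh]
    exact hP.last

theorem whitePlan_eq (hP : PlanInv h) : whitePlan h = planMove h := by
  have := hP.last
  unfold whitePlan
  rw [if_neg (by omega), if_neg (by omega), if_neg (by omega), if_neg (by omega)]

theorem quiet_move (hP : PlanInv h) (hp : start.IsPlay h) (hh : h.length % 2 = 0) :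
    (start.after h).Legal (quietMove h) ∧ PlanInv (h ++ [quietMove h]) := by
  obtain ⟨n, hn⟩ : ∃ n, n = h.length / 4 := ⟨_, rfl⟩
  rcases (show h.length = 4 * n ∨ h.length = 4 * n + 2 by omega) with hL | hL
  · -- the pawn advances to attack both guards
    have hm : quietMove h = (((8 * n + 4 : ℤ), (-1 : ℤ)), ((8 * n + 4 : ℤ), (0 : ℤ))) := by
      rw [quietMove, if_pos (by omega), ← hn]
      push_cast
      rfl
    have hb := start_after_concat_board h (quietMove h)
    have hlen : (h ++ [quietMove h]).length = h.length + 1 := by simp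
    obtain ⟨h1, h2, h3, h4, h5⟩ := hP.fresh n (by omega)
    rw [hm] at *
    have hne : ∀ x y : ℤ, ¬ (x = 8 * n + 4 ∧ y = -1) → ¬ (x = 8 * n + 4 ∧ y = 0) →
        (start.after (h ++
            [(((8 * n + 4 : ℤ), (-1 : ℤ)), ((8 * n + 4 : ℤ), (0 : ℤ)))])).board (x, y) =
          (start.after h).board (x, y) := by
      intro x y h6 h7
      rw [hb]
      apply Board.move_of_ne <;> (simp only [ne_eq, Prod.mk.injEq]; assumption)
    refine ⟨(legal_white_turn hp hh).2 (.inl ⟨h1, canMove_pawn_iff.2 ⟨by simp [Color.forward],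
      .inr ⟨rfl, h2⟩⟩⟩), ?_, fun k hk => ?_, fun k hk => ?_, fun k hk => ?_, fun k hk hr => ?_,
      fun k hk hr => ?_, ?_⟩
    · rw [hb, hlen]
      refine hP.inv.white_move h1 ?_ ?_ ?_ ?_ ?_ <;> (try unfold Static) <;> dsimp only <;> omega
    · rw [hne _ _ (by omega) (by omega), hne _ _ (by omega) (by omega),
        hne _ _ (by omega) (by omega), hne _ _ (by omega) (by omega),
        hne _ _ (by omega) (by omega)]
      exact hP.fresh k (by omega)
    · obtain rfl : k = n := by omega
      exact ⟨by rw [hb, Board.move_apply, if_pos rfl, h1],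
        by rw [hne _ _ (by omega) (by omega), h3], by rw [hne _ _ (by omega) (by omega), h4],
        by rw [hne _ _ (by omega) (by omega), h5]⟩
    · omega
    · rw [getI_concat_of_lt (by omega)] at hr
      rw [hne _ _ (by omega) (by omega)]
      exact hP.right k (by omega) hr
    · rw [getI_concat_of_lt (by omega)] at hr
      rw [hne _ _ (by omega) (by omega)]
      exact hP.left k (by omega) hr
    · rw [lastWhite_concat_of_even hh]
      right
      dsimp only
      omega
  · obtain ⟨h1, h2, h3, h4⟩ := hP.answered n hL
    by_cases hc : (h.getI (4 * n + 1)).2 = ((8 * n + 4 : ℤ), (0 : ℤ))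
    · -- a waiting move
      have hm : quietMove h = (((8 * n + 4 : ℤ), (5 : ℤ)), ((8 * n + 4 : ℤ), (6 : ℤ))) := by
        rw [quietMove, if_neg (by omega), ← hn, if_pos (by push_cast; exact hc)]
        push_cast
        rfl
      have hb := start_after_concat_board h (quietMove h)
      have hlen : (h ++ [quietMove h]).length = h.length + 1 := by simp
      rw [hm] at *
      have hne : ∀ x y : ℤ, ¬ (x = 8 * n + 4 ∧ y = 5) → ¬ (x = 8 * n + 4 ∧ y = 6) →
          (start.after (h ++
            [(((8 * n + 4 : ℤ), (5 : ℤ)), ((8 * n + 4 : ℤ), (6 : ℤ)))])).board (x, y) =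
            (start.after h).board (x, y) := by
        intro x y h6 h7
        rw [hb]
        apply Board.move_of_ne <;> (simp only [ne_eq, Prod.mk.injEq]; assumption)
      refine ⟨(legal_white_turn hp hh).2 (.inl ⟨h1, canMove_pawn_iff.2 ⟨by simp [Color.forward],
        .inr ⟨rfl, h2⟩⟩⟩), ?_, fun k hk => ?_, fun k hk => ?_, fun k hk => ?_, fun k hk hr => ?_,
        fun k hk hr => ?_, ?_⟩
      · rw [hb, hlen]
        refine hP.inv.white_move h1 ?_ ?_ ?_ ?_ ?_ <;> (try unfold Static) <;> dsimp only <;> omega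
      · rw [hne _ _ (by omega) (by omega), hne _ _ (by omega) (by omega),
          hne _ _ (by omega) (by omega), hne _ _ (by omega) (by omega),
          hne _ _ (by omega) (by omega)]
        exact hP.fresh k (by omega)
      · omega
      · omega
      · rw [getI_concat_of_lt (by omega)] at hr
        rw [hne _ _ (by omega) (by omega)]
        exact hP.right k (by omega) hr
      · rw [getI_concat_of_lt (by omega)] at hr
        rw [hne _ _ (by omega) (by omega)]
        by_cases hk' : k = n
        · subst hk'
          exact h4 hc hr
        · exact hP.left k (by omega) hr
      · rw [lastWhite_concat_of_even hh]
        left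
        norm_num
    · -- the pawn takes the left guard
      obtain ⟨h5, h6⟩ := h3 hc
      have hm : quietMove h = (((8 * n + 4 : ℤ), (0 : ℤ)), ((8 * n + 3 : ℤ), (1 : ℤ))) := by
        rw [quietMove, if_neg (by omega), ← hn, if_neg (by push_cast; exact hc)]
        push_cast
        rfl
      have hb := start_after_concat_board h (quietMove h)
      have hlen : (h ++ [quietMove h]).length = h.length + 1 := by simp
      rw [hm] at *
      have hne : ∀ x y : ℤ, ¬ (x = 8 * n + 4 ∧ y = 0) → ¬ (x = 8 * n + 3 ∧ y = 1) →
          (start.after (h ++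
            [(((8 * n + 4 : ℤ), (0 : ℤ)), ((8 * n + 3 : ℤ), (1 : ℤ)))])).board (x, y) =
            (start.after h).board (x, y) := by
        intro x y h6 h7
        rw [hb]
        apply Board.move_of_ne <;> (simp only [ne_eq, Prod.mk.injEq]; assumption)
      refine ⟨(legal_white_turn hp hh).2 (.inl ⟨h5, canMove_pawn_iff.2 ⟨by simp [Color.forward],
        .inl ⟨.inr ?_, _, h6⟩⟩⟩), ?_, fun k hk => ?_, fun k hk => ?_, fun k hk => ?_,
        fun k hk hr => ?_, fun k hk hr => ?_, ?_⟩
      · dsimp only; omega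
      · rw [hb, hlen]
        refine hP.inv.white_move h5 ?_ ?_ ?_ ?_ ?_ <;> (try unfold Static) <;> dsimp only <;> omega
      · rw [hne _ _ (by omega) (by omega), hne _ _ (by omega) (by omega),
          hne _ _ (by omega) (by omega), hne _ _ (by omega) (by omega),
          hne _ _ (by omega) (by omega)]
        exact hP.fresh k (by omega)
      · omega
      · omega
      · rw [getI_concat_of_lt (by omega)] at hr
        rw [hne _ _ (by omega) (by omega)]
        exact hP.right k (by omega) hr
      · rw [getI_concat_of_lt (by omega)] at hr
        by_cases hk' : k = n
        · subst hk'
          rw [hb, Board.move_apply, if_pos rfl, h5]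
          simp
        · rw [hne _ _ (by omega) (by omega)]
          exact hP.left k (by omega) hr
      · rw [lastWhite_concat_of_even hh]
        left
        norm_num

theorem attack_move (hP : PlanInv h) (hp : start.IsPlay h) (hh : h.length % 2 = 0) {m : ℕ}
    (hm : Opportunity h m) : (start.after h).Legal (attackMove h m) ∧
      ∃ n e src cur, Attack 1 (h ++ [attackMove h m]) n e src cur := by
  obtain ⟨n, s, hns⟩ : ∃ n s, n = m.unpair.1 ∧ s = m.unpair.2 := ⟨_, _, rfl, rfl⟩
  -- the rook and its unguarded exit
  have key : ∃ e : ℤ, (e = 1 ∨ e = -1) ∧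
      attackMove h m =
        ((8 * (n : ℤ) + 4 - 3 * e, (s : ℤ) + 1), (8 * (n : ℤ) + 4 - 3 * e, (0 : ℤ))) ∧
      startBoard (8 * n + 4 - 3 * e, s + 1) = whiteRook ∧
      (start.after h).board (8 * n + 4 - e, 1) ≠ blackPawn := by
    obtain ⟨hL, hm | hm⟩ := hm <;> rw [← hns.1, ← hns.2] at hm <;> rw [← hns.1] at hL
    · refine ⟨1, .inl rfl, ?_, ?_, ?_⟩
      · rw [attackMove, ← hns.1, ← hns.2, if_neg hm.2]
        push_cast
        simp only [Prod.mk.injEq, and_true]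
        omega
      · exact startBoard_eq_whiteRook_iff.2 ⟨by omega, n, .inl ⟨by ring, by simpa using hm.1⟩⟩
      · have := hP.left n (by omega) hm.2
        rwa [show 8 * (n : ℤ) + 4 - 1 = 8 * n + 3 by ring]
    · refine ⟨-1, .inr rfl, ?_, ?_, ?_⟩
      · rw [attackMove, ← hns.1, ← hns.2, if_pos hm.2]
        push_cast
        simp only [Prod.mk.injEq, and_true]
        omega
      · exact startBoard_eq_whiteRook_iff.2 ⟨by omega, n, .inr ⟨by ring, by simpa using hm.1⟩⟩
      · have := hP.right n (by omega) hm.2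
        rwa [show 8 * (n : ℤ) + 4 - -1 = 8 * n + 5 by ring]
  obtain ⟨e, he, hmv, hrook, hguard⟩ := key
  have hI : RookInv (start.after h).board (8 * n + 4 - 3 * e, s + 1)
      (8 * n + 4 - 3 * e, s + 1) h.length := by
    refine ⟨fun q hq => ?_, hP.inv.black, hP.inv.white, hP.inv.spare⟩
    rw [hP.inv.static q hq, Board.move_self, Board.move_self]
  have hst : ∀ y, Static (8 * n + 4 - 3 * e, y) := by
    intro y; unfold Static; dsimp only; omega
  have hbr : (start.after h).board (8 * n + 4 - 3 * e, s + 1) = whiteRook := by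
    rw [hI.apply_cur (hst _), hrook]
  have hempty : ∀ y : ℤ, 0 ≤ y → y < s + 1 →
      (start.after h).board (8 * n + 4 - 3 * e, y) = none := by
    intro y h1 h2
    rw [hI.apply_of_ne (hst y) (by simp only [ne_eq, Prod.mk.injEq]; omega)
      (by simp only [ne_eq, Prod.mk.injEq]; omega)]
    exact startBoard_room he hrook h1 (by omega)
  rw [hmv]
  refine ⟨(legal_white_turn hp hh).2 (.inr ⟨hbr, canMove_rook_iff.2 ⟨slides_rookDirs_iff.2
    (.inr (.inr (.inr ⟨rfl, by omega, fun u h1 h2 => hempty u h1.le h2⟩))),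
      .inl (hempty 0 le_rfl (by omega))⟩⟩), n, e, (8 * n + 4 - 3 * e, s + 1),
      (8 * n + 4 - 3 * e, 0), he, hrook, rfl, ?_, ?_, ?_, .inl ⟨rfl, rfl⟩⟩
  · rw [start_after_concat_board, List.length_append, List.length_singleton]
    exact hI.rook_move hrook (hst _) (hst _) (.inr rfl)
  · rw [start_after_concat_board]
    exact Board.move_ne_blackPawn (by rw [hbr]; simp) hguard
  · rw [lastWhite_concat_of_even hh]

theorem white_move (hP : PlanInv h) (hp : start.IsPlay h) (hh : h.length % 2 = 0) :
    (start.after h).Legal (whitePlan h) ∧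
      ((∃ n e src cur, Attack 1 (h ++ [whitePlan h]) n e src cur) ∨
        ((∀ m < h.length, ¬ Opportunity h m) ∧ PlanInv (h ++ [whitePlan h]))) := by
  classical
  rw [hP.whitePlan_eq]
  have e : planMove h = ((((List.range h.length).filter fun m => Opportunity h m).head?).map
      (attackMove h)).getD (quietMove h) := by simp only [planMove]
  cases hf : (List.range h.length).filter fun m => Opportunity h m with
  | nil =>
    rw [hf] at e
    simp only [List.head?_nil, Option.map_none, Option.getD_none] at e
    rw [e]
    have := hP.quiet_move hp hh
    simp only [List.filter_eq_nil_iff, List.mem_range, decide_eq_true_eq] at hf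
    exact ⟨this.1, .inr ⟨hf, this.2⟩⟩
  | cons m l =>
    have hm : m ∈ (List.range h.length).filter fun m => Opportunity h m := by simp [hf]
    rw [hf] at e
    simp only [List.head?_cons, Option.map_some, Option.getD_some] at e
    simp only [List.mem_filter, List.mem_range, decide_eq_true_eq] at hm
    rw [e]
    have := hP.attack_move hp hh hm.2
    exact ⟨this.1, .inl this.2⟩

end PlanInv

/-! ### From an opportunity to checkmate -/

namespace RookInv

variable {b : Board} {src cur : Square} {K : ℕ}

theorem not_shaftCheck (hI : RookInv b src cur K) (hc : cur.1 ≠ -10) : ¬ ShaftCheck b := by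
  rintro ⟨y, hy, h, -⟩
  rw [hI.static _ (.inl (by norm_num)), Board.move_apply] at h
  split_ifs at h with h1
  · exact hc (congrArg Prod.fst h1).symm
  · rw [startBoard_file_king] at h
    split_ifs at h <;> simp at h

theorem shaftCheck {y : ℤ} (hI : RookInv b src (-10, y) K) (hsrc : startBoard src = whiteRook)
    (hy : y < 10) : ShaftCheck b := by
  refine ⟨y, hy, by rw [hI.apply_cur (.inl (by norm_num)), hsrc], fun u h1 h2 => ?_⟩
  rw [hI.apply_of_ne (.inl (by norm_num)), startBoard_file_king, if_neg (by omega),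
    if_neg (by omega)]
  · rintro rfl
    obtain ⟨-, n, h | h⟩ := startBoard_eq_whiteRook_iff.1 hsrc <;> omega
  · simp only [ne_eq, Prod.mk.injEq]; omega

/-- Black can always advance the spare pawn, unless he is in check. -/
theorem exists_legal (hb : CageInv b) (hI : RookInv b src cur K) (hc : cur.1 ≠ -10) :
    ∃ m, Position.Legal ⟨b, .black⟩ m := by
  obtain ⟨z, hz⟩ := hI.spare
  have h1 : b (-30, z) = blackPawn := by rw [hz, if_pos rfl]
  have h2 : b (-30, z - 1) = none := by rw [hz, if_neg (by omega)]
  have hstep : BlackStep b ((-30, z), (-30, z - 1)) := .inl ⟨z, rfl, h1, h2⟩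
  refine ⟨((-30, z), (-30, z - 1)), hb.legal_black_iff.2 ⟨h1, by simp [InCage], ?_,
    (hI.black_move hstep).not_shaftCheck hc⟩⟩
  exact canMove_pawn_iff.2 ⟨by simp [Color.forward]; ring, .inr ⟨rfl, h2⟩⟩

end RookInv

theorem PlanInv.exists_legal {h : List Move} (hP : PlanInv h) (hp : start.IsPlay h)
    (hh : h.length % 2 = 1) : ∃ m, (start.after h).Legal m := by
  rw [start_after_eq_black hh]
  exact hP.inv.exists_legal (cageInv_after hp).1 (by norm_num)

namespace Attack

variable {i n : ℕ} {h : List Move} {e : ℤ} {src cur : Square}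

theorem src_mod (hA : Attack i h n e src cur) : src.1 % 8 = 1 ∨ src.1 % 8 = 7 := by
  have := hA.file
  rcases hA.side with rfl | rfl <;> omega

theorem src_snd_pos (hA : Attack i h n e src cur) : 1 ≤ src.2 :=
  (startBoard_eq_whiteRook_iff (x := src.1) (y := src.2)).1 hA.rook |>.1

/-- The rook is never attacked: at the exit because the guard is missing, afterwards because it
is far below all black pawns. -/
theorem not_attacked (hA : Attack i h n e src cur) (x : ℤ) (hx : x = cur.1 + 1 ∨ x = cur.1 - 1) :
    (start.after h).board (x, cur.2 + 1) ≠ blackPawn := by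
  intro hb
  have hg := hA.guard
  have hbl := hA.inv.black _ _ _ hb
  simp only [InCage] at hbl
  rcases hA.place with ⟨-, rfl⟩ | ⟨-, rfl⟩ | ⟨-, h1, h2⟩ | ⟨-, h1, h2, -⟩
  · dsimp only at *
    rcases hA.side with rfl | rfl <;> omega
  · dsimp only at *
    by_cases hxg : x = 8 * n + 4 - e
    · rw [hxg] at hb
      exact hg hb
    · rcases hA.side with rfl | rfl <;> omega
  · have := hbl (by omega)
    omega
  · have := hbl (by omega)
    omega

theorem blackStep (hA : Attack i h n e src cur) (hp : start.IsPlay h) (hh : h.length % 2 = 1)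
    {m : Move} (hm : (start.after h).Legal m) : BlackStep (start.after h).board m := by
  rw [start_after_eq_black hh] at hm
  exact hA.inv.blackStep (cageInv_after hp).1 hA.src_mod (.inl hA.rook) hA.not_attacked hm

theorem cur_ne (hA : Attack i h n e src cur) (hi : i ≠ 4) : cur.1 ≠ -10 := by
  have := hA.place
  rw [Prod.ext_iff, Prod.ext_iff] at this
  rcases hA.side with rfl | rfl <;> dsimp only at this <;> omega

theorem exists_legal (hA : Attack i h n e src cur) (hp : start.IsPlay h)
    (hh : h.length % 2 = 1) (hi : i ≠ 4) : ∃ m, (start.after h).Legal m := by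
  rw [start_after_eq_black hh]
  exact hA.inv.exists_legal (cageInv_after hp).1 (hA.cur_ne hi)

theorem black_move (hA : Attack i h n e src cur) (hp : start.IsPlay h) (hh : h.length % 2 = 1)
    (hi : i ≠ 4) {m : Move} (hm : (start.after h).Legal m) :
    Attack i (h ++ [m]) n e src cur := by
  have hstep := hA.blackStep hp hh hm
  have hlen : (h ++ [m]).length = h.length + 1 := by simp
  refine ⟨hA.side, hA.rook, hA.file, ?_, ?_, ?_, ?_⟩
  · rw [start_after_concat_board, hlen]
    exact hA.inv.black_move hstep
  · rw [start_after_concat_board]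
    refine hstep.ne_blackPawn ?_ one_pos hA.guard
    rcases hA.side with rfl | rfl <;> omega
  · rw [lastWhite_concat_of_odd hh, hA.last]
  · rw [hlen]
    rcases hA.place with h1 | h1 | ⟨h1, h2, h3⟩ | h1
    · exact .inl h1
    · exact .inr (.inl h1)
    · exact .inr (.inr (.inl ⟨h1, h2, by omega⟩))
    · exact absurd h1.1 hi

theorem rook_at_cur (hA : Attack i h n e src cur) (hs : Static cur) :
    (start.after h).board cur = whiteRook := by
  rw [hA.inv.apply_cur hs, hA.rook]

/-- White carries on with a move of the rook. -/
theorem step (hA : Attack i h n e src cur) (hp : start.IsPlay h) (hh : h.length % 2 = 0)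
    {cur' : Square} (hw : whitePlan h = (cur, cur')) (h1 : Static cur) (h2 : Static cur')
    (h3 : startBoard cur = none)
    (h4 : Slides rookDirs (start.after h).board cur cur') (h5 : (start.after h).board cur' = none)
    (h6 : (i + 1 = 2 ∧ cur' = (8 * n + 4 - 2 * e, 0)) ∨
      (i + 1 = 3 ∧ cur'.1 = 8 * n + 4 - 2 * e ∧ cur'.2 + h.length ≤ -5) ∨
      (i + 1 = 4 ∧ cur'.1 = -10 ∧ cur'.2 + h.length ≤ -3)) :
    (start.after h).Legal (whitePlan h) ∧
      ∃ cur', Attack (i + 1) (h ++ [whitePlan h]) n e src cur' := by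
  have hr := hA.rook_at_cur h1
  have hlen : (h ++ [(cur, cur')]).length = h.length + 1 := by simp
  rw [hw]
  refine ⟨(legal_white_turn hp hh).2 (.inr ⟨hr, canMove_rook_iff.2 ⟨h4, .inl h5⟩⟩),
    cur', hA.side, hA.rook, hA.file, ?_, ?_, ?_, ?_⟩
  · rw [start_after_concat_board, hlen]
    exact hA.inv.rook_move hA.rook h1 h2 (.inl h3)
  · rw [start_after_concat_board]
    exact Board.move_ne_blackPawn (by rw [hr]; simp) hA.guard
  · rw [lastWhite_concat_of_even hh]
  · rw [hlen]
    rcases h6 with h6 | ⟨h6, h7, h8⟩ | ⟨h6, h7, h8⟩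
    · exact .inr (.inl h6)
    · exact .inr (.inr (.inl ⟨h6, h7, by omega⟩))
    · exact .inr (.inr (.inr ⟨h6, h7, by omega, by omega⟩))

theorem white_move (hA : Attack i h n e src cur) (hp : start.IsPlay h) (hh : h.length % 2 = 0) :
    (start.after h).Legal (whitePlan h) ∧
      ∃ cur', Attack (i + 1) (h ++ [whitePlan h]) n e src cur' := by
  have hlast := hA.last
  have hside := hA.side
  have hpos := hA.src_snd_pos
  have hfile := hA.file
  have hne {x y : ℤ} (h1 : y < 1) : (x, y) ≠ src := by
    rintro rfl
    exact absurd hpos (by dsimp only; omega)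
  rcases hA.place with ⟨hi, rfl⟩ | ⟨hi, rfl⟩ | ⟨hi, h1, h2⟩ | ⟨-, -, -, h1⟩
  · -- from the bottom of the room to the exit
    have hst : ∀ k : ℤ, (k = 2 ∨ k = 3) → Static (8 * n + 4 - k * e, 0) := by
      intro k hk
      unfold Static
      dsimp only
      rcases hside with rfl | rfl <;> rcases hk with rfl | rfl <;> omega
    have hex : (start.after h).board (8 * n + 4 - 2 * e, 0) = none := by
      rw [hA.inv.apply_of_ne (hst 2 (by simp)) (hne (by norm_num))
        (by simp only [ne_eq, Prod.mk.injEq]; omega)]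
      exact startBoard_low (by omega) (by omega)
    refine hA.step hp hh ?_ (hst 3 (by simp)) (hst 2 (by simp)) ?_ (slides_rookDirs_iff.2 ?_) hex
      (.inl ⟨by omega, rfl⟩)
    · rw [whitePlan, hlast]
      dsimp only
      rw [if_neg (by omega), if_neg (by rcases hside with rfl | rfl <;> omega)]
      rcases hside with rfl | rfl
      · rw [if_pos (by omega), show 8 * (n : ℤ) + 4 - 3 * 1 + 1 = 8 * n + 4 - 2 * 1 by ring]
      · rw [if_neg (by omega), if_pos (by omega),
          show 8 * (n : ℤ) + 4 - 3 * -1 - 1 = 8 * n + 4 - 2 * -1 by ring]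
    · exact startBoard_room (s := src.2) hside (by rw [← hfile]; exact hA.rook) le_rfl (by omega)
    · rcases hside with rfl | rfl
      · exact .inl ⟨rfl, by omega, fun u h1 h2 => by omega⟩
      · exact .inr (.inl ⟨rfl, by omega, fun u h1 h2 => by omega⟩)
  · -- from the exit down
    have hst : ∀ y : ℤ, Static (8 * n + 4 - 2 * e, y) := by
      intro y
      unfold Static
      dsimp only
      omega
    have hlow : ∀ y : ℤ, y ≤ 0 → startBoard (8 * n + 4 - 2 * e, y) = none := fun y hy =>
      startBoard_low (by omega) (by omega)
    have hb : ∀ y : ℤ, y < 0 → (start.after h).board (8 * n + 4 - 2 * e, y) = none := by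
      intro y hy
      rw [hA.inv.apply_of_ne (hst y) (hne (by omega)) (by simp only [ne_eq, Prod.mk.injEq]; omega),
        hlow y hy.le]
    refine hA.step (cur' := (8 * n + 4 - 2 * e, -(h.length + 5 : ℕ))) hp hh ?_ (hst _) (hst _)
      (hlow 0 le_rfl) (slides_rookDirs_iff.2 (.inr (.inr (.inr ⟨rfl, by omega,
        fun u h1 h2 => hb u h2⟩)))) (hb _ (by omega)) (.inr (.inl ⟨by omega, rfl, ?_⟩))
    · rw [whitePlan, hlast]
      dsimp only
      rw [if_neg (by omega), if_pos (by rcases hside with rfl | rfl <;> omega)]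
    · push_cast; omega
  · -- along a row below all other pieces to the file of the king
    obtain ⟨x, y⟩ := cur
    dsimp only at h1 h2
    have hb : ∀ u, -10 ≤ u → u < x → (start.after h).board (u, y) = none := by
      intro u hu1 hu2
      have hcage : ¬ InCage (u, y) := by simp only [InCage]; omega
      by_cases h4 : 0 ≤ u ∧ u % 8 = 4
      · rcases hbu : (start.after h).board (u, y) with _ | ⟨c, k⟩
        · rfl
        · cases c with
          | white =>
            have := hA.inv.white u y k hbu h4.1 h4.2
            omega
          | black =>
            have := hA.inv.black u y k hbu hcage
            omega
      · rw [hA.inv.apply_of_ne (by unfold Static; dsimp only; omega) (hne (by omega))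
          (by simp only [ne_eq, Prod.mk.injEq]; omega)]
        rcases lt_or_ge u 0 with hu | hu
        · exact startBoard_neg_outside hu (by omega) hcage
        · exact startBoard_low hu (by omega)
    have hx : 0 ≤ x := by rcases hside with rfl | rfl <;> omega
    refine hA.step (cur' := (-10, y)) hp hh ?_ (by unfold Static; dsimp only; omega)
      (by unfold Static; dsimp only; omega) (startBoard_low hx (by omega))
      (slides_rookDirs_iff.2 (.inr (.inl ⟨rfl, by omega, fun u hu1 hu2 => hb u hu1.le hu2⟩)))
      (hb _ le_rfl (by omega)) (.inr (.inr ⟨by omega, rfl, by dsimp only; omega⟩))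
    rw [whitePlan, hlast, if_pos (by dsimp only; omega)]
  · omega

/-- When the rook has reached the file of the king, black is checkmated. -/
theorem checkmated (hA : Attack 4 h n e src cur) (hp : start.IsPlay h) :
    (start.after h).Checkmated .black := by
  obtain ⟨x, y⟩ := cur
  obtain ⟨hx, hy, hh⟩ : x = -10 ∧ y + h.length ≤ -2 ∧ h.length % 2 = 1 := by
    rcases hA.place with h1 | h1 | h1 | h1
    · omega
    · omega
    · omega
    · exact h1.2
  subst hx
  refine ⟨turn_eq_black_iff.2 hh, (cageInv_after hp).1.inCheck_black_iff.2
    (hA.inv.shaftCheck hA.rook (by omega)), fun m hm => ?_⟩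
  have h1 := hA.inv.black_move (hA.blackStep hp hh hm)
  rw [← start_after_concat_board] at h1
  exact ((legal_black_turn hp hh).1 hm).2.2.2 (h1.shaftCheck hA.rook (by omega))

end Attack

/-- The plan is a strategy. -/
theorem isStrategy_whitePlan : start.IsStrategy .white whitePlan := by
  have key : ∀ h, start.IsPlay h → start.Follows .white whitePlan h →
      PlanInv h ∨ ∃ i n e src cur, Attack i h n e src cur := by
    refine play_induction _ (.inl planInv_nil) ?_ ?_
    · intro h hp hi ht hl
      rw [turn_eq_white_iff] at ht
      rcases hi with hP | ⟨i, n, e, src, cur, hA⟩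
      · rcases (hP.white_move hp ht).2 with ⟨n, e, src, cur, hA⟩ | hP'
        · exact .inr ⟨1, n, e, src, cur, hA⟩
        · exact .inl hP'.2
      · obtain ⟨-, cur', hA'⟩ := hA.white_move hp ht
        exact .inr ⟨_, n, e, src, cur', hA'⟩
    · intro h m hp hi ht hl
      have ht' : h.length % 2 = 1 := by rw [ne_eq, turn_eq_white_iff] at ht; omega
      rcases hi with hP | ⟨i, n, e, src, cur, hA⟩
      · exact .inl (hP.black_move hp ht' hl)
      · by_cases hi : i = 4
        · subst hi
          exact absurd hl ((hA.checkmated hp).2.2 m)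
        · exact .inr ⟨i, n, e, src, cur, hA.black_move hp ht' hi hl⟩
  intro h hp hf ht _
  rw [turn_eq_white_iff] at ht
  rcases key h hp hf with hP | ⟨i, n, e, src, cur, hA⟩
  · exact (hP.white_move hp ht).1
  · exact (hA.white_move hp ht).1

/-- Once white has started an attack, black is checkmated a few moves later. -/
theorem Attack.whiteWins {b : List Move → Move} (hb : start.IsStrategy .black b) :
    ∀ {i n : ℕ} {h : List Move} {e : ℤ} {src cur : Square}, Attack i h n e src cur →
      start.IsPlay h → start.Follows .white whitePlan h → start.Follows .black b h →
      h.length % 2 = 1 → start.WhiteWins whitePlan b := by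
  intro i
  induction hd : 4 - i generalizing i with
  | zero =>
    intro n h e src cur hA hp hw hf hh
    obtain rfl : i = 4 := by
      have := hA.place
      omega
    exact ⟨h, hp, hw, hf, hA.checkmated hp⟩
  | succ d ih =>
    intro n h e src cur hA hp hw hf hh
    have hi : i ≠ 4 := by omega
    have hl := hb h hp hf (turn_eq_black_iff.2 hh) (hA.exists_legal hp hh hi)
    have hA' := hA.black_move hp hh hi hl
    have hp' := isPlay_concat.2 ⟨hp, hl⟩
    have hlen : (h ++ [b h]).length = h.length + 1 := by simp
    have hlen' : (h ++ [b h] ++ [whitePlan (h ++ [b h])]).length = h.length + 2 := by simp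
    obtain ⟨hl', cur', hA''⟩ := hA'.white_move hp' (by omega)
    refine ih (by omega) hA'' (isPlay_concat.2 ⟨hp', hl'⟩) (follows_concat.2
      ⟨follows_concat.2 ⟨hw, fun ht => ?_⟩, fun _ => rfl⟩) (follows_concat.2
      ⟨follows_concat.2 ⟨hf, fun _ => rfl⟩, fun ht => ?_⟩) (by omega)
    · rw [turn_eq_white_iff] at ht; omega
    · rw [turn_eq_black_iff] at ht; omega

/-! ### The plan is computable -/

theorem primrec_gadgetSquare {α : Type*} [Primcodable α] {n : α → ℕ} (hn : Primrec n) (r : ℕ)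
    {y : α → ℤ} (hy : Primrec y) : Primrec fun a => (((8 * n a + r : ℕ) : ℤ), y a) :=
  .pair (primrec_int_natCast.comp (Primrec.nat_add.comp
    (Primrec.nat_mul.comp (Primrec.const 8) hn) (Primrec.const r))) hy

theorem primrec_rightReply : Primrec rightReply :=
  (Primrec.pair (primrec_gadgetSquare Primrec.id 5 (Primrec.const 1))
    (primrec_gadgetSquare Primrec.id 4 (Primrec.const 0))).of_eq fun n => by
      simp [rightReply]

/-- The move of black that answers the `n`-th question. -/
theorem primrec_reply {α : Type*} [Primcodable α] {h : α → List Move} {n : α → ℕ} (hh : Primrec h)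
    (hn : Primrec n) : Primrec fun a => (h a).getI (4 * n a + 1) :=
  Primrec.list_getI.comp hh (Primrec.succ.comp (Primrec.nat_mul.comp (Primrec.const 4) hn))

theorem primrecPred_reply_eq {α : Type*} [Primcodable α] {h : α → List Move} {n : α → ℕ}
    (hh : Primrec h) (hn : Primrec n) :
    PrimrecPred fun a => (h a).getI (4 * n a + 1) = rightReply (n a) :=
  Primrec.eq.comp (primrec_reply hh hn) (primrec_rightReply.comp hn)

theorem primrecRel_opportunity : PrimrecRel fun (m : ℕ) (h : List Move) => Opportunity h m := by
  have hh : Primrec fun p : ℕ × List Move => p.2 := Primrec.snd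
  have hu : Primrec fun p : ℕ × List Move => p.1.unpair := Primrec.unpair.comp Primrec.fst
  have hn : Primrec fun p : ℕ × List Move => p.1.unpair.1 := Primrec.fst.comp hu
  have hs : Primrec fun p : ℕ × List Move => p.1.unpair.2 := Primrec.snd.comp hu
  have hr := primrecPred_reply_eq hh hn
  have hl (v : ℕ) : PrimrecPred fun p : ℕ × List Move => HaltsAt v p.1.unpair.1 p.1.unpair.2 :=
    (primrecPred_haltsAt v).comp hn hs
  exact (Primrec.nat_le.comp (Primrec.nat_add.comp (Primrec.nat_mul.comp (Primrec.const 4) hn)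
    (Primrec.const 4)) (Primrec.list_length.comp hh)).and
      (((hl 0).and hr.not).or ((hl 1).and hr))

theorem primrec_attackMove : Primrec₂ attackMove := by
  have hh : Primrec fun p : List Move × ℕ => p.1 := Primrec.fst
  have hu : Primrec fun p : List Move × ℕ => p.2.unpair := Primrec.unpair.comp Primrec.snd
  have hn : Primrec fun p : List Move × ℕ => p.2.unpair.1 := Primrec.fst.comp hu
  have hy : Primrec fun p : List Move × ℕ => ((p.2.unpair.2 + 1 : ℕ) : ℤ) :=
    primrec_int_natCast.comp (Primrec.succ.comp (Primrec.snd.comp hu))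
  exact Primrec.ite (primrecPred_reply_eq hh hn)
    (.pair (primrec_gadgetSquare hn 7 hy) (primrec_gadgetSquare hn 7 (Primrec.const 0)))
    (.pair (primrec_gadgetSquare hn 1 hy) (primrec_gadgetSquare hn 1 (Primrec.const 0)))

theorem primrec_quietMove : Primrec quietMove := by
  have hL : Primrec fun h : List Move => h.length := Primrec.list_length
  have hn : Primrec fun h : List Move => h.length / 4 :=
    Primrec.nat_div.comp hL (Primrec.const 4)
  have sq (r : ℕ) (y : ℤ) : Primrec fun h : List Move =>
      (((8 * (h.length / 4) + r : ℕ) : ℤ), y) := primrec_gadgetSquare hn r (Primrec.const y)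
  exact Primrec.ite (Primrec.eq.comp (Primrec.nat_mod.comp hL (Primrec.const 4)) (Primrec.const 0))
    (.pair (sq 4 (-1)) (sq 4 0)) (Primrec.ite
      (Primrec.eq.comp (Primrec.snd.comp (primrec_reply Primrec.id hn)) (sq 4 0))
      (.pair (sq 4 5) (sq 4 6)) (.pair (sq 4 0) (sq 3 1)))

theorem primrec_planMove : Primrec planMove := by
  classical
  have h1 : Primrec fun h : List Move => (List.range h.length).filter fun m => Opportunity h m :=
    (primrecRel_opportunity.listFilter).comp (Primrec.list_range.comp Primrec.list_length)
      Primrec.id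
  exact (Primrec.option_getD.comp (Primrec.option_map (Primrec.list_head?.comp h1)
    primrec_attackMove) primrec_quietMove).of_eq fun h => by simp only [planMove]

theorem primrec_lastWhite : Primrec lastWhite :=
  Primrec.snd.comp (Primrec.list_getI.comp Primrec.id (Primrec.nat_mul.comp
    (Primrec.nat_div.comp (Primrec.nat_sub.comp Primrec.list_length (Primrec.const 1))
      (Primrec.const 2)) (Primrec.const 2)))

theorem computable_whitePlan : Computable whitePlan := by
  have hl := primrec_lastWhite
  have hx : Primrec fun h => (lastWhite h).1 := Primrec.fst.comp hl
  have hy : Primrec fun h => (lastWhite h).2 := Primrec.snd.comp hl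
  have h0 : PrimrecPred fun h => (lastWhite h).2 = 0 := Primrec.eq.comp hy (Primrec.const 0)
  have hm (r : ℕ) : PrimrecPred fun h => (lastWhite h).1.toNat % 8 = r :=
    Primrec.eq.comp (Primrec.nat_mod.comp (primrec_int_toNat.comp hx) (Primrec.const 8))
      (Primrec.const r)
  have hd : Primrec fun h : List Move => -((h.length + 5 : ℕ) : ℤ) :=
    primrec_int_neg.comp (primrec_int_natCast.comp
      (Primrec.nat_add.comp Primrec.list_length (Primrec.const 5)))
  have h1 : Primrec fun _ : List Move => (1 : ℤ) := Primrec.const 1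
  have hz : Primrec fun _ : List Move => (0 : ℤ) := Primrec.const 0
  exact (Primrec.ite (primrec_int_lt.comp hy hz) (.pair hl (.pair (Primrec.const (-10)) hy))
    (Primrec.ite (h0.and ((hm 2).or (hm 6))) (.pair hl (.pair hx hd))
      (Primrec.ite (h0.and (hm 1)) (.pair hl (.pair (primrec_int_add.comp hx h1) hz))
        (Primrec.ite (h0.and (hm 7)) (.pair hl (.pair (primrec_int_sub.comp hx h1) hz))
          primrec_planMove)))).to_comp

/-! ### The plan defeats every computable strategy -/

/-- The first `n` moves of the play of white's plan against `b`. -/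
noncomputable def planPlay (b : List Move → Move) : ℕ → List Move
  | 0 => []
  | n + 1 => planPlay b n ++ [bif n % 2 == 0 then whitePlan (planPlay b n) else b (planPlay b n)]

section PlanPlay

variable {b : List Move → Move}

theorem length_planPlay (n : ℕ) : (planPlay b n).length = n := by
  induction n with
  | zero => rfl
  | succ n ih => simp [planPlay, ih]

theorem getI_planPlay {k n n' : ℕ} (h : k < n) (h' : n ≤ n') :
    (planPlay b n').getI k = (planPlay b n).getI k := by
  induction n', h' using Nat.le_induction with
  | base => rfl
  | succ m hm ih => rw [planPlay, getI_concat_of_lt (by rw [length_planPlay]; omega), ih]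

theorem computable_planPlay (hb : Computable b) : Computable (planPlay b) := by
  have hI : Computable fun p : ℕ × ℕ × List Move => p.2.2 :=
    (Primrec.snd.comp Primrec.snd).to_comp
  have hc : Computable fun p : ℕ × ℕ × List Move => p.2.1 % 2 == 0 :=
    (Primrec.beq.comp (Primrec.nat_mod.comp (Primrec.fst.comp Primrec.snd) (Primrec.const 2))
      (Primrec.const 0)).to_comp
  refine (Computable.nat_rec Computable.id (Computable.const ([] : List Move))
    (Computable.list_concat.comp hI
      (Computable.cond hc (computable_whitePlan.comp hI) (hb.comp hI))).to₂).of_eq fun n => ?_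
  induction n with
  | zero => rfl
  | succ n ih => exact congrArg (fun l => l ++ [bif n % 2 == 0 then whitePlan l else b l]) ih

/-- If white's plan does not win against `b`, then white waits for an opportunity forever. -/
theorem planInv_planPlay (hb : start.IsStrategy .black b) (hno : ¬ start.WhiteWins whitePlan b)
    (n : ℕ) : (start.IsPlay (planPlay b n) ∧ start.Follows .white whitePlan (planPlay b n) ∧
      start.Follows .black b (planPlay b n) ∧ PlanInv (planPlay b n)) ∧
    (n % 2 = 0 → ∀ m < n, ¬ Opportunity (planPlay b n) m) := by
  induction n with
  | zero => exact ⟨⟨trivial, follows_nil, follows_nil, planInv_nil⟩, by simp⟩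
  | succ n ih =>
    obtain ⟨⟨hp, hw, hf, hP⟩, -⟩ := ih
    have hlen := length_planPlay (b := b) n
    have hlen' := length_planPlay (b := b) (n + 1)
    rcases Nat.mod_two_eq_zero_or_one n with hn | hn
    · have e : planPlay b (n + 1) = planPlay b n ++ [whitePlan (planPlay b n)] := by
        simp [planPlay, hn]
      have hm := hP.white_move hp (by omega)
      rw [← e] at hm
      have hp' : start.IsPlay (planPlay b (n + 1)) := by
        rw [e]
        exact isPlay_concat.2 ⟨hp, hm.1⟩
      have hw' : start.Follows .white whitePlan (planPlay b (n + 1)) := by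
        rw [e]
        exact follows_concat.2 ⟨hw, fun _ => rfl⟩
      have hf' : start.Follows .black b (planPlay b (n + 1)) := by
        rw [e]
        refine follows_concat.2 ⟨hf, fun ht => ?_⟩
        rw [turn_eq_black_iff] at ht
        omega
      rcases hm.2 with ⟨k, e, src, cur, hA⟩ | ⟨-, hP'⟩
      · exact absurd (hA.whiteWins hb hp' hw' hf' (by omega)) hno
      · exact ⟨⟨hp', hw', hf', hP'⟩, by omega⟩
    · have e : planPlay b (n + 1) = planPlay b n ++ [b (planPlay b n)] := by
        simp [planPlay, hn]
      have hl := hb _ hp hf (turn_eq_black_iff.2 (by omega)) (hP.exists_legal hp (by omega))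
      have hP' := hP.black_move hp (by omega) hl
      have hp' : start.IsPlay (planPlay b (n + 1)) := by
        rw [e]
        exact isPlay_concat.2 ⟨hp, hl⟩
      have hw' : start.Follows .white whitePlan (planPlay b (n + 1)) := by
        rw [e]
        refine follows_concat.2 ⟨hw, fun ht => ?_⟩
        rw [turn_eq_white_iff] at ht
        omega
      have hf' : start.Follows .black b (planPlay b (n + 1)) := by
        rw [e]
        exact follows_concat.2 ⟨hf, fun _ => rfl⟩
      rw [← e] at hP'
      refine ⟨⟨hp', hw', hf', hP'⟩, fun _ m hm ho => ?_⟩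
      -- otherwise white would seize the opportunity
      have hm2 := hP'.white_move hp' (by omega)
      rcases hm2.2 with ⟨k, e', src, cur, hA⟩ | ⟨hnone, -⟩
      · refine hno (hA.whiteWins hb (isPlay_concat.2 ⟨hp', hm2.1⟩)
          (follows_concat.2 ⟨hw', fun _ => rfl⟩) (follows_concat.2 ⟨hf', fun ht => ?_⟩) ?_)
        · rw [turn_eq_black_iff] at ht
          omega
        · rw [List.length_append, List.length_singleton]
          omega
      · exact hnone m (by omega) ho

end PlanPlay

/-- White's plan wins against every computable strategy `b`. Otherwise the function that tells how
`b` answers the questions is computable, and the question about a program of this function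
yields an opportunity. -/
theorem whiteWins_whitePlan {b : List Move → Move} (hb : start.IsStrategy .black b)
    (hc : Computable b) : start.WhiteWins whitePlan b := by
  by_contra hno
  have hplay := computable_planPlay hc
  have hd : Computable fun n =>
      bif decide ((planPlay b (4 * n + 2)).getI (4 * n + 1) = rightReply n) then 1 else 0 := by
    have h1 : Primrec fun n : ℕ => 4 * n := Primrec.nat_mul.comp (Primrec.const 4) Primrec.id
    have h2 : Computable fun n : ℕ => 4 * n + 2 :=
      (Primrec.nat_add.comp h1 (Primrec.const 2)).to_comp
    have h3 : Computable fun n : ℕ => 4 * n + 1 := (Primrec.succ.comp h1).to_comp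
    have h4 : Computable fun n => planPlay b (4 * n + 2) := hplay.comp h2
    have h5 : Computable fun n => (planPlay b (4 * n + 2)).getI (4 * n + 1) :=
      Primrec.list_getI.to_comp.comp h4 h3
    exact Computable.cond (Primrec.eq.decide.to_comp.comp h5 primrec_rightReply.to_comp)
      (Computable.const 1) (Computable.const 0)
  obtain ⟨c, hcode⟩ := Code.exists_code.1 (Partrec.nat_iff.1 hd.partrec)
  obtain ⟨e, rfl⟩ : ∃ e, Denumerable.ofNat Code e = c :=
    ⟨Encodable.encode c, Denumerable.ofNat_encode c⟩
  obtain ⟨v, hv⟩ : ∃ v, v = (bif decide ((planPlay b (4 * e + 2)).getI (4 * e + 1) = rightReply e)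
      then 1 else 0) := ⟨_, rfl⟩
  -- the step at which the program outputs the answer of `b` to the question about itself
  have hex : ∃ k, Code.evaln k (Denumerable.ofNat Code e) e = some v := by
    refine Code.evaln_complete.1 ?_
    rw [hcode, hv]
    exact Part.mem_some _
  obtain ⟨s, hs⟩ : ∃ s, HaltsAt v e s := by
    classical
    have h0 : Nat.find hex ≠ 0 := by
      intro h
      have := Nat.find_spec hex
      rw [h] at this
      simp [Code.evaln] at this
    obtain ⟨s, hs⟩ := Nat.exists_eq_succ_of_ne_zero h0
    have h1 := Nat.find_spec hex
    refine ⟨s, by rw [hs] at h1; exact h1, ?_⟩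
    rcases h2 : Code.evaln s (Denumerable.ofNat Code e) e with _ | a
    · rfl
    · have h3 := Code.evaln_mono (show s ≤ Nat.find hex by omega) h2
      rw [h1] at h3
      cases h3
      exact absurd h2 (Nat.find_min hex (by omega))
  -- a stage with white to move that is late enough for the search to find the opportunity
  obtain ⟨L, hL⟩ : ∃ L, L = 2 * Nat.pair e s + 4 * e + 4 := ⟨_, rfl⟩
  refine (planInv_planPlay hb hno L).2 (by omega) (Nat.pair e s) (by omega) ?_
  rw [Opportunity, Nat.unpair_pair, length_planPlay]
  refine ⟨by dsimp only; omega, ?_⟩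
  dsimp only
  rw [getI_planPlay (n := 4 * e + 2) (by omega) (by omega)]
  by_cases hr : (planPlay b (4 * e + 2)).getI (4 * e + 1) = rightReply e
  · rw [decide_eq_true hr, cond_true] at hv
    exact .inr ⟨hv ▸ hs, hr⟩
  · rw [decide_eq_false hr, cond_false] at hv
    exact .inl ⟨hv ▸ hs, hr⟩

end InfiniteChess

open InfiniteChess in
theorem mainTheorem4 :
    ∃ p : Position, p.Proper ∧
      -- the position is computable, and so is its game tree
      Computable p.board ∧ ComputablePred p.IsPlay ∧
      -- computable play: a win for white, where black does have computable strategies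
      (∃ b, p.IsStrategy .black b ∧ Computable b) ∧
      (∃ w, p.IsStrategy .white w ∧ Computable w ∧
        ∀ b, p.IsStrategy .black b → Computable b → p.WhiteWins w b) ∧
      -- arbitrary play: neither player has a winning strategy
      (¬ ∃ w, p.IsStrategy .white w ∧ ∀ b, p.IsStrategy .black b → p.WhiteWins w b) ∧
      (¬ ∃ b, p.IsStrategy .black b ∧ ∀ w, p.IsStrategy .white w → p.BlackWins w b) ∧
      -- arbitrary play: either player can force a draw
      (∃ w, p.IsStrategy .white w ∧ ∀ b, p.IsStrategy .black b → p.IsDraw w b) ∧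
      (∃ b, p.IsStrategy .black b ∧ ∀ w, p.IsStrategy .white w → p.IsDraw w b) := by
  refine ⟨start, ⟨fun c s t hs ht => ?_, (cageInv_after (h := []) trivial).2 rfl⟩,
    primrec_startBoard.to_comp, computablePred_isPlay,
    ⟨greedyBlack, isStrategy_greedyBlack, computable_greedyBlack⟩,
    ⟨whitePlan, isStrategy_whitePlan, computable_whitePlan, fun b => whiteWins_whitePlan⟩,
    fun ⟨w, _, hw⟩ => (isDraw_guardBlack w).1 (hw _ isStrategy_guardBlack),
    fun ⟨b, _, hb⟩ => not_blackWins _ _ (hb _ isStrategy_idleWhite),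
    ⟨idleWhite, isStrategy_idleWhite, fun b _ => isDraw_idleWhite b⟩,
    ⟨guardBlack, isStrategy_guardBlack, fun w _ => isDraw_guardBlack w⟩⟩
  cases c with
  | white => exact absurd hs (cageInv_startBoard.not_whiteKing s)
  | black =>
    rw [cageInv_startBoard.blackKing_iff.1 hs, cageInv_startBoard.blackKing_iff.1 ht]
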